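/- Let $\mathsf A$ be a finite-dimensional complex Hilbert space of dimension $|A|$, let $\mathsf C,\mathsf E$ be separable (possibly infinite-dimensional) complex Hilbert spaces, let $\rho_{AE}$ be a density operator on $\mathsf A\otimes\mathsf E$, and let $\mathcal T_{A\to C}$ be a quantum channel (a completely positive, trace-preserving map). Fix an orthonormal basis $(|i\rangle)_i$ of $\mathsf A$, let $\mathsf A'$ be a copy of $\mathsf A$, put $\Phi_{A'A}=\frac1{|A|}\sum_{i,j}|i\rangle\langle j|\otimes|i\rangle\langle j|$, and let $\omega_{A'C}=(\mathrm{id}_{A'}\otimes\mathcal T_{A\to C})(\Phi_{A'A})$ be the Choi state, with marginal $\omega_C$. Write $\|X\|_\alpha=(\operatorname{Tr}|X|^\alpha)^{1/\alpha}$, and let $\log$ be the natural logarithm. For a state $\tau_{AB}$, with $\mathsf A$ finite-dimensional, let $$H(A|B)_\tau=-\operatorname{Tr}\big[\tau_{AB}(\log\tau_{AB}-\log(\mathbb 1_A\otimes\tau_B))\big],$$ where for infinite-dimensional $\mathsf B$ the trace is evaluated through the spectral decompositions $\tau_{AB}=\sum_s sP_s$, $\mathbb 1_A\otimes\tau_B=\sum_t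 tQ_t$ as the absolutely convergent sum $\sum_{s,t>0}\operatorname{Tr}[Q_tP_sQ_t]\,s(\log s-\log t)$. For $\alpha\in(1,2]$ let $$H^*_\alpha(A|B)_\tau=-\frac{\alpha}{\alpha-1}\log\inf_{\sigma_B}\Big\|\big(\mathbb 1_A\otimes\sigma_B^{-\frac{\alpha-1}{2\alpha}}\big)\,\tau_{AB}\,\big(\mathbb 1_A\otimes\sigma_B^{-\frac{\alpha-1}{2\alpha}}\big)\Big\|_\alpha ,$$ the infimum being over density operators $\sigma_B$ on $\mathsf B$, where the sandwiched operator means a bounded $Y$ with $(\mathbb 1_A\otimes\sigma_B^{\frac{\alpha-1}{2\alpha}})\,Y\,(\mathbb 1_A\otimes\sigma_B^{\frac{\alpha-1}{2\alpha}})=\tau_{AB}$, of least norm when $Y$ is not unique, and $\sigma_B$ contributes $+\infty$ when there is no such $Y$. Set $H^*_1=H$. Then, with $\mathbf E_U$ the expectation over the Haar probability measure of the unitary group of $\mathsf A$, $$\frac12\,\mathbf E_U\Big\|(\mathcal T_{A\to C}\otimes\mathrm{id}_E)\big((U\otimes\mathbb 1_E)\rho_{AE}(U^\dagger\otimes\mathbb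 1_E)\big)-\omega_C\otimes\rho_E\Big\|_1\le\exp\Big[\frac{1-\alpha}{\alpha}\big(H^*_\alpha(A'|C)_\omega+H^*_\alpha(A|E)_\rho+\log 3\big)\Big]\qquad\text{for every }\alpha\in[1,2].$$ Moreover, $$\sup_{\alpha\in[1,2]}\frac{\alpha-1}{\alpha}\big(H^*_\alpha(A|E)_\rho+H^*_\alpha(A'|C)_\omega\big)>0\iff H(A'|C)_\omega+H(A|E)_\rho>0 .$$ -/

import Mathlib

open MeasureTheory TensorProduct UniformSpace
open scoped InnerProductSpace ENNReal CStarAlgebra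

noncomputable section

namespace Decoupling

universe u v w

section Operators

variable {H : Type u} [NormedAddCommGroup H] [InnerProductSpace ℂ H]

/-- The trace `Tr T ∈ [0, ∞]` of a positive bounded operator `T`: the supremum of
`∑ v ∈ s, ⟨v, T v⟩` over the finite orthonormal families `s`. It equals `∑ i, ⟨e i, T (e i)⟩` for
every Hilbert basis `e`, see `trace_eq_tsum`. It is only ever applied to positive operators. -/
def trace (T : H →L[ℂ] H) : ℝ≥0∞ :=
  ⨆ s : {s : Finset H // Orthonormal ℂ ((↑) : s → H)},
    ∑ v ∈ s.1, ENNReal.ofReal (RCLike.re ⟪v, T v⟫_ℂ)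

variable [CompleteSpace H]

/-- For a positive operator the trace is the sum of the diagonal in any Hilbert basis. -/
theorem trace_eq_tsum {ι : Type*} (e : HilbertBasis ι ℂ H) (T : H →L[ℂ] H) (hT : 0 ≤ T) :
    trace T = ∑' i, ENNReal.ofReal (RCLike.re ⟪e i, T (e i)⟫_ℂ) := by
  classical
  obtain ⟨S, hS, rfl⟩ : ∃ S : H →L[ℂ] H, IsSelfAdjoint S ∧ S * S = T :=
    ⟨CFC.sqrt T, (CFC.sqrt_nonneg T).isSelfAdjoint, CFC.sqrt_mul_sqrt_self T hT⟩
  have adj : ∀ x y : H, ⟪S x, y⟫_ℂ = ⟪x, S y⟫_ℂ := fun x y => by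
    have h := ContinuousLinearMap.adjoint_inner_left S y x
    rwa [← ContinuousLinearMap.star_eq_adjoint, hS.star_eq] at h
  have key : ∀ x : H, ENNReal.ofReal (RCLike.re ⟪x, (S * S) x⟫_ℂ) = ‖S x‖ₑ ^ 2 := fun x => by
    rw [mul_apply_eq_comp, ← adj, inner_self_eq_norm_sq (𝕜 := ℂ),
      ENNReal.ofReal_pow (norm_nonneg _), ofReal_norm]
  have parseval : ∀ y : H, ‖y‖ₑ ^ 2 = ∑' i, ‖⟪e i, y⟫_ℂ‖ₑ ^ 2 := fun y => by
    have h := e.hasSum_inner_mul_inner y y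
    have h2 : HasSum (fun i => ‖⟪e i, y⟫_ℂ‖ ^ 2) (‖y‖ ^ 2) := by
      have h3 := (RCLike.hasSum_re ℂ h)
      rw [inner_self_eq_norm_sq (𝕜 := ℂ)] at h3
      convert h3 using 2 with i
      rw [← inner_conj_symm y (e i), RCLike.conj_mul, ← RCLike.ofReal_pow, RCLike.ofReal_re]
    rw [← ofReal_norm, ← ENNReal.ofReal_pow (norm_nonneg _), ← h2.tsum_eq,
      ENNReal.ofReal_tsum_of_nonneg (fun _ => by positivity) h2.summable]
    congr 1; funext i
    rw [ENNReal.ofReal_pow (norm_nonneg _), ofReal_norm]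
  have swap : ∀ x y : H, ‖⟪x, S y⟫_ℂ‖ₑ = ‖⟪y, S x⟫_ℂ‖ₑ := fun x y => by
    rw [← adj, ← ofReal_norm, ← ofReal_norm, norm_inner_symm]
  simp only [trace, key]
  apply le_antisymm
  · refine iSup_le fun ⟨s, hs⟩ => ?_
    calc ∑ v ∈ s, ‖S v‖ₑ ^ 2 = ∑ v ∈ s, ∑' i, ‖⟪e i, S v⟫_ℂ‖ₑ ^ 2 :=
          Finset.sum_congr rfl fun v _ => parseval _
      _ = ∑' i, ∑ v ∈ s, ‖⟪e i, S v⟫_ℂ‖ₑ ^ 2 :=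
          (Summable.tsum_finsetSum fun _ _ => ENNReal.summable).symm
      _ ≤ ∑' i, ‖S (e i)‖ₑ ^ 2 := by
          refine ENNReal.tsum_le_tsum fun i => ?_
          have hb := hs.sum_inner_products_le (S (e i)) (s := Finset.univ)
          rw [← ofReal_norm, ← ENNReal.ofReal_pow (norm_nonneg _)]
          refine le_trans (le_of_eq ?_) (ENNReal.ofReal_le_ofReal hb)
          rw [ENNReal.ofReal_sum_of_nonneg (fun _ _ => by positivity),
            Finset.univ_eq_attach,
            Finset.sum_attach s (fun v => ENNReal.ofReal (‖⟪v, S (e i)⟫_ℂ‖ ^ 2))]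
          refine Finset.sum_congr rfl fun v _ => ?_
          rw [swap, ENNReal.ofReal_pow (norm_nonneg _), ofReal_norm]
  · rw [ENNReal.tsum_eq_iSup_sum]
    refine iSup_le fun t => ?_
    have ho : Orthonormal ℂ (Subtype.val : {x // x ∈ Finset.image (fun i => e i) t} → H) := by
      have := e.orthonormal.toSubtypeRange
      have hsub : (Finset.image (fun i => e i) t : Set H) ⊆ Set.range e := by
        intro x hx
        simp only [Finset.coe_image] at hx
        exact Set.image_subset_range _ _ hx
      exact this.comp (Set.inclusion hsub) (Set.inclusion_injective hsub)
    refine le_trans (le_of_eq ?_)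
      (le_iSup (fun s : {s : Finset H // Orthonormal ℂ ((↑) : s → H)} =>
        ∑ v ∈ s.1, ‖S v‖ₑ ^ 2) ⟨Finset.image (fun i => e i) t, ho⟩)
    exact (Finset.sum_image (f := fun v => ‖S v‖ₑ ^ 2) (g := fun i => e i)
      (e.orthonormal.linearIndependent.injective.injOn)).symm

/-- A density operator (state): positive with trace one. -/
def IsDensity (ρ : H →L[ℂ] H) : Prop := 0 ≤ ρ ∧ trace ρ = 1

/-- The Schatten norm `‖X‖_α = (Tr |X|^α)^(1/α) ∈ [0, ∞]`. -/
def schattenNorm (α : ℝ) (X : H →L[ℂ] H) : ℝ≥0∞ :=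
  (trace ((CFC.abs X) ^ α)) ^ (1 / α)

/-- The orthogonal projection onto the eigenspace `{x | T x = t x}`. -/
def eigenProj (T : H →L[ℂ] H) (t : ℝ) : H →L[ℂ] H :=
  (T - (t : ℂ) • (1 : H →L[ℂ] H)).ker.starProjection

end Operators

section Tensor

/-- The Hilbert space tensor product: the completion of the algebraic tensor product for the inner
product determined by `⟨a ⊗ b, a' ⊗ b'⟩ = ⟨a, a'⟩ ⟨b, b'⟩`. -/
abbrev HTensor (A : Type u) (B : Type v) [NormedAddCommGroup A] [InnerProductSpace ℂ A]
    [NormedAddCommGroup B] [InnerProductSpace ℂ B] : Type (max u v) :=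
  Completion (A ⊗[ℂ] B)

variable {A : Type u} {B : Type v} {C : Type w}
  [NormedAddCommGroup A] [InnerProductSpace ℂ A]
  [NormedAddCommGroup B] [InnerProductSpace ℂ B]
  [NormedAddCommGroup C] [InnerProductSpace ℂ C]

/-- The bounded operator `S ⊗ R` on the Hilbert space tensor product. -/
def opTensor (S : A →L[ℂ] A) (R : B →L[ℂ] B) : HTensor A B →L[ℂ] HTensor A B :=
  (TensorProduct.mapL S R).completion

/-- The operator `|a⟩ ⊗ 1 : B → A ⊗ B`, `b ↦ a ⊗ b`. -/
def ketTensor (a : A) : B →L[ℂ] HTensor A B :=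
  Completion.toComplL ∘L TensorProduct.mkL ℂ A B a

variable [CompleteSpace B]

/-- The block `(⟨a| ⊗ 1) X (|a'⟩ ⊗ 1)`, an operator on `B`. -/
def block (X : HTensor A B →L[ℂ] HTensor A B) (a a' : A) : B →L[ℂ] B :=
  (ContinuousLinearMap.adjoint (ketTensor a)) ∘L X ∘L (ketTensor a')

variable [FiniteDimensional ℂ A]

/-- The partial trace `X_B = Tr_A X_{AB}` over the finite-dimensional first factor. -/
def partialTrace (X : HTensor A B →L[ℂ] HTensor A B) : B →L[ℂ] B :=
  ∑ i, block X (stdOrthonormalBasis ℂ A i) (stdOrthonormalBasis ℂ A i)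

/-- The ampliation `T_{A → C} ⊗ id_B`: writing `X = ∑ i j, |i⟩⟨j| ⊗ X i j`, it sends `X` to
`∑ i j, T(|i⟩⟨j|) ⊗ X i j`. -/
def ampliation (T : (A →L[ℂ] A) →ₗ[ℂ] (C →L[ℂ] C)) (X : HTensor A B →L[ℂ] HTensor A B) :
    HTensor C B →L[ℂ] HTensor C B :=
  ∑ i, ∑ j,
    opTensor
      (T (InnerProductSpace.rankOne ℂ (stdOrthonormalBasis ℂ A i) (stdOrthonormalBasis ℂ A j)))
      (block X (stdOrthonormalBasis ℂ A i) (stdOrthonormalBasis ℂ A j))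

end Tensor

section Channels

variable {A : Type u} {C : Type w}
  [NormedAddCommGroup A] [InnerProductSpace ℂ A] [CompleteSpace A]
  [NormedAddCommGroup C] [InnerProductSpace ℂ C] [CompleteSpace C]

/-- A completely positive map is a quantum channel if it preserves the trace. By linearity it is
enough to ask this for positive operators. -/
def IsChannel (T : (A →L[ℂ] A) →CP (C →L[ℂ] C)) : Prop :=
  ∀ X : A →L[ℂ] A, 0 ≤ X → trace (T X) = trace X

/-- The normalized Choi operator `ω_{A'C} = (id_{A'} ⊗ T)(Φ_{A'A})` on `A' ⊗ C`, where `A'` is a copy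
of `A` and `Φ = (1/|A|) ∑ i j, |i⟩⟨j| ⊗ |i⟩⟨j|` is the maximally entangled state for the orthonormal
basis `b` of `A`. -/
def choi {ι : Type*} [Fintype ι] (b : OrthonormalBasis ι ℂ A)
    (T : (A →L[ℂ] A) →CP (C →L[ℂ] C)) : HTensor A C →L[ℂ] HTensor A C :=
  ((Fintype.card ι : ℂ)⁻¹) •
    ∑ i, ∑ j, opTensor (InnerProductSpace.rankOne ℂ (b i) (b j))
      (T (InnerProductSpace.rankOne ℂ (b i) (b j)))

end Channels

section Entropies

variable {A : Type u} {B : Type v}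
  [NormedAddCommGroup A] [InnerProductSpace ℂ A] [FiniteDimensional ℂ A]
  [NormedAddCommGroup B] [InnerProductSpace ℂ B] [CompleteSpace B]

/-- The infimum over states `σ` on `B` of `‖(1 ⊗ σ^{-s}) ρ (1 ⊗ σ^{-s})‖_α`, `s = 1/(2α')`, where
`1/α + 1/α' = 1`, i.e. `s = (α - 1)/(2α)`. As `σ^{-s}` is unbounded in general, the operator
`Y = (1 ⊗ σ^{-s}) ρ (1 ⊗ σ^{-s})` is expressed by the equation `(1 ⊗ σ^s) Y (1 ⊗ σ^s) = ρ`: when `σ`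
is injective, `Y` is unique; in general, the solution of least norm is the one given by the
generalized inverse of `σ^s`, and there is none when the support of `ρ` is not covered, in which
case `σ` contributes `∞`. -/
def sandwichedNorm (α : ℝ) (ρ : HTensor A B →L[ℂ] HTensor A B) : ℝ≥0∞ :=
  ⨅ (σ : B →L[ℂ] B) (_ : IsDensity σ) (Y : HTensor A B →L[ℂ] HTensor A B)
    (_ : opTensor (1 : A →L[ℂ] A) (σ ^ ((α - 1) / (2 * α))) * Y *
      opTensor (1 : A →L[ℂ] A) (σ ^ ((α - 1) / (2 * α))) = ρ),
    schattenNorm α Y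

/-- The conditional entropy `H(A|B)_ρ = - Tr[ρ_{AB} (log ρ_{AB} - log (1_A ⊗ ρ_B))]` of a state.
With the spectral decompositions `ρ_{AB} = ∑ s, s P_s` and `1_A ⊗ ρ_B = ∑ t, t Q_t` this trace is the
absolutely convergent sum of `Tr[Q_t P_s Q_t] s (log s - log t)` over the pairs `(s, t)`. (The
terms with `s = 0` vanish, and so do those with `t = 0`, because the support of `ρ_{AB}` is contained
in that of `1_A ⊗ ρ_B`.) -/
def condEntropy (ρ : HTensor A B →L[ℂ] HTensor A B) : ℝ :=
  - ∑' p : ℝ × ℝ,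
      (trace (eigenProj (opTensor (1 : A →L[ℂ] A) (partialTrace ρ)) p.2 * eigenProj ρ p.1 *
        eigenProj (opTensor (1 : A →L[ℂ] A) (partialTrace ρ)) p.2)).toReal *
      (p.1 * (Real.log p.1 - Real.log p.2))

/-- The sandwiched Rényi conditional entropy
`H*_α(A|B)_ρ = - α' log inf_σ ‖(1 ⊗ σ^{-1/(2α')}) ρ (1 ⊗ σ^{-1/(2α')})‖_α`, with `α' = α/(α - 1)`, for
`α > 1`; at `α = 1` it is the limiting value `H(A|B)_ρ`. For a state `ρ` with `A` finite-dimensional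
the infimum is positive and finite. -/
def sandwichedCondEntropy (α : ℝ) (ρ : HTensor A B →L[ℂ] HTensor A B) : ℝ :=
  if α = 1 then condEntropy ρ
  else - (α / (α - 1)) * Real.log (sandwichedNorm α ρ).toReal

end Entropies

section Haar

variable (A : Type u) [NormedAddCommGroup A] [InnerProductSpace ℂ A] [CompleteSpace A]
  [FiniteDimensional ℂ A]

instance compactSpace_unitary : CompactSpace (unitary (A →L[ℂ] A)) := by
  have : FiniteDimensional ℂ (A →L[ℂ] A) := inferInstance
  have : ProperSpace (A →L[ℂ] A) := FiniteDimensional.proper ℂ _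
  refine isCompact_iff_compactSpace.mp (Metric.isCompact_of_isClosed_isBounded ?_ ?_)
  · exact isClosed_unitary
  · refine (Metric.isBounded_closedBall (x := (0 : A →L[ℂ] A)) (r := 1)).subset fun U hU => ?_
    rw [mem_closedBall_zero_iff]
    nontriviality (A →L[ℂ] A)
    exact (CStarRing.norm_of_mem_unitary hU).le

/-- The Haar probability measure on the unitary group of `A`. -/
def haarUnitary : Measure (unitary (A →L[ℂ] A)) :=
  Measure.haarMeasure ⊤

end Haar

end Decoupling

end

/-!
Write `u = (α - 1) / α` and `d = |A|`. In the basis `b`, with blocks `ω_{ij}` of the Choi state and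
`ρ_{kl}` of `ρ`, the operator inside the trace norm is `∑ g_{ijkl}(U) ω_{ij} ⊗ ρ_{kl}` for scalar
functions `g_{ijkl}` of the unitary (`ampliation_sub_eq_sum`). It is therefore bilinear in the pair
`(ω, ρ)`, has mean zero, and makes sense for arbitrary operators in place of the two states.

**The decoupling bound.** Suppose that `ω = (1 ⊗ σ₁^(u/2)) Y₁ (1 ⊗ σ₁^(u/2))` and
`ρ = (1 ⊗ σ₂^(u/2)) Y₂ (1 ⊗ σ₂^(u/2))` for states `σ₁`, `σ₂`. Replacing the power of each `σ` by
`σ^(z/4)` and the singular values `y` of each `Y` by `y^(α (1 - z/2))` embeds the pair into an analytic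
family over the strip `0 ≤ re z ≤ 1`, which at `z = 2u` returns to `(ω, ρ)`. On `re z = 0` the expected
trace norm is at most `2 ‖Y₁‖_α^α ‖Y₂‖_α^α`: by the triangle inequality only rank-one arguments
matter, for which the first moments of the Haar measure suffice
(`integral_norm_traceForm_le_two_mul`). On `re z = 1` Hölder's inequality reduces it to a
Hilbert–Schmidt norm, and the second moments give the constant `√(4/3)`, because the functional
`d Tr (w U r U⋆)` has variance at most `d² / (d² - 1) ≤ 4/3` times `‖w‖₂² ‖r‖₂²`
(`integral_norm_traceForm_le_sqrt`, `integral_norm_sub_sq_le`). Hadamard's three lines theorem at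
`z = 2u` produces the constant `2^(1 - 2u) (4/3)^u = 2 · 3^(-u)` and the norms `‖Y₁‖_α ‖Y₂‖_α`
(`integral_norm_traceForm_le`). The interpolation is carried out for finite matrices, where the trace
norm is that of a functional on bounded operators and everything is a finite sum of exponentials;
lower semicontinuity of the trace norm and Fatou's lemma extend the result to infinite dimensions
(`lintegral_schattenNorm_decouplingOp_le`). The infimum over `σ₁`, `σ₂` yields the exponents
`H*_α` for `α > 1`, and `α = 1` follows by letting `α` decrease to `1`.

**The Rényi entropies near `α = 1`.** Both halves of the equivalence, and the limit just mentioned,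
rest on the two-sided estimate `H - K u ≤ H*_α ≤ H` for `1 < α ≤ 2`, with `K` independent of `α`. Let
`e i` and `h j` be eigenbases of `ρ_{AB}` and `1 ⊗ ρ_B` with eigenvalues `s i` and `t j`. Then
`p_{ij} = s i |⟨e i, h j⟩|²` is a probability distribution, and `-H` is the mean of
`L_{ij} = log (s i) - log (t j)`. Both `∑ p e^L ≤ d` and `∑ p e^(-L) ≤ d` are finite, the first because
`ρ_{AB} ≤ d (1 ⊗ ρ_B)`; hence `∑ p e^(uL) ≤ 1 - u H + O(u²)` (`SpectralPair.exists_moment_le`).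

* Lower bound (`exists_sandwichedNorm_le`): the choice `σ_B = ρ_B` is feasible, with
  `‖Y‖_α^α ≤ d^(u(α-1)) ∑ p e^(uL)`. Here `Y = V⋆ ρ_{AB}^(1-u) V`, where the bounded operator
  `V` sends `(1 ⊗ ρ_B)^(u/2) x` to `ρ_{AB}^(u/2) x`, and operator monotonicity of `x ↦ x^(α-1)` replaces
  the Araki–Lieb–Thirring inequality (`exists_sandwiched_schattenNorm_le`).
* Upper bound (`exp_neg_condEntropy_le_schattenNorm`): for every feasible pair `(σ_B, Y)` duality
  gives `Tr ρ^(1+u) σ^(-u) ≤ ‖Y‖_α` (`tsum_le_schattenNorm`). By convexity of the exponential the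
  left-hand side is at least `e^(uD)` for `D = -H`, once the cross entropy with `σ_B` is known to
  dominate the one with `ρ_B`. As the entropy of `ρ_B` may be infinite, that comparison is made for
  finitely many eigenvectors of `ρ_{AB}` at a time, with the missing mass as error term
  (`sum_crossEntropy_le`).
-/

set_option linter.unusedSectionVars false
set_option synthInstance.maxHeartbeats 400000
set_option maxHeartbeats 1000000


noncomputable section

namespace Decoupling

universe u v w

/-! ### Traces, eigenbases and singular values of operators on a Hilbert space -/

section HilbertBasics

variable {H : Type u} [NormedAddCommGroup H] [InnerProductSpace ℂ H] [CompleteSpace H]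
variable {G : Type v} [NormedAddCommGroup G] [InnerProductSpace ℂ G] [CompleteSpace G]
variable {K : Type w} [NormedAddCommGroup K] [InnerProductSpace ℂ K] [CompleteSpace K]

/-- Douglas factorization: if `‖R x‖ ≤ c ‖S x‖` for all `x`, then `R = V S` for an operator `V` of
norm at most `c`, which can be chosen to vanish on the orthogonal complement of the range of `S`. -/
theorem exists_factor_of_norm_le (S : H →L[ℂ] G) (R : H →L[ℂ] K) {c : ℝ} (hc : 0 ≤ c)
    (h : ∀ x, ‖R x‖ ≤ c * ‖S x‖) :
    ∃ V : G →L[ℂ] K, ‖V‖ ≤ c ∧ (∀ x, V (S x) = R x) ∧ ∀ y, (∀ x, ⟪S x, y⟫_ℂ = 0) → V y = 0 := by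
  set M := S.range.topologicalClosure with hM
  have hMc : IsClosed (M : Set G) := S.range.isClosed_topologicalClosure
  have : CompleteSpace M := hMc.completeSpace_coe
  have hmem : ∀ x, S x ∈ M := fun x => S.range.le_topologicalClosure ⟨x, rfl⟩
  let e : H →ₗ[ℂ] M := S.toLinearMap.codRestrict M hmem
  have hdense : DenseRange e := by
    intro y
    rw [Metric.mem_closure_iff]
    intro ε hε
    have hy : (y : G) ∈ closure (S.range : Set G) := y.2
    obtain ⟨z, ⟨x, rfl⟩, hz⟩ := Metric.mem_closure_iff.1 hy ε hε
    exact ⟨e x, ⟨x, rfl⟩, hz⟩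
  have hn : ∀ x, ‖R.toLinearMap x‖ ≤ c * ‖e x‖ := h
  let W : M →L[ℂ] K := R.toLinearMap.extendOfNorm e
  refine ⟨W ∘L M.orthogonalProjectionOnto, ?_, ?_, ?_⟩
  · refine (W.opNorm_comp_le _).trans ?_
    calc ‖W‖ * ‖M.orthogonalProjectionOnto‖ ≤ c * 1 :=
          mul_le_mul (LinearMap.opNorm_extendOfNorm_le hdense hc hn)
            M.orthogonalProjectionOnto_norm_le
            (ContinuousLinearMap.opNorm_nonneg _) hc
      _ = c := mul_one c
  · intro x
    have h1 : M.orthogonalProjectionOnto (S x) = e x :=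
      Submodule.orthogonalProjectionOnto_mem_subspace_eq_self (e x)
    rw [ContinuousLinearMap.comp_apply, h1]
    exact LinearMap.extendOfNorm_eq hdense ⟨c, hn⟩ x
  · intro y hy
    have hyM : y ∈ Mᗮ := by
      rw [hM, Submodule.orthogonal_closure, Submodule.mem_orthogonal]
      rintro _ ⟨x, rfl⟩
      exact hy x
    rw [ContinuousLinearMap.comp_apply,
      (Submodule.orthogonalProjectionOnto_eq_zero_iff).2 hyM, map_zero]

theorem isPositive_of_nonneg {T : H →L[ℂ] H} (hT : 0 ≤ T) : T.IsPositive :=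
  (ContinuousLinearMap.nonneg_iff_isPositive T).1 hT

theorem inner_apply_eq_inner_apply {T : H →L[ℂ] H} (hT : 0 ≤ T) (x y : H) :
    ⟪T x, y⟫_ℂ = ⟪x, T y⟫_ℂ :=
  (isPositive_of_nonneg hT).isSelfAdjoint.isSymmetric x y

/-- The functional calculus acts on an eigenvector through the eigenvalue. -/
theorem cfc_apply_eigenvector {T : H →L[ℂ] H} (hT : IsSelfAdjoint T) {f : ℝ → ℝ}
    (hf : ContinuousOn f (spectrum ℝ T)) {t : ℝ} {e : H} (he : T e = (t : ℂ) • e) :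
    cfc f T e = (f t : ℂ) • e := by
  by_cases he0 : e = 0
  · simp [he0]
  have ht : t ∈ spectrum ℝ T := by
    rw [spectrum.mem_iff]
    intro hu
    obtain ⟨B, hB⟩ := hu
    have h1 : (B : H →L[ℂ] H) e = 0 := by
      rw [hB]
      simp only [sub_apply, he, Algebra.algebraMap_eq_smul_one]
      simp
    have h2 : ((B⁻¹ : (H →L[ℂ] H)ˣ) : H →L[ℂ] H) ((B : H →L[ℂ] H) e) = e := by
      rw [← mul_apply_eq_comp, Units.inv_mul]; rfl
    rw [h1, map_zero] at h2
    exact he0 h2.symm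
  rw [cfc_apply f T hT hf]
  have key : ∀ g : C(spectrum ℝ T, ℝ), cfcHom hT g e = ((g ⟨t, ht⟩ : ℝ) : ℂ) • e := by
    intro g
    induction g using ContinuousMap.induction_on_of_compact with
    | const r =>
      have : ContinuousMap.const (spectrum ℝ T) r = algebraMap ℝ C(spectrum ℝ T, ℝ) r := rfl
      rw [this, AlgHomClass.commutes, Algebra.algebraMap_eq_smul_one]
      simp
    | id => rw [cfcHom_id hT]; exact he
    | star_id => rw [map_star, cfcHom_id hT, hT.star_eq]; exact he
    | add f g hf hg => rw [map_add, add_apply, hf, hg, ← add_smul]; simp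
    | mul f g hf hg =>
      rw [map_mul, mul_apply_eq_comp, hg, map_smul, hf, smul_smul, mul_comm]; simp
    | frequently f h =>
      have hcl : IsClosed {g : C(spectrum ℝ T, ℝ) |
          cfcHom hT g e = ((g ⟨t, ht⟩ : ℝ) : ℂ) • e} := by
        refine isClosed_eq ?_ ?_
        · exact ((ContinuousLinearMap.apply ℂ H e).continuous).comp (cfcHom_continuous hT)
        · exact (Complex.continuous_ofReal.comp (continuous_eval_const _)).smul
            continuous_const
      exact hcl.closure_subset (mem_closure_iff_frequently.2 h)
  exact key _

theorem rpow_apply_eigenvector {T : H →L[ℂ] H} (hT : 0 ≤ T) {r : ℝ} (hr : 0 ≤ r) {t : ℝ} {e : H}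
    (he : T e = (t : ℂ) • e) : (T ^ r) e = ((t ^ r : ℝ) : ℂ) • e := by
  rw [CFC.rpow_eq_cfc_real (a := T) (y := r) hT]
  exact cfc_apply_eigenvector (isPositive_of_nonneg hT).isSelfAdjoint
    (Real.continuous_rpow_const hr).continuousOn he

theorem rpow_add_of_nonneg (T : H →L[ℂ] H) {r s : ℝ} (hr : 0 ≤ r) (hs : 0 ≤ s) :
    T ^ (r + s) = T ^ r * T ^ s := by
  rw [CFC.rpow_def, CFC.rpow_def, CFC.rpow_def, ← cfc_mul _ _ T
    (NNReal.continuous_rpow_const hr).continuousOn (NNReal.continuous_rpow_const hs).continuousOn]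
  congr 1
  funext x
  exact NNReal.rpow_add_of_nonneg x hr hs

theorem hasSum_norm_inner_sq {ι : Type*} (e : HilbertBasis ι ℂ H) (y : H) :
    HasSum (fun i => ‖⟪e i, y⟫_ℂ‖ ^ 2) (‖y‖ ^ 2) := by
  have h3 := (RCLike.hasSum_re ℂ (e.hasSum_inner_mul_inner y y))
  rw [inner_self_eq_norm_sq (𝕜 := ℂ)] at h3
  convert h3 using 2 with i
  rw [← inner_conj_symm y (e i), RCLike.conj_mul, ← RCLike.ofReal_pow, RCLike.ofReal_re]

/-- Parseval's identity in extended nonnegative form. -/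
theorem enorm_sq_eq_tsum {ι : Type*} (e : HilbertBasis ι ℂ H) (y : H) :
    ‖y‖ₑ ^ 2 = ∑' i, ‖⟪e i, y⟫_ℂ‖ₑ ^ 2 := by
  have h2 := hasSum_norm_inner_sq e y
  rw [← ofReal_norm, ← ENNReal.ofReal_pow (norm_nonneg _), ← h2.tsum_eq,
    ENNReal.ofReal_tsum_of_nonneg (fun _ => by positivity) h2.summable]
  congr 1; funext i
  rw [ENNReal.ofReal_pow (norm_nonneg _), ofReal_norm]

theorem norm_sq_eq_re_inner_rpow_half {T : H →L[ℂ] H} {r : ℝ} (hr : 0 ≤ r) (x : H) :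
    RCLike.re ⟪x, (T ^ r) x⟫_ℂ = ‖(T ^ (r / 2)) x‖ ^ 2 := by
  have h : T ^ r = T ^ (r / 2) * T ^ (r / 2) := by
    rw [← rpow_add_of_nonneg T (by positivity) (by positivity), add_halves]
  rw [h, mul_apply_eq_comp, ← inner_apply_eq_inner_apply (CFC.rpow_nonneg (a := T)),
    inner_self_eq_norm_sq (𝕜 := ℂ)]

/-- The trace of `Tʳ` is the squared Hilbert–Schmidt norm of `T^(r/2)`. -/
theorem trace_rpow_eq_tsum {ι : Type*} (e : HilbertBasis ι ℂ H) (T : H →L[ℂ] H) {r : ℝ}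
    (hr : 0 ≤ r) : trace (T ^ r) = ∑' i, ‖(T ^ (r / 2)) (e i)‖ₑ ^ 2 := by
  rw [trace_eq_tsum e _ CFC.rpow_nonneg]
  congr 1; funext i
  rw [norm_sq_eq_re_inner_rpow_half hr, ENNReal.ofReal_pow (norm_nonneg _), ofReal_norm]

theorem trace_mono {S T : H →L[ℂ] H} (h : S ≤ T) : trace S ≤ trace T := by
  unfold trace
  refine iSup_mono fun s => Finset.sum_le_sum fun v _ => ENNReal.ofReal_le_ofReal ?_
  have := ((ContinuousLinearMap.le_def S T).1 h).re_inner_nonneg_right v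
  rw [sub_apply, inner_sub_right, map_sub] at this
  linarith

/-- The operator norm is at most the Hilbert–Schmidt norm. -/
theorem norm_apply_sq_le_of_hilbertSchmidt {ι : Type*} (e : HilbertBasis ι ℂ H) (S : H →L[ℂ] G)
    {c : ℝ} (hs : Summable fun i => ‖S (e i)‖ ^ 2) (hc : ∑' i, ‖S (e i)‖ ^ 2 ≤ c ^ 2)
    (hc0 : 0 ≤ c) : ‖S‖ ≤ c := by
  have h1 : ‖ContinuousLinearMap.adjoint S‖ ≤ c := by
    refine ContinuousLinearMap.opNorm_le_bound _ hc0 fun y => ?_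
    have h2 := hasSum_norm_inner_sq e (ContinuousLinearMap.adjoint S y)
    have h3 : ‖ContinuousLinearMap.adjoint S y‖ ^ 2 ≤ (c * ‖y‖) ^ 2 := by
      rw [← h2.tsum_eq, mul_pow]
      calc ∑' i, ‖⟪e i, ContinuousLinearMap.adjoint S y⟫_ℂ‖ ^ 2
          ≤ ∑' i, ‖S (e i)‖ ^ 2 * ‖y‖ ^ 2 := by
            refine h2.summable.tsum_le_tsum (fun i => ?_) (hs.mul_right _)
            rw [ContinuousLinearMap.adjoint_inner_right, ← mul_pow]
            gcongr
            exact norm_inner_le_norm _ _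
        _ = (∑' i, ‖S (e i)‖ ^ 2) * ‖y‖ ^ 2 := tsum_mul_right
        _ ≤ c ^ 2 * ‖y‖ ^ 2 := by gcongr
    exact abs_le_of_sq_le_sq' h3 (by positivity) |>.2
  simpa using h1

/-- Hilbert–Schmidt operators are compact. -/
theorem isCompactOperator_of_hilbertSchmidt {ι : Type*} (e : HilbertBasis ι ℂ H) (S : H →L[ℂ] G)
    (hs : Summable fun i => ‖S (e i)‖ ^ 2) : IsCompactOperator S := by
  classical
  let P : Finset ι → (H →L[ℂ] H) := fun F => ∑ i ∈ F, InnerProductSpace.rankOne ℂ (e i) (e i)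
  have hP : ∀ F i, P F (e i) = if i ∈ F then e i else 0 := by
    intro F i
    simp only [P, sum_apply, InnerProductSpace.rankOne_apply]
    simp_rw [orthonormal_iff_ite.1 e.orthonormal, ite_smul, one_smul, zero_smul]
    rw [Finset.sum_ite_eq' F i (fun j => e j)]
  have hcomp : ∀ F, IsCompactOperator (S ∘L P F) := by
    intro F
    have hfin : IsCompactOperator (P F) := by
      induction F using Finset.induction_on with
      | empty => simp only [P, Finset.sum_empty]; exact isCompactOperator_zero
      | insert a F ha ih =>
        simp only [P, Finset.sum_insert ha]
        refine IsCompactOperator.add ?_ ih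
        have : (InnerProductSpace.rankOne ℂ (e a) (e a) : H →L[ℂ] H)
            = (ContinuousLinearMap.toSpanSingleton ℂ (e a)) ∘L (innerSL ℂ (e a)) := by
          ext x; simp [InnerProductSpace.rankOne_apply]
        rw [this]
        have hk : IsCompactOperator (innerSL ℂ (e a)) :=
          isCompactOperator_of_locallyCompactSpace_dom (innerSL ℂ (e a) : H →L[ℂ] ℂ)
        exact hk.clm_comp (ContinuousLinearMap.toSpanSingleton ℂ (e a))
    exact hfin.clm_comp S
  refine isCompactOperator_of_tendsto (l := Filter.atTop) (F := fun F => S ∘L P F) ?_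
    (Filter.Eventually.of_forall hcomp)
  rw [tendsto_iff_norm_sub_tendsto_zero]
  have ht := tendsto_tsum_compl_atTop_zero (fun i => ‖S (e i)‖ ^ 2)
  have ht2 : Filter.Tendsto (fun F : Finset ι => √(∑' i : { x // x ∉ F }, ‖S (e i)‖ ^ 2))
      Filter.atTop (nhds 0) := by
    have := (Real.continuous_sqrt.tendsto 0).comp ht
    rwa [Real.sqrt_zero] at this
  refine squeeze_zero (fun _ => norm_nonneg _) (fun F => ?_) ht2
  rw [norm_sub_rev]
  have hval : ∀ i, ‖(S - S ∘L P F) (e i)‖ ^ 2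
      = Set.indicator {x | x ∉ F} (fun i => ‖S (e i)‖ ^ 2) i := by
    intro i
    rw [sub_apply, ContinuousLinearMap.comp_apply, hP]
    by_cases hi : i ∈ F <;> simp [hi, Set.indicator]
  refine norm_apply_sq_le_of_hilbertSchmidt e _ ?_ ?_ (Real.sqrt_nonneg _)
  · simp_rw [hval]; exact hs.indicator _
  · simp_rw [hval]
    rw [Real.sq_sqrt (tsum_nonneg fun _ => by positivity)]
    exact le_of_eq (tsum_subtype {x | x ∉ F} _).symm

/-- Spectral theorem: a compact positive operator has a Hilbert basis of eigenvectors. -/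
theorem exists_eigenbasis {T : H →L[ℂ] H} (hT : 0 ≤ T) (hc : IsCompactOperator T) :
    ∃ (ι : Type u) (e : HilbertBasis ι ℂ H) (t : ι → ℝ), (∀ i, 0 ≤ t i) ∧
      ∀ i, T (e i) = (t i : ℂ) • e i := by
  classical
  have hsym : T.IsSymmetric := (isPositive_of_nonneg hT).isSelfAdjoint.isSymmetric
  let E : ℂ → Submodule ℂ H := fun μ => Module.End.eigenspace (T : Module.End ℂ H) μ
  have hEc : ∀ μ, IsClosed (E μ : Set H) := fun μ => by
    have : (E μ : Set H) = {x | T x = μ • x} := by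
      ext x; exact Module.End.mem_eigenspace_iff
    rw [this]
    exact isClosed_eq T.continuous (continuous_const_smul μ)
  have : ∀ μ, CompleteSpace (E μ) := fun μ => (hEc μ).completeSpace_coe
  choose w b hb using fun μ => exists_hilbertBasis ℂ (E μ)
  have hO : OrthogonalFamily ℂ (fun μ => E μ) fun μ => (E μ).subtypeₗᵢ :=
    hsym.orthogonalFamily_eigenspaces
  let f : (Σ μ, w μ) → H := fun a => ((b a.1 a.2 : E a.1) : H)
  have hon : Orthonormal ℂ f := hO.orthonormal_sigma_orthonormal (v_family := fun μ i => b μ i)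
    fun μ => (b μ).orthonormal
  have hspan : (Submodule.span ℂ (Set.range f))ᗮ = ⊥ := by
    rw [eq_bot_iff, ← ContinuousLinearMap.orthogonalComplement_iSup_eigenspaces_eq_bot hc hsym]
    intro x hx
    rw [Submodule.mem_orthogonal'] at hx ⊢
    have hperp : ∀ μ, ∀ y ∈ E μ, ⟪x, y⟫_ℂ = 0 := by
      intro μ y hy
      have hP : (E μ).orthogonalProjectionOnto x = 0 := by
        apply (b μ).repr.injective
        ext i
        rw [HilbertBasis.repr_apply_apply, map_zero,
          Submodule.inner_orthogonalProjectionOnto_eq_of_mem_left]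
        rw [← inner_conj_symm, hx _ (Submodule.subset_span ⟨⟨μ, i⟩, rfl⟩)]
        simp
      have := Submodule.inner_orthogonalProjectionOnto_eq_of_mem_right (K := E μ) ⟨y, hy⟩ x
      rw [hP] at this
      rw [← this]; simp
    intro y hy
    induction hy using Submodule.iSup_induction' with
    | mem μ y hy => exact hperp μ y hy
    | zero => simp
    | add y z _ _ h1 h2 => rw [inner_add_right, h1, h2, add_zero]
  have hTf : ∀ a, T (f a) = a.1 • f a := fun a =>
    Module.End.mem_eigenspace_iff.1 (b a.1 a.2).2
  have hre : ∀ a, ∃ t : ℝ, 0 ≤ t ∧ T (f a) = (t : ℂ) • f a := by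
    intro a
    have hn : ‖f a‖ = 1 := hon.norm_eq_one a
    have hv : ⟪f a, T (f a)⟫_ℂ = a.1 := by
      rw [hTf, inner_smul_right, inner_self_eq_norm_sq_to_K, hn]; simp
    have h1 := (isPositive_of_nonneg hT).re_inner_nonneg_right (f a)
    have h2 := hsym.coe_re_inner_self_apply (f a)
    rw [hv] at h1
    refine ⟨a.1.re, h1, ?_⟩
    rw [hTf]
    congr 1
    rw [← hv]
    exact h2.symm
  choose t ht0 ht using hre
  refine ⟨Σ μ, w μ, HilbertBasis.mkOfOrthogonalEqBot hon hspan, t, ht0, fun a => ?_⟩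
  have h := congrFun (HilbertBasis.coe_mkOfOrthogonalEqBot hon hspan) a
  rw [h]
  exact ht a

theorem summable_norm_sq_of_tsum_ne_top {ι : Type*} {x : ι → H}
    (h : ∑' i, ‖x i‖ₑ ^ 2 ≠ ∞) : Summable fun i => ‖x i‖ ^ 2 := by
  have := ENNReal.summable_toReal h
  simpa using this

/-- The power `T^(r/2)` is Hilbert–Schmidt, hence compact; as `r ≤ 2`, so is its multiple `T`. -/
theorem isCompactOperator_of_trace_rpow_ne_top {T : H →L[ℂ] H} (hT : 0 ≤ T) {r : ℝ} (hr : 0 < r)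
    (hr2 : r ≤ 2) (h : trace (T ^ r) ≠ ∞) : IsCompactOperator T := by
  obtain ⟨w, e, -⟩ := exists_hilbertBasis ℂ H
  rw [trace_rpow_eq_tsum e T hr.le] at h
  have h1 := isCompactOperator_of_hilbertSchmidt e _ (summable_norm_sq_of_tsum_ne_top h)
  have h2 : T = T ^ (r / 2) * T ^ (1 - r / 2) := by
    rw [← rpow_add_of_nonneg T (by positivity) (by linarith), add_sub_cancel, CFC.rpow_one T hT]
  rw [h2]
  exact h1.comp_clm (T ^ (1 - r / 2))

theorem trace_rpow_eq_tsum_eigenvalues {ι : Type*} (e : HilbertBasis ι ℂ H) {T : H →L[ℂ] H}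
    (hT : 0 ≤ T) {t : ι → ℝ} (het : ∀ i, T (e i) = (t i : ℂ) • e i) {r : ℝ} (hr : 0 ≤ r) :
    trace (T ^ r) = ∑' i, ENNReal.ofReal (t i ^ r) := by
  rw [trace_eq_tsum e _ CFC.rpow_nonneg]
  congr 1; funext i
  rw [rpow_apply_eigenvector hT hr (het i), inner_smul_right, inner_self_eq_norm_sq_to_K,
    e.orthonormal.norm_eq_one]
  simp

theorem trace_eq_tsum_eigenvalues {ι : Type*} (e : HilbertBasis ι ℂ H) {T : H →L[ℂ] H}
    (hT : 0 ≤ T) {t : ι → ℝ} (het : ∀ i, T (e i) = (t i : ℂ) • e i) :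
    trace T = ∑' i, ENNReal.ofReal (t i) := by
  have := trace_rpow_eq_tsum_eigenvalues e hT het zero_le_one
  simpa [CFC.rpow_one T hT] using this

theorem IsDensity.exists_eigenbasis {ρ : H →L[ℂ] H} (hρ : IsDensity ρ) :
    ∃ (ι : Type u) (e : HilbertBasis ι ℂ H) (t : ι → ℝ), (∀ i, 0 ≤ t i) ∧
      (∀ i, ρ (e i) = (t i : ℂ) • e i) ∧ HasSum t 1 := by
  have hc : IsCompactOperator ρ := by
    refine isCompactOperator_of_trace_rpow_ne_top hρ.1 zero_lt_one one_le_two ?_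
    rw [CFC.rpow_one ρ hρ.1, hρ.2]; simp
  obtain ⟨ι, e, t, ht0, het⟩ := Decoupling.exists_eigenbasis hρ.1 hc
  refine ⟨ι, e, t, ht0, het, ?_⟩
  have h1 := trace_eq_tsum_eigenvalues e hρ.1 het
  rw [hρ.2] at h1
  have hs : Summable t := by
    have := ENNReal.summable_toReal (f := fun i => ENNReal.ofReal (t i)) (by rw [← h1]; simp)
    simpa [ENNReal.toReal_ofReal, ht0] using this
  have h2 : ∑' i, t i = 1 := by
    rw [← ENNReal.ofReal_tsum_of_nonneg ht0 hs] at h1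
    have := congrArg ENNReal.toReal h1
    rw [ENNReal.toReal_ofReal (tsum_nonneg ht0)] at this
    simpa using this.symm
  exact h2 ▸ hs.hasSum

/-- A Bessel family: a family of vectors satisfying Bessel's inequality, such as the image of an
orthonormal family under a contraction. -/
def IsBessel {ι : Type*} (v : ι → H) : Prop :=
  ∀ (F : Finset ι) (x : H), ∑ i ∈ F, ‖⟪v i, x⟫_ℂ‖ ^ 2 ≤ ‖x‖ ^ 2

theorem _root_.Orthonormal.isBessel {ι : Type*} {e : ι → H} (he : Orthonormal ℂ e) :
    IsBessel e := fun _ _ => he.sum_inner_products_le _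

theorem IsBessel.map {ι : Type*} {e : ι → H} (he : IsBessel e) {V : H →L[ℂ] G}
    (hV : ‖V‖ ≤ 1) : IsBessel fun i => V (e i) := by
  intro F x
  have h : ∀ i, ⟪V (e i), x⟫_ℂ = ⟪e i, ContinuousLinearMap.adjoint V x⟫_ℂ := fun i =>
    (ContinuousLinearMap.adjoint_inner_right V (e i) x).symm
  simp_rw [h]
  refine (he F _).trans ?_
  have h2 : ‖ContinuousLinearMap.adjoint V x‖ ≤ ‖x‖ := by
    refine (ContinuousLinearMap.le_opNorm _ _).trans ?_
    rw [LinearIsometryEquiv.norm_map]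
    exact mul_le_of_le_one_left (norm_nonneg _) hV
  gcongr

theorem IsBessel.norm_le_one {ι : Type*} {e : ι → H} (he : IsBessel e) (i : ι) : ‖e i‖ ≤ 1 := by
  have h := he {i} (e i)
  rw [Finset.sum_singleton, inner_self_eq_norm_sq_to_K] at h
  simp only [norm_pow, RCLike.norm_ofReal, abs_norm] at h
  nlinarith [norm_nonneg (e i), sq_nonneg (‖e i‖ - 1), sq_nonneg (‖e i‖ ^ 2 - 1)]

theorem norm_abs_apply (Y : H →L[ℂ] H) (x : H) : ‖CFC.abs Y x‖ = ‖Y x‖ := by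
  have h : ∀ T : H →L[ℂ] H, ‖T x‖ ^ 2 = RCLike.re ⟪x, (star T * T) x⟫_ℂ := fun T => by
    rw [mul_apply_eq_comp, ContinuousLinearMap.star_eq_adjoint,
      ContinuousLinearMap.adjoint_inner_right, inner_self_eq_norm_sq (𝕜 := ℂ)]
  have h2 : ‖CFC.abs Y x‖ ^ 2 = ‖Y x‖ ^ 2 := by
    rw [h, h, (CFC.abs_nonneg Y).isSelfAdjoint.star_eq, CFC.abs_mul_abs]
  exact (sq_eq_sq₀ (norm_nonneg _) (norm_nonneg _)).1 h2

/-- Polar decomposition, in a weak form with contractions in both directions. -/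
theorem exists_polar (Y : H →L[ℂ] H) :
    ∃ V W : H →L[ℂ] H, ‖V‖ ≤ 1 ∧ ‖W‖ ≤ 1 ∧ (∀ x, V (CFC.abs Y x) = Y x) ∧
      ∀ x, W (Y x) = CFC.abs Y x := by
  obtain ⟨V, hV, hV2, -⟩ := exists_factor_of_norm_le (CFC.abs Y) Y zero_le_one
    fun x => by rw [one_mul, norm_abs_apply]
  obtain ⟨W, hW, hW2, -⟩ := exists_factor_of_norm_le Y (CFC.abs Y) zero_le_one
    fun x => by rw [one_mul, norm_abs_apply]
  exact ⟨V, W, hV, hW, hV2, hW2⟩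

/-- Singular value decomposition of an operator with finite Schatten `α`-norm: `Y = ∑ yᵢ |vᵢ⟩⟨eᵢ|`
with an orthonormal basis `e`, a Bessel family `v` and `∑ yᵢ ^ α = ‖Y‖_α ^ α`. -/
theorem exists_singularValues {Y : H →L[ℂ] H} {α : ℝ} (h1 : 1 ≤ α) (h2 : α ≤ 2)
    (hY : schattenNorm α Y ≠ ∞) :
    ∃ (ι : Type u) (e : HilbertBasis ι ℂ H) (v : ι → H) (y : ι → ℝ), (∀ i, 0 ≤ y i) ∧
      IsBessel v ∧ (∀ i, Y (e i) = (y i : ℂ) • v i) ∧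
      HasSum (fun i => y i ^ α) ((schattenNorm α Y).toReal ^ α) := by
  have h0 : 0 < α := by linarith
  have htr : trace (CFC.abs Y ^ α) ≠ ∞ := by
    intro h
    rw [schattenNorm, h, ENNReal.top_rpow_of_pos (by positivity)] at hY
    exact hY rfl
  obtain ⟨ι, e, y, hy0, hey⟩ := Decoupling.exists_eigenbasis (CFC.abs_nonneg Y)
    (isCompactOperator_of_trace_rpow_ne_top (CFC.abs_nonneg Y) h0 h2 htr)
  obtain ⟨V, -, hV, -, hVY, -⟩ := exists_polar Y
  refine ⟨ι, e, fun i => V (e i), y, hy0, e.orthonormal.isBessel.map hV, fun i => ?_, ?_⟩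
  · rw [← hVY, hey, map_smul]
  · have h3 := trace_rpow_eq_tsum_eigenvalues e (CFC.abs_nonneg Y) hey h0.le
    have hs : Summable fun i => y i ^ α := by
      have := ENNReal.summable_toReal (f := fun i => ENNReal.ofReal (y i ^ α))
        (by rw [← h3]; exact htr)
      simpa [ENNReal.toReal_ofReal, Real.rpow_nonneg, hy0] using this
    have h4 : (schattenNorm α Y).toReal ^ α = ∑' i, y i ^ α := by
      rw [schattenNorm, ← ENNReal.toReal_rpow, ← Real.rpow_mul ENNReal.toReal_nonneg,
        one_div_mul_cancel h0.ne', Real.rpow_one, h3,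
        ← ENNReal.ofReal_tsum_of_nonneg (fun i => Real.rpow_nonneg (hy0 i) _) hs,
        ENNReal.toReal_ofReal (tsum_nonneg fun i => Real.rpow_nonneg (hy0 i) _)]
    rw [h4]
    exact hs.hasSum

end HilbertBasics


/-! ### Operators on the tensor product and their blocks -/

section TensorStructure

variable {A : Type u} {B : Type v}
  [NormedAddCommGroup A] [InnerProductSpace ℂ A]
  [NormedAddCommGroup B] [InnerProductSpace ℂ B]

/-- A shortcut for instance search on completed tensor products. -/
instance instCStarAlgebraHTensor : CStarAlgebra (HTensor A B →L[ℂ] HTensor A B) := inferInstance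

/-- A shortcut for instance search on completed tensor products. -/
instance instAlgebraRealHTensor : Algebra ℝ (HTensor A B →L[ℂ] HTensor A B) := inferInstance

theorem ketTensor_apply (a : A) (b : B) :
    (ketTensor a b : HTensor A B) = ((a ⊗ₜ[ℂ] b : A ⊗[ℂ] B) : Completion (A ⊗[ℂ] B)) := rfl

theorem inner_ketTensor (a a' : A) (b b' : B) :
    ⟪(ketTensor a b : HTensor A B), ketTensor a' b'⟫_ℂ = ⟪a, a'⟫_ℂ * ⟪b, b'⟫_ℂ := by
  rw [ketTensor_apply, ketTensor_apply, Completion.inner_coe, TensorProduct.inner_tmul]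

theorem opTensor_ketTensor (S : A →L[ℂ] A) (R : B →L[ℂ] B) (a : A) (b : B) :
    opTensor S R (ketTensor a b) = ketTensor (S a) (R b) := by
  rw [ketTensor_apply, ketTensor_apply]
  exact ContinuousLinearMap.completion_apply_coe _ _

theorem ketTensor_add (a a' : A) :
    (ketTensor (a + a') : B →L[ℂ] HTensor A B) = ketTensor a + ketTensor a' := by
  refine ContinuousLinearMap.ext fun b => ?_
  rw [add_apply, ketTensor_apply, TensorProduct.add_tmul, Completion.coe_add]; rfl

theorem ketTensor_smul (c : ℂ) (a : A) :
    (ketTensor (c • a) : B →L[ℂ] HTensor A B) = c • ketTensor a := by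
  refine ContinuousLinearMap.ext fun b => ?_
  rw [smul_apply, ketTensor_apply, ← TensorProduct.smul_tmul', Completion.coe_smul]; rfl

/-- Operators on the Hilbert space tensor product are determined by their values on product
vectors. -/
theorem ext_ketTensor {V : Type*} [NormedAddCommGroup V] [NormedSpace ℂ V]
    {X Y : HTensor A B →L[ℂ] V} (h : ∀ a b, X (ketTensor a b) = Y (ketTensor a b)) : X = Y := by
  ext ψ
  induction ψ using Completion.induction_on with
  | hp => exact isClosed_eq X.continuous Y.continuous
  | ih ψ =>
    induction ψ using TensorProduct.induction_on with
    | zero => rw [Completion.coe_zero, map_zero, map_zero]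
    | tmul a b => exact h a b
    | add x y hx hy => rw [Completion.coe_add, map_add, map_add, hx, hy]

/-- The product vectors of two Hilbert bases form a Hilbert basis. -/
theorem exists_tensorBasis [CompleteSpace A] [CompleteSpace B] {ι κ : Type*}
    (e : HilbertBasis ι ℂ A) (f : HilbertBasis κ ℂ B) :
    ∃ g : HilbertBasis (ι × κ) ℂ (HTensor A B), ∀ p, g p = ketTensor (e p.1) (f p.2) := by
  classical
  let v : ι × κ → HTensor A B := fun p => ketTensor (e p.1) (f p.2)
  have hv : Orthonormal ℂ v := by
    rw [orthonormal_iff_ite]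
    rintro ⟨i, k⟩ ⟨j, l⟩
    rw [inner_ketTensor, orthonormal_iff_ite.1 e.orthonormal, orthonormal_iff_ite.1 f.orthonormal]
    by_cases h1 : i = j <;> by_cases h2 : k = l <;> simp [h1, h2]
  have hsp : (Submodule.span ℂ (Set.range v))ᗮ = ⊥ := by
    rw [eq_bot_iff]
    intro x hx
    rw [Submodule.mem_orthogonal'] at hx
    have h1 : ∀ i k, ⟪x, ketTensor (e i) (f k)⟫_ℂ = 0 := fun i k =>
      hx _ (Submodule.subset_span ⟨(i, k), rfl⟩)
    have h2 : ∀ i b, ⟪x, ketTensor (e i) b⟫_ℂ = 0 := by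
      intro i b
      have : ContinuousLinearMap.adjoint (ketTensor (e i) : B →L[ℂ] HTensor A B) x = 0 := by
        apply f.repr.injective
        ext k
        rw [HilbertBasis.repr_apply_apply, map_zero, ContinuousLinearMap.adjoint_inner_right,
          ← inner_conj_symm, h1]
        simp
      rw [← ContinuousLinearMap.adjoint_inner_left, this, inner_zero_left]
    have h3 : ∀ a b, ⟪x, (ketTensor a b : HTensor A B)⟫_ℂ = 0 := by
      intro a b
      let L : A →L[ℂ] HTensor A B :=
        Completion.toComplL ∘L (TensorProduct.mkL ℂ A B).flip b
      have hL : ∀ a, L a = ketTensor a b := fun _ => rfl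
      have : ContinuousLinearMap.adjoint L x = 0 := by
        apply e.repr.injective
        ext k
        rw [HilbertBasis.repr_apply_apply, map_zero, ContinuousLinearMap.adjoint_inner_right,
          ← inner_conj_symm, hL, h2]
        simp
      rw [← hL, ← ContinuousLinearMap.adjoint_inner_left, this, inner_zero_left]
    have h4 : innerSL ℂ x = 0 := ext_ketTensor fun a b => by simpa using h3 a b
    have h5 := congrArg (fun F => F x) h4
    simpa using h5
  refine ⟨HilbertBasis.mkOfOrthogonalEqBot hv hsp, fun p => ?_⟩
  exact congrFun (HilbertBasis.coe_mkOfOrthogonalEqBot hv hsp) p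

theorem opTensor_add_left (S S' : A →L[ℂ] A) (R : B →L[ℂ] B) :
    opTensor (S + S') R = opTensor S R + opTensor S' R :=
  ext_ketTensor fun a b => by simp [opTensor_ketTensor, ketTensor_add]

theorem opTensor_smul_left (c : ℂ) (S : A →L[ℂ] A) (R : B →L[ℂ] B) :
    opTensor (c • S) R = c • opTensor S R :=
  ext_ketTensor fun a b => by simp [opTensor_ketTensor, ketTensor_smul]

theorem opTensor_add_right (S : A →L[ℂ] A) (R R' : B →L[ℂ] B) :
    opTensor S (R + R') = opTensor S R + opTensor S R' :=
  ext_ketTensor fun a b => by simp [opTensor_ketTensor]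

theorem opTensor_smul_right (c : ℂ) (S : A →L[ℂ] A) (R : B →L[ℂ] B) :
    opTensor S (c • R) = c • opTensor S R :=
  ext_ketTensor fun a b => by simp [opTensor_ketTensor]

/-- The tensor product of operators as a bilinear map. -/
def opTensorₗ : (A →L[ℂ] A) →ₗ[ℂ] (B →L[ℂ] B) →ₗ[ℂ] (HTensor A B →L[ℂ] HTensor A B) :=
  LinearMap.mk₂ ℂ opTensor opTensor_add_left opTensor_smul_left opTensor_add_right
    opTensor_smul_right

theorem opTensorₗ_apply (S : A →L[ℂ] A) (R : B →L[ℂ] B) : opTensorₗ S R = opTensor S R := rfl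

theorem opTensor_mul (S S' : A →L[ℂ] A) (R R' : B →L[ℂ] B) :
    opTensor S R * opTensor S' R' = opTensor (S * S') (R * R') :=
  ext_ketTensor fun a b => by simp [opTensor_ketTensor]

theorem star_opTensor [CompleteSpace A] [CompleteSpace B] (S : A →L[ℂ] A) (R : B →L[ℂ] B) :
    star (opTensor S R) = opTensor (star S) (star R) := by
  refine ext_ketTensor fun a b => ?_
  refine ext_inner_left ℂ fun ψ => ?_
  have h : innerSL ℂ (star (opTensor S R) (ketTensor a b)) =
      innerSL ℂ (opTensor (star S) (star R) (ketTensor a b)) := by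
    refine ext_ketTensor fun a' b' => ?_
    simp only [innerSL_apply_apply]
    rw [ContinuousLinearMap.star_eq_adjoint, ContinuousLinearMap.adjoint_inner_left,
      opTensor_ketTensor, opTensor_ketTensor, inner_ketTensor, inner_ketTensor,
      ContinuousLinearMap.star_eq_adjoint, ContinuousLinearMap.star_eq_adjoint,
      ContinuousLinearMap.adjoint_inner_left, ContinuousLinearMap.adjoint_inner_left]
  have h2 := congrArg (fun F => F ψ) h
  simp only [innerSL_apply_apply] at h2
  rw [← inner_conj_symm, h2, inner_conj_symm]

theorem opTensor_one_nonneg [CompleteSpace A] [CompleteSpace B] {R : B →L[ℂ] B} (hR : 0 ≤ R) :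
    0 ≤ opTensor (1 : A →L[ℂ] A) R := by
  obtain ⟨S, hS, rfl⟩ : ∃ S : B →L[ℂ] B, star S = S ∧ S * S = R :=
    ⟨CFC.sqrt R, (IsSelfAdjoint.of_nonneg (CFC.sqrt_nonneg R)).star_eq, CFC.sqrt_mul_sqrt_self R hR⟩
  have : opTensor (1 : A →L[ℂ] A) (S * S) =
      star (opTensor (1 : A →L[ℂ] A) S) * opTensor (1 : A →L[ℂ] A) S := by
    rw [star_opTensor, opTensor_mul, hS, star_one, one_mul]
  rw [this]
  exact star_mul_self_nonneg _

theorem ext_hilbertBasis {H : Type*} [NormedAddCommGroup H] [InnerProductSpace ℂ H]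
    {V : Type*} [NormedAddCommGroup V] [NormedSpace ℂ V] {ι : Type*} (e : HilbertBasis ι ℂ H)
    {X Y : H →L[ℂ] V} (h : ∀ i, X (e i) = Y (e i)) : X = Y := by
  refine ContinuousLinearMap.ext_on (s := Set.range e) ?_ ?_
  · have := e.dense_span
    rw [Submodule.dense_iff_topologicalClosure_eq_top]
    exact this
  · rintro _ ⟨i, rfl⟩
    exact h i

theorem opTensor_one_apply_eigenvector {R : B →L[ℂ] B} {t : ℝ} {f : B} (hf : R f = (t : ℂ) • f)
    (a : A) : opTensor (1 : A →L[ℂ] A) R (ketTensor a f) = (t : ℂ) • ketTensor a f := by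
  rw [opTensor_ketTensor, hf, map_smul]; rfl

/-- Powers of `1 ⊗ σ`, for a state `σ`. -/
theorem opTensor_one_rpow [CompleteSpace A] [CompleteSpace B] {σ : B →L[ℂ] B} (hσ : IsDensity σ)
    {r : ℝ} (hr : 0 ≤ r) :
    (opTensor (1 : A →L[ℂ] A) σ) ^ r = opTensor (1 : A →L[ℂ] A) (σ ^ r) := by
  obtain ⟨κ, f, t, ht0, hft, -⟩ := hσ.exists_eigenbasis
  obtain ⟨ι, e, -⟩ := exists_hilbertBasis ℂ A
  obtain ⟨g, hg⟩ := exists_tensorBasis e f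
  refine ext_hilbertBasis g fun p => ?_
  rw [hg, rpow_apply_eigenvector (opTensor_one_nonneg hσ.1) hr
      (opTensor_one_apply_eigenvector (hft p.2) _),
    opTensor_one_apply_eigenvector (rpow_apply_eigenvector hσ.1 hr (hft p.2))]

section Blocks

variable [CompleteSpace B]

theorem adjoint_ketTensor_apply (a a' : A) (b : B) :
    ContinuousLinearMap.adjoint (ketTensor a : B →L[ℂ] HTensor A B) (ketTensor a' b) =
      ⟪a, a'⟫_ℂ • b := by
  refine ext_inner_left ℂ fun x => ?_
  rw [ContinuousLinearMap.adjoint_inner_right, inner_ketTensor, inner_smul_right]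

theorem inner_block (X : HTensor A B →L[ℂ] HTensor A B) (a a' : A) (b b' : B) :
    ⟪b, block X a a' b'⟫_ℂ = ⟪ketTensor a b, X (ketTensor a' b')⟫_ℂ := by
  simp only [block, ContinuousLinearMap.comp_apply]
  rw [ContinuousLinearMap.adjoint_inner_right]

theorem block_add_left (X : HTensor A B →L[ℂ] HTensor A B) (a₁ a₂ a' : A) :
    block X (a₁ + a₂) a' = block X a₁ a' + block X a₂ a' := by
  rw [block, ketTensor_add, map_add, ContinuousLinearMap.add_comp]; rfl

theorem block_smul_left (X : HTensor A B →L[ℂ] HTensor A B) (c : ℂ) (a a' : A) :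
    block X (c • a) a' = starRingEnd ℂ c • block X a a' := by
  rw [block, ketTensor_smul, map_smulₛₗ, ContinuousLinearMap.smul_comp]; rfl

theorem block_add_right (X : HTensor A B →L[ℂ] HTensor A B) (a a₁ a₂ : A) :
    block X a (a₁ + a₂) = block X a a₁ + block X a a₂ := by
  rw [block, ketTensor_add, ContinuousLinearMap.comp_add, ContinuousLinearMap.comp_add]; rfl

theorem block_smul_right (X : HTensor A B →L[ℂ] HTensor A B) (c : ℂ) (a a' : A) :
    block X a (c • a') = c • block X a a' := by
  rw [block, ketTensor_smul, ContinuousLinearMap.comp_smul, ContinuousLinearMap.comp_smul]; rfl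

/-- The blocks of an operator as a sesquilinear map. -/
def blockₗ (X : HTensor A B →L[ℂ] HTensor A B) : A →ₗ⋆[ℂ] A →ₗ[ℂ] (B →L[ℂ] B) :=
  LinearMap.mk₂'ₛₗ (starRingEnd ℂ) (RingHom.id ℂ) (block X) (block_add_left X)
    (fun c => block_smul_left X c) (block_add_right X) (fun c => block_smul_right X c)

theorem blockₗ_apply (X : HTensor A B →L[ℂ] HTensor A B) (a a' : A) :
    blockₗ X a a' = block X a a' := rfl

end Blocks

end TensorStructure

section BasisIndependence

variable {A : Type u} [NormedAddCommGroup A] [InnerProductSpace ℂ A]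

/-- The diagonal sum of a sesquilinear map does not depend on the orthonormal basis. -/
theorem sum_diag_eq_sum_diag {V : Type*} [AddCommGroup V] [Module ℂ V]
    (F : A →ₗ⋆[ℂ] A →ₗ[ℂ] V) {ι κ : Type*} [Fintype ι] [Fintype κ] (b : OrthonormalBasis ι ℂ A)
    (e : OrthonormalBasis κ ℂ A) : ∑ i, F (b i) (b i) = ∑ k, F (e k) (e k) := by
  classical
  have h1 : ∀ i, F (b i) (b i) =
      ∑ k, ∑ l, (⟪b i, e k⟫_ℂ * ⟪e l, b i⟫_ℂ) • F (e k) (e l) := by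
    intro i
    conv_lhs => rw [← e.sum_repr' (b i)]
    simp only [map_sum, LinearMap.sum_apply, map_smulₛₗ, LinearMap.smul_apply, RingHom.id_apply,
      inner_conj_symm, Finset.smul_sum, smul_smul]
    rw [Finset.sum_comm]
    refine Finset.sum_congr rfl fun k _ => Finset.sum_congr rfl fun l _ => ?_
    rw [mul_comm]
  simp_rw [h1]
  rw [Finset.sum_comm]
  refine Finset.sum_congr rfl fun k _ => ?_
  rw [Finset.sum_comm]
  have h2 : ∀ l, ∑ i, (⟪b i, e k⟫_ℂ * ⟪e l, b i⟫_ℂ) • F (e k) (e l) =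
      if l = k then F (e k) (e l) else 0 := by
    intro l
    rw [← Finset.sum_smul]
    have : ∑ i, ⟪b i, e k⟫_ℂ * ⟪e l, b i⟫_ℂ = ⟪e l, e k⟫_ℂ := by
      rw [← b.sum_inner_mul_inner]
      exact Finset.sum_congr rfl fun i _ => mul_comm _ _
    rw [this, orthonormal_iff_ite.1 e.orthonormal]
    split_ifs <;> simp
  simp_rw [h2]
  simp

end BasisIndependence

/-! ### The partial trace -/

section PartialTrace

variable {A : Type u} {B : Type v}
  [NormedAddCommGroup A] [InnerProductSpace ℂ A] [FiniteDimensional ℂ A]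
  [NormedAddCommGroup B] [InnerProductSpace ℂ B] [CompleteSpace B]

theorem partialTrace_eq_sum {ι : Type*} [Fintype ι] (b : OrthonormalBasis ι ℂ A)
    (X : HTensor A B →L[ℂ] HTensor A B) : partialTrace X = ∑ i, block X (b i) (b i) :=
  sum_diag_eq_sum_diag (blockₗ X) (stdOrthonormalBasis ℂ A) b

theorem re_inner_partialTrace {ι : Type*} [Fintype ι] (b : OrthonormalBasis ι ℂ A)
    (X : HTensor A B →L[ℂ] HTensor A B) (x y : B) :
    ⟪x, partialTrace X y⟫_ℂ = ∑ i, ⟪ketTensor (b i) x, X (ketTensor (b i) y)⟫_ℂ := by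
  rw [partialTrace_eq_sum b, sum_apply, inner_sum]
  exact Finset.sum_congr rfl fun i _ => inner_block X _ _ _ _

theorem block_nonneg {X : HTensor A B →L[ℂ] HTensor A B} (hX : 0 ≤ X) (a : A) :
    0 ≤ block X a a := by
  rw [ContinuousLinearMap.nonneg_iff_isPositive]
  exact (isPositive_of_nonneg hX).adjoint_conj (ketTensor a)

theorem partialTrace_nonneg {X : HTensor A B →L[ℂ] HTensor A B} (hX : 0 ≤ X) :
    0 ≤ partialTrace X :=
  Finset.sum_nonneg fun _ _ => block_nonneg hX _

theorem partialTrace_sub (X Y : HTensor A B →L[ℂ] HTensor A B) :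
    partialTrace (X - Y) = partialTrace X - partialTrace Y := by
  simp only [partialTrace, ← Finset.sum_sub_distrib]
  refine Finset.sum_congr rfl fun i _ => ?_
  ext x
  simp [block]

theorem partialTrace_mono {X Y : HTensor A B →L[ℂ] HTensor A B} (h : X ≤ Y) :
    partialTrace X ≤ partialTrace Y := by
  rw [← sub_nonneg, ← partialTrace_sub]
  exact partialTrace_nonneg (sub_nonneg.2 h)

theorem trace_partialTrace {X : HTensor A B →L[ℂ] HTensor A B} (hX : 0 ≤ X) :
    trace (partialTrace X) = trace X := by
  obtain ⟨κ, f, -⟩ := exists_hilbertBasis ℂ B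
  let b := stdOrthonormalBasis ℂ A
  obtain ⟨g, hg⟩ := exists_tensorBasis b.toHilbertBasis f
  rw [trace_eq_tsum f _ (partialTrace_nonneg hX), trace_eq_tsum g _ hX,
    ENNReal.tsum_prod', tsum_fintype (L := .unconditional (Fin _)),
    ← Summable.tsum_finsetSum fun _ _ => ENNReal.summable]
  congr 1; funext k
  rw [re_inner_partialTrace b, map_sum, ENNReal.ofReal_sum_of_nonneg]
  · refine Finset.sum_congr rfl fun i _ => ?_
    rw [hg]; simp
  · intro i _
    exact (isPositive_of_nonneg hX).re_inner_nonneg_right _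

theorem IsDensity.partialTrace {ρ : HTensor A B →L[ℂ] HTensor A B} (hρ : IsDensity ρ) :
    IsDensity (partialTrace ρ) :=
  ⟨partialTrace_nonneg hρ.1, by rw [trace_partialTrace hρ.1, hρ.2]⟩

/-- The resolution of the identity of `A ⊗ B` along an orthonormal basis of `A`. -/
theorem sum_ketTensor_adjoint {ι : Type*} [Fintype ι] (b : OrthonormalBasis ι ℂ A)
    (ψ : HTensor A B) :
    ∑ i, ketTensor (b i) (ContinuousLinearMap.adjoint (ketTensor (b i) : B →L[ℂ] HTensor A B) ψ) =
      ψ := by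
  have h : ∑ i, (ketTensor (b i) : B →L[ℂ] HTensor A B) ∘L
      ContinuousLinearMap.adjoint (ketTensor (b i)) = ContinuousLinearMap.id ℂ (HTensor A B) := by
    refine ext_ketTensor fun a x => ?_
    simp only [sum_apply, ContinuousLinearMap.comp_apply, adjoint_ketTensor_apply, map_smul,
      ContinuousLinearMap.id_apply]
    simp_rw [← smul_apply, ← ketTensor_smul]
    rw [← sum_apply]
    have : ∀ s : Finset ι, (∑ i ∈ s, (ketTensor (⟪b i, a⟫_ℂ • b i) : B →L[ℂ] HTensor A B)) =
        ketTensor (∑ i ∈ s, ⟪b i, a⟫_ℂ • b i) := by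
      classical
      intro s
      induction s using Finset.induction_on with
      | empty => ext; simp [ketTensor]
      | insert i s hi ih => rw [Finset.sum_insert hi, Finset.sum_insert hi, ih, ketTensor_add]
    rw [this, b.sum_repr']
  have h2 := congrArg (fun F => F ψ) h
  simpa using h2

/-- The pinching inequality `X ≤ |A| (1 ⊗ Tr_A X)` for positive `X`. -/
theorem le_card_smul_opTensor_partialTrace {X : HTensor A B →L[ℂ] HTensor A B} (hX : 0 ≤ X) :
    X ≤ (Module.finrank ℂ A : ℝ) • opTensor (1 : A →L[ℂ] A) (partialTrace X) := by
  have : CompleteSpace A := FiniteDimensional.complete ℂ A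
  have hP := opTensor_one_nonneg (A := A) (partialTrace_nonneg hX)
  have hsa : ((Module.finrank ℂ A : ℝ) • opTensor (1 : A →L[ℂ] A) (partialTrace X) - X).IsSymmetric := by
    have h1 : IsSelfAdjoint ((Module.finrank ℂ A : ℝ) • opTensor (1 : A →L[ℂ] A) (partialTrace X)) :=
      (IsSelfAdjoint.all _).smul hP.isSelfAdjoint
    exact (h1.sub hX.isSelfAdjoint).isSymmetric
  rw [ContinuousLinearMap.le_def, ContinuousLinearMap.isPositive_def]
  refine ⟨hsa, fun ψ => ?_⟩
  let b := stdOrthonormalBasis ℂ A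
  set φ : Fin (Module.finrank ℂ A) → B :=
    fun i => ContinuousLinearMap.adjoint (ketTensor (b i) : B →L[ℂ] HTensor A B) ψ with hφ
  have hψ : ψ = ∑ i, ketTensor (b i) (φ i) := (sum_ketTensor_adjoint b ψ).symm
  set S := CFC.sqrt X with hS
  have hSX : S * S = X := CFC.sqrt_mul_sqrt_self X hX
  have hS0 : 0 ≤ S := CFC.sqrt_nonneg X
  have hq : ∀ x, RCLike.re ⟪x, X x⟫_ℂ = ‖S x‖ ^ 2 := fun x => by
    rw [← hSX, mul_apply_eq_comp, ← inner_apply_eq_inner_apply hS0,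
      inner_self_eq_norm_sq (𝕜 := ℂ)]
  -- Cauchy–Schwarz over the index of the basis of `A`
  have h1 : RCLike.re ⟪ψ, X ψ⟫_ℂ ≤
      (Module.finrank ℂ A : ℝ) * ∑ i, RCLike.re ⟪ketTensor (b i) (φ i), X (ketTensor (b i) (φ i))⟫_ℂ := by
    simp_rw [hq]
    calc ‖S ψ‖ ^ 2 ≤ (∑ i, ‖S (ketTensor (b i) (φ i))‖) ^ 2 := by
          gcongr
          conv_lhs => rw [hψ, map_sum]
          exact norm_sum_le _ _
      _ ≤ _ := by
          have := sq_sum_le_card_mul_sum_sq (s := Finset.univ)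
            (f := fun i => ‖S (ketTensor (b i) (φ i))‖)
          simpa using this
  have h2 : ∀ i, RCLike.re ⟪ketTensor (b i) (φ i), X (ketTensor (b i) (φ i))⟫_ℂ ≤
      RCLike.re ⟪φ i, partialTrace X (φ i)⟫_ℂ := by
    intro i
    rw [re_inner_partialTrace b, map_sum]
    exact Finset.single_le_sum
      (f := fun j => RCLike.re ⟪ketTensor (b j) (φ i), X (ketTensor (b j) (φ i))⟫_ℂ)
      (fun j _ => (isPositive_of_nonneg hX).re_inner_nonneg_right _) (Finset.mem_univ i)
  have h3 : RCLike.re ⟪ψ, opTensor (1 : A →L[ℂ] A) (partialTrace X) ψ⟫_ℂ =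
      ∑ i, RCLike.re ⟪φ i, partialTrace X (φ i)⟫_ℂ := by
    classical
    conv_lhs => rw [hψ]
    simp only [map_sum, sum_inner, inner_sum, opTensor_ketTensor, inner_ketTensor,
      one_apply_eq_self, orthonormal_iff_ite.1 b.orthonormal, ite_mul, one_mul, zero_mul,
      Finset.sum_ite_eq', Finset.mem_univ, if_true]
  rw [ContinuousLinearMap.reApplyInnerSelf_apply, ← inner_re_symm]
  have hsm : ((Module.finrank ℂ A : ℝ) • opTensor (1 : A →L[ℂ] A) (partialTrace X) - X) ψ =
      ((Module.finrank ℂ A : ℝ) : ℂ) • opTensor (1 : A →L[ℂ] A) (partialTrace X) ψ - X ψ := by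
    rw [sub_apply, smul_apply]; rfl
  rw [hsm, inner_sub_right, map_sub, inner_smul_right, RCLike.re_to_complex, Complex.re_ofReal_mul,
    ← RCLike.re_to_complex, h3, sub_nonneg]
  exact h1.trans (mul_le_mul_of_nonneg_left (Finset.sum_le_sum fun i _ => h2 i) (Nat.cast_nonneg _))

end PartialTrace


/-! ### The Choi state and the decoupling operator -/

section Choi

variable {A : Type u} {C : Type w} {E : Type v}
  [NormedAddCommGroup A] [InnerProductSpace ℂ A] [CompleteSpace A] [FiniteDimensional ℂ A]
  [NormedAddCommGroup C] [InnerProductSpace ℂ C] [CompleteSpace C]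
  [NormedAddCommGroup E] [InnerProductSpace ℂ E] [CompleteSpace E]
  {ι : Type*} [Fintype ι]

theorem opTensor_rankOne (a a' : A) (R : C →L[ℂ] C) :
    opTensor (InnerProductSpace.rankOne ℂ a a') R =
      (ketTensor a : C →L[ℂ] HTensor A C) ∘L R ∘L ContinuousLinearMap.adjoint (ketTensor a') := by
  refine ext_ketTensor fun x y => ?_
  rw [opTensor_ketTensor, InnerProductSpace.rankOne_apply, ContinuousLinearMap.comp_apply,
    ContinuousLinearMap.comp_apply, adjoint_ketTensor_apply, ketTensor_smul, map_smul, map_smul]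
  rfl

theorem block_opTensor (S : A →L[ℂ] A) (R : C →L[ℂ] C) (a a' : A) :
    block (opTensor S R) a a' = ⟪a, S a'⟫_ℂ • R := by
  refine ContinuousLinearMap.ext fun x => ext_inner_left ℂ fun y => ?_
  rw [inner_block, opTensor_ketTensor, inner_ketTensor, smul_apply, inner_smul_right]

theorem block_smul (c : ℂ) (X : HTensor A C →L[ℂ] HTensor A C) (a a' : A) :
    block (c • X) a a' = c • block X a a' := by
  refine ContinuousLinearMap.ext fun x => ext_inner_left ℂ fun y => ?_
  rw [inner_block, smul_apply, smul_apply, inner_smul_right, inner_smul_right, inner_block]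

theorem block_sum {κ : Type*} (s : Finset κ) (X : κ → HTensor A C →L[ℂ] HTensor A C) (a a' : A) :
    block (∑ k ∈ s, X k) a a' = ∑ k ∈ s, block (X k) a a' := by
  refine ContinuousLinearMap.ext fun x => ext_inner_left ℂ fun y => ?_
  rw [inner_block, sum_apply, sum_apply, inner_sum, inner_sum]
  exact Finset.sum_congr rfl fun k _ => (inner_block _ _ _ _ _).symm

theorem block_choi (b : OrthonormalBasis ι ℂ A) (T : (A →L[ℂ] A) →CP (C →L[ℂ] C)) (i j : ι) :
    block (choi b T) (b i) (b j) =
      (Fintype.card ι : ℂ)⁻¹ • T (InnerProductSpace.rankOne ℂ (b i) (b j)) := by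
  classical
  rw [choi, block_smul, block_sum]
  simp_rw [block_sum, block_opTensor, InnerProductSpace.rankOne_apply, inner_smul_right,
    orthonormal_iff_ite.1 b.orthonormal, mul_ite, mul_one, mul_zero, ite_smul, one_smul, zero_smul]
  simp

/-- Complete positivity is applied to the positive matrix with entries `|bᵢ⟩⟨bⱼ|`. Its image is a sum
of matrices of operators of the form `N⋆ N`, and each of them contributes an operator `∑ₖ Gₖ⋆ Gₖ`. -/
theorem choi_nonneg (b : OrthonormalBasis ι ℂ A) (T : (A →L[ℂ] A) →CP (C →L[ℂ] C)) :
    0 ≤ choi b T := by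
  classical
  -- the matrix `|bᵢ⟩⟨bⱼ|` is positive, being of the form `N⋆ N`
  let M : CStarMatrix ι ι (A →L[ℂ] A) :=
    CStarMatrix.ofMatrix fun i j => InnerProductSpace.rankOne ℂ (b i) (b j)
  have hM : 0 ≤ M := by
    rcases isEmpty_or_nonempty ι with hι | ⟨⟨i₀⟩⟩
    · have : M = 0 := by ext i; exact (hι.false i).elim
      rw [this]
    · let N : CStarMatrix ι ι (A →L[ℂ] A) :=
        CStarMatrix.ofMatrix fun k j =>
          if k = i₀ then InnerProductSpace.rankOne ℂ (b i₀) (b j) else 0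
      have hNe : ∀ k j, N k j =
          if k = i₀ then InnerProductSpace.rankOne ℂ (b i₀) (b j) else 0 := fun _ _ => rfl
      have hN : M = star N * N := by
        ext i j x
        have h1 : (star N * N) i j = InnerProductSpace.rankOne ℂ (b i) (b j) := by
          rw [CStarMatrix.mul_apply, Finset.sum_eq_single i₀]
          · rw [CStarMatrix.star_apply]
            simp only [hNe, if_true, ContinuousLinearMap.star_eq_adjoint]
            ext y
            refine ext_inner_left ℂ fun z => ?_
            rw [mul_apply_eq_comp, ContinuousLinearMap.adjoint_inner_right]
            simp only [InnerProductSpace.rankOne_apply, inner_smul_left, inner_smul_right,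
              inner_self_eq_norm_sq_to_K, b.orthonormal.norm_eq_one, inner_conj_symm]
            simp [mul_comm]
          · intro k _ hk
            simp [hNe, hk]
          · simp
        rw [h1]; rfl
      rw [hN]
      exact star_mul_self_nonneg N
  have hTM : 0 ≤ M.map T := T.map_cstarMatrix_nonneg M hM
  let Θ : CStarMatrix ι ι (C →L[ℂ] C) → (HTensor A C →L[ℂ] HTensor A C) := fun L =>
    ∑ i, ∑ j, (ketTensor (b i) : C →L[ℂ] HTensor A C) ∘L (L i j) ∘L
      ContinuousLinearMap.adjoint (ketTensor (b j))
  have hΘ : ∀ L ∈ AddSubmonoid.closure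
      (Set.range fun s : CStarMatrix ι ι (C →L[ℂ] C) => star s * s), 0 ≤ Θ L := by
    intro L hL
    induction hL using AddSubmonoid.closure_induction with
    | mem L hL =>
      obtain ⟨N, rfl⟩ := hL
      let G : ι → (HTensor A C →L[ℂ] C) := fun k =>
        ∑ j, N k j ∘L ContinuousLinearMap.adjoint (ketTensor (b j))
      have hij : ∀ i j, (star N * N) i j = ∑ k, ContinuousLinearMap.adjoint (N k i) ∘L N k j := by
        intro i j
        rw [CStarMatrix.mul_apply]
        rfl
      have h2 : Θ (star N * N) = ∑ k, ContinuousLinearMap.adjoint (G k) ∘L G k := by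
        refine ContinuousLinearMap.ext fun x => ext_inner_left ℂ fun y => ?_
        simp only [Θ, hij, sum_apply, inner_sum, ContinuousLinearMap.comp_apply, map_sum]
        have h3 : ∀ k, ⟪y, ContinuousLinearMap.adjoint (G k) (G k x)⟫_ℂ = ∑ i, ∑ j,
            ⟪y, ketTensor (b i) (ContinuousLinearMap.adjoint (N k i) (N k j
              (ContinuousLinearMap.adjoint (ketTensor (b j)) x)))⟫_ℂ := by
          intro k
          rw [ContinuousLinearMap.adjoint_inner_right]
          simp only [G, sum_apply, sum_inner, inner_sum, ContinuousLinearMap.comp_apply]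
          rw [Finset.sum_comm]
          refine Finset.sum_congr rfl fun i _ => Finset.sum_congr rfl fun j _ => ?_
          rw [← ContinuousLinearMap.adjoint_inner_right, ContinuousLinearMap.adjoint_inner_left]
        rw [Finset.sum_congr rfl fun k _ => h3 k]
        symm
        rw [Finset.sum_comm]
        refine Finset.sum_congr rfl fun i _ => ?_
        rw [Finset.sum_comm]
      rw [h2]
      refine Finset.sum_nonneg fun k _ => ?_
      rw [ContinuousLinearMap.nonneg_iff_isPositive]
      exact ContinuousLinearMap.isPositive_adjoint_comp_self (G k)
    | zero =>
      have : Θ 0 = 0 := by simp [Θ]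
      rw [this]
    | add L L' _ _ h h' =>
      have : Θ (L + L') = Θ L + Θ L' := by
        simp only [Θ, ← Finset.sum_add_distrib]
        refine Finset.sum_congr rfl fun i _ => Finset.sum_congr rfl fun j _ => ?_
        rw [← ContinuousLinearMap.comp_add, ← ContinuousLinearMap.add_comp]
        rfl
      rw [this]
      exact add_nonneg h h'
  have hsum : choi b T = (Fintype.card ι : ℝ)⁻¹ • Θ (M.map T) := by
    have h2 : ∑ i, ∑ j, opTensor (InnerProductSpace.rankOne ℂ (b i) (b j))
        (T (InnerProductSpace.rankOne ℂ (b i) (b j))) = Θ (M.map T) := by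
      simp only [Θ, opTensor_rankOne]
      rfl
    rw [choi, h2]
    refine ContinuousLinearMap.ext fun x => ?_
    rw [smul_apply, smul_apply, ← Complex.coe_smul]
    simp
  rw [hsum]
  exact smul_nonneg (by positivity) (hΘ _ (StarOrderedRing.nonneg_iff.1 hTM))

theorem isDensity_choi [Nonempty ι] (b : OrthonormalBasis ι ℂ A)
    {T : (A →L[ℂ] A) →CP (C →L[ℂ] C)} (hT : IsChannel T) : IsDensity (choi b T) := by
  refine ⟨choi_nonneg b T, ?_⟩
  rw [← trace_partialTrace (choi_nonneg b T), partialTrace_eq_sum b]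
  simp_rw [block_choi]
  rw [← Finset.smul_sum, ← map_sum, ← map_smul]
  have h1 : ∑ i, InnerProductSpace.rankOne ℂ (b i) (b i) = (1 : A →L[ℂ] A) := by
    refine ContinuousLinearMap.ext fun x => ?_
    simp only [sum_apply, InnerProductSpace.rankOne_apply, b.sum_repr']
    rfl
  rw [h1]
  have hd : (0 : ℝ) ≤ (Fintype.card ι : ℝ)⁻¹ := by positivity
  have h2 : ((Fintype.card ι : ℂ)⁻¹) • (1 : A →L[ℂ] A) = (Fintype.card ι : ℝ)⁻¹ • 1 := by
    refine ContinuousLinearMap.ext fun x => ?_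
    rw [smul_apply, smul_apply, ← Complex.coe_smul]
    simp
  have h3 : (0 : A →L[ℂ] A) ≤ (Fintype.card ι : ℝ)⁻¹ • 1 :=
    smul_nonneg hd zero_le_one
  rw [h2, hT _ h3, trace_eq_tsum b.toHilbertBasis _ h3, tsum_fintype]
  have h4 : ∀ i, RCLike.re ⟪b i, ((Fintype.card ι : ℝ)⁻¹ • (1 : A →L[ℂ] A)) (b i)⟫_ℂ =
      (Fintype.card ι : ℝ)⁻¹ := by
    intro i
    rw [smul_apply, ← Complex.coe_smul, inner_smul_right, one_apply_eq_self,
      inner_self_eq_norm_sq_to_K, b.orthonormal.norm_eq_one]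
    simp
  simp only [OrthonormalBasis.coe_toHilbertBasis, h4]
  rw [Finset.sum_const, nsmul_eq_mul, Finset.card_univ, ENNReal.ofReal_inv_of_pos (by positivity),
    ENNReal.ofReal_natCast]
  exact ENNReal.mul_inv_cancel (by simp) (by simp)

theorem ampliation_eq_sum (b : OrthonormalBasis ι ℂ A) (T : (A →L[ℂ] A) →ₗ[ℂ] (C →L[ℂ] C))
    (X : HTensor A E →L[ℂ] HTensor A E) :
    ampliation T X = ∑ i, ∑ j, opTensor (T (InnerProductSpace.rankOne ℂ (b i) (b j)))
      (block X (b i) (b j)) := by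
  let e := stdOrthonormalBasis ℂ A
  let F₁ : A →ₗ⋆[ℂ] A →ₗ[ℂ] (HTensor C E →L[ℂ] HTensor C E) :=
    LinearMap.mk₂'ₛₗ (starRingEnd ℂ) (RingHom.id ℂ)
      (fun x y => ∑ j, opTensor (T (InnerProductSpace.rankOne ℂ y (e j))) (block X x (e j)))
      (fun x x' y => by
        simp only [block_add_left, opTensor_add_right, Finset.sum_add_distrib])
      (fun c x y => by
        simp only [block_smul_left, opTensor_smul_right, Finset.smul_sum])
      (fun x y y' => by
        simp only [map_add, add_apply, opTensor_add_left, Finset.sum_add_distrib])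
      (fun c x y => by
        simp only [map_smul, smul_apply, opTensor_smul_left, Finset.smul_sum, RingHom.id_apply])
  let F₂ : ι → A →ₗ⋆[ℂ] A →ₗ[ℂ] (HTensor C E →L[ℂ] HTensor C E) := fun i =>
    LinearMap.mk₂'ₛₗ (starRingEnd ℂ) (RingHom.id ℂ)
      (fun x y => opTensor (T (InnerProductSpace.rankOne ℂ (b i) x)) (block X (b i) y))
      (fun x x' y => by simp only [map_add, opTensor_add_left])
      (fun c x y => by simp only [map_smulₛₗ, opTensor_smul_left, RingHom.id_apply])
      (fun x y y' => by simp only [block_add_right, opTensor_add_right])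
      (fun c x y => by simp only [block_smul_right, opTensor_smul_right, RingHom.id_apply])
  have h1 : ampliation T X = ∑ i, F₁ (b i) (b i) := sum_diag_eq_sum_diag F₁ e b
  rw [h1]
  exact Finset.sum_congr rfl fun i _ => sum_diag_eq_sum_diag (F₂ i) e b

/-- The coefficients of `d U ⊗ Ū` minus its Haar average, in an orthonormal basis of `A`. -/
def decouplingCoeff [DecidableEq ι] (b : OrthonormalBasis ι ℂ A) (U : A →L[ℂ] A) (i j k l : ι) :
    ℂ :=
  Fintype.card ι * (⟪b i, U (b k)⟫_ℂ * starRingEnd ℂ ⟪b j, U (b l)⟫_ℂ) -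
    (if i = j then 1 else 0) * (if k = l then 1 else 0)

/-- Local conjugation by `U` acts on the matrix of blocks by the matrix of `U`. -/
theorem block_conj (U : A →L[ℂ] A) (ρ : HTensor A E →L[ℂ] HTensor A E)
    (b : OrthonormalBasis ι ℂ A) (i j : ι) :
    block (opTensor U (1 : E →L[ℂ] E) * ρ * opTensor (star U) (1 : E →L[ℂ] E)) (b i) (b j) =
      ∑ k, ∑ l, (⟪b i, U (b k)⟫_ℂ * starRingEnd ℂ ⟪b j, U (b l)⟫_ℂ) • block ρ (b k) (b l) := by
  have h1 : ∀ x y, block (opTensor U (1 : E →L[ℂ] E) * ρ * opTensor (star U) (1 : E →L[ℂ] E)) x y =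
      block ρ (star U x) (star U y) := by
    intro x y
    refine ContinuousLinearMap.ext fun z => ext_inner_left ℂ fun w => ?_
    rw [inner_block, inner_block, mul_apply_eq_comp, mul_apply_eq_comp, opTensor_ketTensor,
      one_apply_eq_self]
    have h2 : opTensor U (1 : E →L[ℂ] E) =
        ContinuousLinearMap.adjoint (opTensor (star U) (1 : E →L[ℂ] E)) := by
      rw [← ContinuousLinearMap.star_eq_adjoint, star_opTensor, star_star, star_one]
    rw [h2, ContinuousLinearMap.adjoint_inner_right, opTensor_ketTensor, one_apply_eq_self]
  have h3 : ∀ x : A, star U x = ∑ k, starRingEnd ℂ ⟪x, U (b k)⟫_ℂ • b k := by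
    intro x
    rw [← b.sum_repr' (star U x)]
    refine Finset.sum_congr rfl fun k _ => ?_
    rw [ContinuousLinearMap.star_eq_adjoint, ContinuousLinearMap.adjoint_inner_right,
      inner_conj_symm]
  rw [h1, ← blockₗ_apply, h3 (b i), h3 (b j)]
  simp only [map_sum, LinearMap.sum_apply, map_smulₛₗ, LinearMap.smul_apply, RingHom.id_apply,
    Finset.smul_sum, smul_smul, blockₗ_apply, starRingEnd_self_apply]
  rw [Finset.sum_comm]
  refine Finset.sum_congr rfl fun k _ => Finset.sum_congr rfl fun l _ => ?_
  rw [mul_comm]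

/-- The operator whose trace norm measures the failure of decoupling, in terms of the blocks of the
Choi state and of `ρ`. -/
theorem ampliation_sub_eq_sum [DecidableEq ι] [Nonempty ι] (b : OrthonormalBasis ι ℂ A)
    (T : (A →L[ℂ] A) →CP (C →L[ℂ] C)) (U : A →L[ℂ] A) (ρ : HTensor A E →L[ℂ] HTensor A E) :
    ampliation T.toLinearMap
        (opTensor U (1 : E →L[ℂ] E) * ρ * opTensor (star U) (1 : E →L[ℂ] E)) -
      opTensor (partialTrace (choi b T)) (partialTrace ρ) =
    ∑ i, ∑ j, ∑ k, ∑ l, decouplingCoeff b U i j k l •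
      opTensor (block (choi b T) (b i) (b j)) (block ρ (b k) (b l)) := by
  have hd : (Fintype.card ι : ℂ) ≠ 0 := by simp
  have hT : ∀ i j, T.toLinearMap (InnerProductSpace.rankOne ℂ (b i) (b j)) =
      (Fintype.card ι : ℂ) • block (choi b T) (b i) (b j) := by
    intro i j
    rw [block_choi, smul_smul, mul_inv_cancel₀ hd, one_smul]; rfl
  have h1 : ∀ i j, opTensor (T.toLinearMap (InnerProductSpace.rankOne ℂ (b i) (b j)))
      (block (opTensor U (1 : E →L[ℂ] E) * ρ * opTensor (star U) (1 : E →L[ℂ] E)) (b i) (b j)) =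
      ∑ k, ∑ l, ((Fintype.card ι : ℂ) * (⟪b i, U (b k)⟫_ℂ * starRingEnd ℂ ⟪b j, U (b l)⟫_ℂ)) •
        opTensor (block (choi b T) (b i) (b j)) (block ρ (b k) (b l)) := by
    intro i j
    rw [hT, block_conj, opTensor_smul_left, ← opTensorₗ_apply]
    simp only [map_sum, map_smul, Finset.smul_sum, smul_smul, opTensorₗ_apply]
  have h2 : opTensor (∑ i, block (choi b T) (b i) (b i)) (∑ k, block ρ (b k) (b k)) =
      ∑ i, ∑ j, ∑ k, ∑ l, ((if i = j then 1 else 0) * (if k = l then 1 else 0) : ℂ) •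
        opTensor (block (choi b T) (b i) (b j)) (block ρ (b k) (b l)) := by
    rw [← opTensorₗ_apply]
    simp only [map_sum, LinearMap.sum_apply, opTensorₗ_apply]
    rw [Finset.sum_comm]
    refine Finset.sum_congr rfl fun i _ => ?_
    conv_rhs => rw [Finset.sum_eq_single i (fun j _ hj => by simp [hj.symm]) (by simp)]
    refine Finset.sum_congr rfl fun k _ => ?_
    conv_rhs => rw [Finset.sum_eq_single k (fun j _ hj => by simp [hj.symm]) (by simp)]
    simp
  rw [ampliation_eq_sum b, partialTrace_eq_sum b, partialTrace_eq_sum b, h2]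
  simp only [h1, decouplingCoeff, sub_smul, Finset.sum_sub_distrib]

end Choi


/-! ### First and second moments of the Haar measure -/

section Haar

variable {A : Type u} [NormedAddCommGroup A] [InnerProductSpace ℂ A] [CompleteSpace A]
  [FiniteDimensional ℂ A] {ι : Type*} [Fintype ι]

instance isHaarMeasure_haarUnitary : (haarUnitary A).IsHaarMeasure :=
  Measure.isHaarMeasure_haarMeasure ⊤

instance isProbabilityMeasure_haarUnitary : IsProbabilityMeasure (haarUnitary A) :=
  ⟨by
    have h := Measure.haarMeasure_self
      (K₀ := (⊤ : TopologicalSpace.PositiveCompacts (unitary (A →L[ℂ] A))))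
    simpa [haarUnitary] using h⟩

theorem integrable_of_continuous {V : Type*} [NormedAddCommGroup V]
    {f : unitary (A →L[ℂ] A) → V} (hf : Continuous f) : Integrable f (haarUnitary A) :=
  hf.integrable_of_hasCompactSupport (HasCompactSupport.of_compactSpace f)

/-- The matrix of an operator in an orthonormal basis. -/
def matrixOf (b : OrthonormalBasis ι ℂ A) (U : A →L[ℂ] A) : Matrix ι ι ℂ :=
  Matrix.of fun i k => ⟪b i, U (b k)⟫_ℂ

theorem matrixOf_apply (b : OrthonormalBasis ι ℂ A) (U : A →L[ℂ] A) (i k : ι) :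
    matrixOf b U i k = ⟪b i, U (b k)⟫_ℂ := rfl

theorem matrixOf_mul (b : OrthonormalBasis ι ℂ A) (U V : A →L[ℂ] A) :
    matrixOf b (U * V) = matrixOf b U * matrixOf b V := by
  ext i k
  rw [Matrix.mul_apply, matrixOf_apply, mul_apply_eq_comp]
  conv_lhs => rw [← b.sum_repr' (V (b k))]
  simp only [map_sum, map_smul, inner_sum, inner_smul_right, matrixOf_apply]
  exact Finset.sum_congr rfl fun j _ => mul_comm _ _

open scoped Matrix in
theorem matrixOf_star (b : OrthonormalBasis ι ℂ A) (U : A →L[ℂ] A) :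
    matrixOf b (star U) = (matrixOf b U)ᴴ := by
  ext i k
  rw [Matrix.conjTranspose_apply, matrixOf_apply, matrixOf_apply,
    ContinuousLinearMap.star_eq_adjoint, ContinuousLinearMap.adjoint_inner_right]
  exact (inner_conj_symm _ _).symm

theorem matrixOf_one [DecidableEq ι] (b : OrthonormalBasis ι ℂ A) :
    matrixOf b (1 : A →L[ℂ] A) = 1 := by
  ext i k
  rw [matrixOf_apply, one_apply_eq_self, orthonormal_iff_ite.1 b.orthonormal, Matrix.one_apply]

open scoped Matrix in
theorem matrixOf_conjTranspose_mul_self [DecidableEq ι] (b : OrthonormalBasis ι ℂ A)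
    (U : unitary (A →L[ℂ] A)) : (matrixOf b (U : A →L[ℂ] A))ᴴ * matrixOf b (U : A →L[ℂ] A) = 1 := by
  rw [← matrixOf_star, ← matrixOf_mul, Unitary.coe_star_mul_self, matrixOf_one]

theorem continuous_matrixOf (b : OrthonormalBasis ι ℂ A) (i k : ι) :
    Continuous fun U : unitary (A →L[ℂ] A) => matrixOf b (U : A →L[ℂ] A) i k := by
  simp only [matrixOf_apply]
  exact continuous_const.inner
    (((ContinuousLinearMap.apply ℂ A (b k)).continuous).comp continuous_subtype_val)

open scoped Matrix in
/-- The matrix of `U r U⋆`. -/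
def twirl (b : OrthonormalBasis ι ℂ A) (r : Matrix ι ι ℂ) (U : A →L[ℂ] A) : Matrix ι ι ℂ :=
  matrixOf b U * r * (matrixOf b U)ᴴ

theorem twirl_apply (b : OrthonormalBasis ι ℂ A) (r : Matrix ι ι ℂ) (U : A →L[ℂ] A) (i j : ι) :
    twirl b r U i j =
      ∑ k, ∑ l, matrixOf b U i k * starRingEnd ℂ (matrixOf b U j l) * r k l := by
  simp only [twirl, Matrix.mul_apply, Matrix.conjTranspose_apply, Finset.sum_mul]
  rw [Finset.sum_comm]
  refine Finset.sum_congr rfl fun k _ => Finset.sum_congr rfl fun l _ => ?_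
  rw [starRingEnd_apply]; ring

theorem twirl_mul_apply (b : OrthonormalBasis ι ℂ A) (r : Matrix ι ι ℂ) (V U : A →L[ℂ] A)
    (i j : ι) : twirl b r (V * U) i j =
      ∑ k, ∑ l, matrixOf b V i k * starRingEnd ℂ (matrixOf b V j l) * twirl b r U k l := by
  rw [← twirl_apply b (twirl b r U) V]
  simp only [twirl, matrixOf_mul, Matrix.conjTranspose_mul, Matrix.mul_assoc]

@[fun_prop]
theorem continuous_twirl (b : OrthonormalBasis ι ℂ A) (r : Matrix ι ι ℂ) (i j : ι) :
    Continuous fun U : unitary (A →L[ℂ] A) => twirl b r (U : A →L[ℂ] A) i j := by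
  simp only [twirl_apply]
  have := continuous_matrixOf b
  fun_prop

theorem trace_twirl [DecidableEq ι] (b : OrthonormalBasis ι ℂ A) (r : Matrix ι ι ℂ)
    (U : unitary (A →L[ℂ] A)) : (twirl b r (U : A →L[ℂ] A)).trace = r.trace := by
  rw [twirl, Matrix.trace_mul_comm, ← Matrix.mul_assoc, matrixOf_conjTranspose_mul_self,
    Matrix.one_mul]

open scoped Matrix in
theorem trace_conjTranspose_mul_self_eq (r : Matrix ι ι ℂ) :
    (rᴴ * r).trace = ((∑ i, ∑ j, ‖r i j‖ ^ 2 : ℝ) : ℂ) := by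
  simp only [Matrix.trace, Matrix.diag_apply, Matrix.mul_apply, Matrix.conjTranspose_apply]
  rw [Finset.sum_comm]
  push_cast
  refine Finset.sum_congr rfl fun i _ => Finset.sum_congr rfl fun j _ => ?_
  rw [← Complex.conj_mul', starRingEnd_apply]

theorem sum_norm_twirl_sq [DecidableEq ι] (b : OrthonormalBasis ι ℂ A) (r : Matrix ι ι ℂ)
    (U : unitary (A →L[ℂ] A)) :
    ∑ i, ∑ j, ‖twirl b r (U : A →L[ℂ] A) i j‖ ^ 2 = ∑ i, ∑ j, ‖r i j‖ ^ 2 := by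
  have h := matrixOf_conjTranspose_mul_self b U
  have h1 : ((twirl b r (U : A →L[ℂ] A)).conjTranspose * twirl b r (U : A →L[ℂ] A)).trace =
      (r.conjTranspose * r).trace := by
    set m := matrixOf b (U : A →L[ℂ] A)
    have h2 : (twirl b r (U : A →L[ℂ] A)).conjTranspose * twirl b r (U : A →L[ℂ] A) =
        m * (r.conjTranspose * r * m.conjTranspose) := by
      simp only [twirl, Matrix.conjTranspose_mul, Matrix.conjTranspose_conjTranspose]
      calc m * (r.conjTranspose * m.conjTranspose) * (m * r * m.conjTranspose)
          = m * (r.conjTranspose * ((m.conjTranspose * m) * (r * m.conjTranspose))) := by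
            simp only [Matrix.mul_assoc]
        _ = _ := by rw [h, Matrix.one_mul, Matrix.mul_assoc]
    rw [h2, Matrix.trace_mul_comm, Matrix.mul_assoc, h, Matrix.mul_one]
  rw [trace_conjTranspose_mul_self_eq, trace_conjTranspose_mul_self_eq] at h1
  exact_mod_cast h1

/-- Rank-one perturbations of the identity provide the three kinds of unitaries used for the
moments: phases, transpositions and square roots of transpositions. -/
theorem one_add_smul_rankOne_mem_unitary (v : A) (c : ℂ)
    (h : c + starRingEnd ℂ c + starRingEnd ℂ c * c * ⟪v, v⟫_ℂ = 0) :
    (1 + c • InnerProductSpace.rankOne ℂ v v : A →L[ℂ] A) ∈ unitary (A →L[ℂ] A) := by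
  have hs : star (InnerProductSpace.rankOne ℂ v v : A →L[ℂ] A) = InnerProductSpace.rankOne ℂ v v := by
    refine ContinuousLinearMap.ext fun x => ext_inner_left ℂ fun y => ?_
    rw [ContinuousLinearMap.star_eq_adjoint, ContinuousLinearMap.adjoint_inner_right,
      InnerProductSpace.rankOne_apply, InnerProductSpace.rankOne_apply, inner_smul_left,
      inner_smul_right, inner_conj_symm, mul_comm]
  have hm : (InnerProductSpace.rankOne ℂ v v : A →L[ℂ] A) * InnerProductSpace.rankOne ℂ v v =
      ⟪v, v⟫_ℂ • InnerProductSpace.rankOne ℂ v v := by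
    refine ContinuousLinearMap.ext fun x => ?_
    simp only [mul_apply_eq_comp, InnerProductSpace.rankOne_apply, smul_apply, inner_smul_right,
      smul_smul]
    rw [mul_comm]
  rw [Unitary.mem_iff]
  constructor
  · rw [star_add, star_one, star_smul, hs, add_mul, one_mul, mul_add, mul_one, smul_mul_smul_comm,
      hm, smul_smul, add_assoc, ← add_smul, ← add_smul]
    convert add_zero (1 : A →L[ℂ] A) using 2
    rw [← zero_smul ℂ (InnerProductSpace.rankOne ℂ v v : A →L[ℂ] A), ← h]
    congr 1
    rw [starRingEnd_apply]; ring
  · rw [star_add, star_one, star_smul, hs, add_mul, one_mul, mul_add, mul_one, smul_mul_smul_comm,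
      hm, smul_smul, add_assoc, ← add_smul, ← add_smul]
    convert add_zero (1 : A →L[ℂ] A) using 2
    rw [← zero_smul ℂ (InnerProductSpace.rankOne ℂ v v : A →L[ℂ] A), ← h]
    congr 1
    rw [starRingEnd_apply]; ring

theorem matrixOf_one_add_smul_rankOne [DecidableEq ι] (b : OrthonormalBasis ι ℂ A) (v : A) (c : ℂ)
    (i k : ι) : matrixOf b (1 + c • InnerProductSpace.rankOne ℂ v v) i k =
      (if i = k then 1 else 0) + c * (⟪v, b k⟫_ℂ * ⟪b i, v⟫_ℂ) := by
  rw [matrixOf_apply, add_apply, inner_add_right, one_apply_eq_self,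
    orthonormal_iff_ite.1 b.orthonormal, smul_apply, inner_smul_right,
    InnerProductSpace.rankOne_apply, inner_smul_right]

/-- The unitary multiplying the `p`-th basis vector by the imaginary unit. -/
theorem exists_phase [DecidableEq ι] (b : OrthonormalBasis ι ℂ A) (p : ι) :
    ∃ V : unitary (A →L[ℂ] A), ∀ i k, matrixOf b (V : A →L[ℂ] A) i k =
      if i = k then (if i = p then Complex.I else 1) else 0 := by
  refine ⟨⟨_, one_add_smul_rankOne_mem_unitary (b p) (Complex.I - 1) ?_⟩, fun i k => ?_⟩
  · rw [orthonormal_iff_ite.1 b.orthonormal]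
    simp only [map_sub, Complex.conj_I, map_one, if_true]
    linear_combination (-1 : ℂ) * Complex.I_mul_I
  · rw [matrixOf_one_add_smul_rankOne, orthonormal_iff_ite.1 b.orthonormal,
      orthonormal_iff_ite.1 b.orthonormal]
    by_cases h1 : i = k
    · subst h1
      by_cases h2 : i = p <;> simp [h2]
    · by_cases h2 : i = p
      · subst h2; simp [h1]
      · simp [h1, h2]

theorem inner_sub_basis [DecidableEq ι] (b : OrthonormalBasis ι ℂ A) {p q : ι} (hpq : p ≠ q) :
    ⟪b p - b q, b p - b q⟫_ℂ = 2 := by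
  simp only [inner_sub_left, inner_sub_right, orthonormal_iff_ite.1 b.orthonormal]
  simp [hpq, hpq.symm]
  norm_num

/-- The unitary exchanging two basis vectors. -/
theorem exists_swap [DecidableEq ι] (b : OrthonormalBasis ι ℂ A) (p q : ι) :
    ∃ V : unitary (A →L[ℂ] A), ∀ i k, matrixOf b (V : A →L[ℂ] A) i k =
      if k = Equiv.swap p q i then 1 else 0 := by
  by_cases hpq : p = q
  · subst hpq
    refine ⟨1, fun i k => ?_⟩
    rw [OneMemClass.coe_one, matrixOf_one, Matrix.one_apply]
    simp [eq_comm]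
  refine ⟨⟨_, one_add_smul_rankOne_mem_unitary (b p - b q) (-1) ?_⟩, fun i k => ?_⟩
  · rw [inner_sub_basis b hpq]; simp; norm_num
  · rw [matrixOf_one_add_smul_rankOne]
    simp only [inner_sub_left, inner_sub_right, orthonormal_iff_ite.1 b.orthonormal]
    by_cases h1 : i = p
    · subst h1
      rw [Equiv.swap_apply_left]
      by_cases h2 : k = i
      · subst h2; simp [hpq, Ne.symm hpq]
      · by_cases h3 : k = q
        · subst h3; simp [hpq]
        · simp [h3, hpq, Ne.symm h2, Ne.symm h3]
    · by_cases h4 : i = q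
      · subst h4
        rw [Equiv.swap_apply_right]
        by_cases h2 : k = i
        · subst h2; simp [h1, Ne.symm h1]
        · by_cases h3 : k = p
          · subst h3; simp [h1]
          · simp [h3, h1, Ne.symm h2, Ne.symm h3]
      · rw [Equiv.swap_apply_of_ne_of_ne h1 h4]
        simp [h1, h4, eq_comm]

/-- A square root of the transposition of two basis vectors, which mixes them with equal weights. -/
theorem exists_sqrt_swap [DecidableEq ι] (b : OrthonormalBasis ι ℂ A) {p q : ι} (hpq : p ≠ q) :
    ∃ V : unitary (A →L[ℂ] A), ∀ k, matrixOf b (V : A →L[ℂ] A) p k =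
      (if k = p then (1 + Complex.I) / 2 else 0) + (if k = q then (1 - Complex.I) / 2 else 0) := by
  refine ⟨⟨_, one_add_smul_rankOne_mem_unitary (b p - b q) ((Complex.I - 1) / 2) ?_⟩,
    fun k => ?_⟩
  · rw [inner_sub_basis b hpq]
    simp only [map_div₀, map_sub, Complex.conj_I, map_one, map_ofNat]
    linear_combination (-1 / 2 : ℂ) * Complex.I_mul_I
  · rw [matrixOf_one_add_smul_rankOne]
    simp only [inner_sub_left, inner_sub_right, orthonormal_iff_ite.1 b.orthonormal]
    by_cases h2 : k = p
    · subst h2; simp [hpq, Ne.symm hpq]; ring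
    · by_cases h3 : k = q
      · subst h3; simp [hpq, h2]; ring
      · simp [h2, h3, hpq, Ne.symm h2, Ne.symm h3]

theorem integral_twirl_mul_left (b : OrthonormalBasis ι ℂ A) (r : Matrix ι ι ℂ)
    (V : unitary (A →L[ℂ] A)) (F : Matrix ι ι ℂ → ℂ) :
    ∫ U : unitary (A →L[ℂ] A), F (twirl b r ((V : A →L[ℂ] A) * (U : A →L[ℂ] A))) ∂haarUnitary A =
      ∫ U : unitary (A →L[ℂ] A), F (twirl b r (U : A →L[ℂ] A)) ∂haarUnitary A :=
  integral_mul_left_eq_self (fun U : unitary (A →L[ℂ] A) => F (twirl b r (U : A →L[ℂ] A))) V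

/-- First moments: `E U r U⋆ = (tr r / d) 1`. -/
theorem integral_twirl [DecidableEq ι] [Nonempty ι] (b : OrthonormalBasis ι ℂ A)
    (r : Matrix ι ι ℂ) (i j : ι) :
    ∫ U : unitary (A →L[ℂ] A), twirl b r (U : A →L[ℂ] A) i j ∂haarUnitary A =
      if i = j then r.trace / Fintype.card ι else 0 := by
  set M : ι → ι → ℂ := fun i j =>
    ∫ U : unitary (A →L[ℂ] A), twirl b r (U : A →L[ℂ] A) i j ∂haarUnitary A with hM
  change M i j = _
  split_ifs with h
  · subst h
    have hswap : ∀ p q, M p p = M q q := by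
      intro p q
      obtain ⟨V, hV⟩ := exists_swap b p q
      have h1 := integral_twirl_mul_left b r V (fun m => m p p)
      simp only [twirl_mul_apply, hV, Equiv.swap_apply_left] at h1
      simp only [apply_ite (starRingEnd ℂ), map_one, map_zero, ite_mul, mul_ite, one_mul, zero_mul,
        mul_one, mul_zero, Finset.sum_ite_eq', Finset.mem_univ, if_true] at h1
      simpa using h1.symm
    have htr : ∑ p, M p p = r.trace := by
      simp only [hM]
      rw [← integral_finsetSum _ fun p _ => integrable_of_continuous (continuous_twirl b r p p)]
      have : ∀ U : unitary (A →L[ℂ] A), ∑ p, twirl b r (U : A →L[ℂ] A) p p = r.trace := fun U =>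
        trace_twirl b r U
      simp [this]
    rw [Finset.sum_congr rfl fun p _ => hswap p i, Finset.sum_const, nsmul_eq_mul,
      Finset.card_univ] at htr
    rw [← htr, mul_div_cancel_left₀]
    simp
  · obtain ⟨V, hV⟩ := exists_phase b i
    have h1 := integral_twirl_mul_left b r V (fun m => m i j)
    simp only [twirl_mul_apply, hV] at h1
    simp only [apply_ite (starRingEnd ℂ), map_one, map_zero, ite_mul, mul_ite, zero_mul,
        mul_one, mul_zero, Finset.sum_ite_eq, Finset.mem_univ, if_true, if_neg (Ne.symm h)] at h1
    rw [integral_const_mul] at h1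
    have h2 : (Complex.I - 1) * M i j = 0 := by
      rw [sub_mul, one_mul, sub_eq_zero]; exact h1
    rcases mul_eq_zero.1 h2 with h3 | h3
    · exfalso
      have := congrArg Complex.im h3
      simp at this
    · exact h3

/-- Invariance under diagonal unitaries kills the second moments whose indices do not pair up. -/
theorem integral_star_mul_twirl_eq_zero [DecidableEq ι] (b : OrthonormalBasis ι ℂ A)
    (r : Matrix ι ι ℂ) {i j i' j' : ι} (h1 : ¬ (i = i' ∧ j = j')) (h2 : ¬ (i = j ∧ i' = j')) :
    ∫ U : unitary (A →L[ℂ] A), starRingEnd ℂ (twirl b r (U : A →L[ℂ] A) i j) *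
      twirl b r (U : A →L[ℂ] A) i' j' ∂haarUnitary A = 0 := by
  by_contra hne
  -- conjugation by a diagonal unitary multiplies the moment by a phase
  have key : ∀ p, starRingEnd ℂ (if i = p then Complex.I else 1) * (if j = p then Complex.I else 1)
      * ((if i' = p then Complex.I else 1) * starRingEnd ℂ (if j' = p then Complex.I else 1)) = 1 := by
    intro p
    obtain ⟨V, hV⟩ := exists_phase b p
    have h3 := integral_twirl_mul_left b r V (fun m => starRingEnd ℂ (m i j) * m i' j')
    have hm : ∀ (U : unitary (A →L[ℂ] A)) (i j : ι),
        twirl b r ((V : A →L[ℂ] A) * (U : A →L[ℂ] A)) i j = (if i = p then Complex.I else 1) *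
          starRingEnd ℂ (if j = p then Complex.I else 1) * twirl b r (U : A →L[ℂ] A) i j := by
      intro U i j
      rw [twirl_mul_apply]
      simp only [hV]
      rw [Finset.sum_eq_single i, Finset.sum_eq_single j]
      · simp
      · intro l _ hl; simp [hl.symm]
      · simp
      · intro l _ hl; simp [hl.symm]
      · simp
    simp only [hm] at h3
    have h4 : ∀ U : unitary (A →L[ℂ] A), starRingEnd ℂ ((if i = p then Complex.I else 1) *
          starRingEnd ℂ (if j = p then Complex.I else 1) * twirl b r (U : A →L[ℂ] A) i j) *
        ((if i' = p then Complex.I else 1) *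
          starRingEnd ℂ (if j' = p then Complex.I else 1) * twirl b r (U : A →L[ℂ] A) i' j') =
        (starRingEnd ℂ (if i = p then Complex.I else 1) * (if j = p then Complex.I else 1)
      * ((if i' = p then Complex.I else 1) * starRingEnd ℂ (if j' = p then Complex.I else 1))) *
        (starRingEnd ℂ (twirl b r (U : A →L[ℂ] A) i j) * twirl b r (U : A →L[ℂ] A) i' j') := by
      intro U
      simp only [map_mul, Complex.conj_conj]
      ring
    simp only [h4] at h3
    rw [integral_const_mul] at h3
    exact mul_right_cancel₀ hne (h3.trans (one_mul _).symm)
  have k1 := key i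
  have k2 := key j'
  have c1 : Complex.I ≠ 1 := fun h => by simpa using congrArg Complex.im h
  have c2 : -Complex.I ≠ 1 := fun h => by simpa using congrArg Complex.im h
  have c3 : (-1 : ℂ) ≠ 1 := by norm_num
  clear key
  by_cases e1 : i = j
  · subst e1
    by_cases e3 : i = j'
    · subst e3
      by_cases e2 : i = i'
      · exact h1 ⟨e2, rfl⟩
      · simp [Ne.symm e2] at k1; exact c2 k1
    · by_cases e2 : i = i'
      · subst e2; simp [Ne.symm e3] at k1; exact c1 k1
      · by_cases e5 : i' = j'
        · exact h2 ⟨rfl, e5⟩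
        · simp [e3, e5] at k2; exact c2 k2
  · by_cases e2 : i = i'
    · subst e2
      by_cases e4 : j = j'
      · exact h1 ⟨rfl, e4⟩
      · by_cases e3 : i = j'
        · subst e3; simp [Ne.symm e1] at k1; exact c2 k1
        · simp [e3, e4] at k2; exact c2 k2
    · by_cases e3 : i = j'
      · subst e3; simp [Ne.symm e1, Ne.symm e2] at k1; exact c3 k1
      · simp [Ne.symm e1, Ne.symm e2, Ne.symm e3] at k1; exact c2 k1

/-- The second moments are invariant under permutations of the basis. -/
theorem integral_star_mul_twirl_perm [DecidableEq ι] (b : OrthonormalBasis ι ℂ A)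
    (r : Matrix ι ι ℂ) (p q i j i' j' : ι) :
    ∫ U : unitary (A →L[ℂ] A), starRingEnd ℂ (twirl b r (U : A →L[ℂ] A) (Equiv.swap p q i)
        (Equiv.swap p q j)) * twirl b r (U : A →L[ℂ] A) (Equiv.swap p q i') (Equiv.swap p q j')
        ∂haarUnitary A =
      ∫ U : unitary (A →L[ℂ] A), starRingEnd ℂ (twirl b r (U : A →L[ℂ] A) i j) *
        twirl b r (U : A →L[ℂ] A) i' j' ∂haarUnitary A := by
  obtain ⟨V, hV⟩ := exists_swap b p q
  have h3 := integral_twirl_mul_left b r V (fun m => starRingEnd ℂ (m i j) * m i' j')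
  have hm : ∀ (U : unitary (A →L[ℂ] A)) (i j : ι),
      twirl b r ((V : A →L[ℂ] A) * (U : A →L[ℂ] A)) i j =
        twirl b r (U : A →L[ℂ] A) (Equiv.swap p q i) (Equiv.swap p q j) := by
    intro U i j
    rw [twirl_mul_apply]
    simp only [hV]
    rw [Finset.sum_eq_single (Equiv.swap p q i), Finset.sum_eq_single (Equiv.swap p q j)]
    · simp
    · intro l _ hl; simp [hl]
    · simp
    · intro l _ hl; simp [hl]
    · simp
  simpa only [hm] using h3

theorem integral_star_mul_sum_twirl (b : OrthonormalBasis ι ℂ A) (r w : Matrix ι ι ℂ) :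
    ∫ U : unitary (A →L[ℂ] A), starRingEnd ℂ (∑ i, ∑ j, w i j * twirl b r (U : A →L[ℂ] A) i j) *
      (∑ i, ∑ j, w i j * twirl b r (U : A →L[ℂ] A) i j) ∂haarUnitary A =
    ∑ i, ∑ j, ∑ i', ∑ j', starRingEnd ℂ (w i j) * w i' j' *
      ∫ U : unitary (A →L[ℂ] A), starRingEnd ℂ (twirl b r (U : A →L[ℂ] A) i j) *
        twirl b r (U : A →L[ℂ] A) i' j' ∂haarUnitary A := by
  have hi : ∀ i j i' j', Integrable (fun U : unitary (A →L[ℂ] A) => starRingEnd ℂ (w i j) * w i' j' *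
      (starRingEnd ℂ (twirl b r (U : A →L[ℂ] A) i j) * twirl b r (U : A →L[ℂ] A) i' j'))
      (haarUnitary A) := fun i j i' j' =>
    (integrable_of_continuous ((Complex.continuous_conj.comp (continuous_twirl b r i j)).mul
      (continuous_twirl b r i' j'))).const_mul _
  simp only [← integral_const_mul]
  simp_rw [← integral_finsetSum _ fun j' _ => hi _ _ _ j']
  simp_rw [← integral_finsetSum _ fun i' _ => integrable_finsetSum _ fun j' _ => hi _ _ i' j']
  simp_rw [← integral_finsetSum _ fun j _ => integrable_finsetSum _ fun i' _ =>
    integrable_finsetSum _ fun j' _ => hi _ j i' j']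
  rw [← integral_finsetSum _ fun i _ => integrable_finsetSum _ fun j _ =>
    integrable_finsetSum _ fun i' _ => integrable_finsetSum _ fun j' _ => hi i j i' j']
  congr 1
  funext U
  simp only [map_sum, Finset.sum_mul]
  refine Finset.sum_congr rfl fun i _ => Finset.sum_congr rfl fun j _ => ?_
  rw [Finset.mul_sum]
  refine Finset.sum_congr rfl fun i' _ => ?_
  rw [Finset.mul_sum]
  refine Finset.sum_congr rfl fun j' _ => ?_
  rw [map_mul]
  ring

theorem sum_star_mul_ite [DecidableEq ι] (w : ι → ι → ℂ) (x y z : ℂ) :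
    ∑ i, ∑ j, ∑ i', ∑ j', starRingEnd ℂ (w i j) * w i' j' *
      ((if i = i' then if j = j' then x else 0 else 0) +
        (if i = j then if i' = j' then y else 0 else 0) +
        (if i = j then if i = i' then if i = j' then z else 0 else 0 else 0)) =
    x * (∑ i, ∑ j, starRingEnd ℂ (w i j) * w i j) +
      y * (starRingEnd ℂ (∑ i, w i i) * ∑ i, w i i) +
      z * ∑ i, starRingEnd ℂ (w i i) * w i i := by
  simp only [mul_add, Finset.sum_add_distrib, mul_ite, mul_zero, Finset.sum_ite_irrel,
      Finset.sum_ite_eq, Finset.mem_univ, Finset.sum_const_zero, if_true]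
  congr 1
  · congr 1
    · rw [Finset.mul_sum]
      refine Finset.sum_congr rfl fun i _ => ?_
      rw [Finset.mul_sum]
      exact Finset.sum_congr rfl fun j _ => mul_comm _ _
    · rw [map_sum, Finset.sum_mul, Finset.mul_sum]
      refine Finset.sum_congr rfl fun i _ => ?_
      rw [← Finset.sum_mul, ← Finset.mul_sum, mul_comm]
  · rw [Finset.mul_sum]
    exact Finset.sum_congr rfl fun j _ => mul_comm _ _

/-- Second moments: the commutant of `U ⊗ Ū` is spanned by the identity and the maximally entangled
projection. -/
theorem exists_integral_star_mul_twirl [DecidableEq ι] [Nontrivial ι] (b : OrthonormalBasis ι ℂ A)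
    (r : Matrix ι ι ℂ) : ∃ x y : ℂ, ∀ i j i' j',
    ∫ U : unitary (A →L[ℂ] A), starRingEnd ℂ (twirl b r (U : A →L[ℂ] A) i j) *
      twirl b r (U : A →L[ℂ] A) i' j' ∂haarUnitary A =
      (if i = i' then if j = j' then x else 0 else 0) +
        (if i = j then if i' = j' then y else 0 else 0) := by
  set K : ι → ι → ι → ι → ℂ := fun i j i' j' => ∫ U : unitary (A →L[ℂ] A),
    starRingEnd ℂ (twirl b r (U : A →L[ℂ] A) i j) *
      twirl b r (U : A →L[ℂ] A) i' j' ∂haarUnitary A with hK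
  have hperm : ∀ p q i j i' j', K (Equiv.swap p q i) (Equiv.swap p q j) (Equiv.swap p q i')
      (Equiv.swap p q j') = K i j i' j' := integral_star_mul_twirl_perm b r
  have hzero : ∀ {i j i' j'}, ¬ (i = i' ∧ j = j') → ¬ (i = j ∧ i' = j') → K i j i' j' = 0 :=
    fun h1 h2 => integral_star_mul_twirl_eq_zero b r h1 h2
  obtain ⟨p₀, q₀, h₀⟩ := exists_pair_ne ι
  have hmove : ∀ (G : ι → ι → ℂ), (∀ s t p q, G (Equiv.swap s t p) (Equiv.swap s t q) = G p q) →
      ∀ p q, p ≠ q → G p q = G p₀ q₀ := by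
    intro G hG p q hpq
    rw [← hG p p₀ p q, Equiv.swap_apply_left, ← hG (Equiv.swap p p₀ q) q₀ p₀ (Equiv.swap p p₀ q),
      Equiv.swap_apply_left, Equiv.swap_apply_of_ne_of_ne _ h₀]
    intro h
    exact hpq ((Equiv.swap p p₀).injective (by rw [← h, Equiv.swap_apply_left]))
  set x := K p₀ q₀ p₀ q₀
  set y := K p₀ p₀ q₀ q₀
  set z := K p₀ p₀ p₀ p₀ - x - y with hz
  have hx : ∀ p q, p ≠ q → K p q p q = x :=
    hmove (fun p q => K p q p q) fun s t p q => hperm s t p q p q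
  have hy : ∀ p q, p ≠ q → K p p q q = y :=
    hmove (fun p q => K p p q q) fun s t p q => hperm s t p p q q
  have hw : ∀ p q, K p p p p = K q q q q := fun p q => by
    rw [← hperm p q p p p p, Equiv.swap_apply_left]
  have hform : ∀ i j i' j', K i j i' j' = (if i = i' then if j = j' then x else 0 else 0) +
      (if i = j then if i' = j' then y else 0 else 0) +
      (if i = j then if i = i' then if i = j' then z else 0 else 0 else 0) := by
    intro i j i' j'
    by_cases h1 : i = i' ∧ j = j'
    · obtain ⟨rfl, rfl⟩ := h1
      by_cases h2 : i = j
      · subst h2; simp only [if_true]; rw [hw i p₀, hz]; ring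
      · simp [h2, hx i j h2]
    · by_cases h2 : i = j ∧ i' = j'
      · obtain ⟨rfl, rfl⟩ := h2
        have h3 : i ≠ i' := fun h => h1 ⟨h, h⟩
        simp [h3, hy i i' h3]
      · rw [hzero h1 h2]
        rw [not_and] at h1 h2
        by_cases e1 : i = j
        · subst e1
          simp only [if_true, if_neg (h2 rfl)]
          by_cases e2 : i = i'
          · subst e2; simp [h1 rfl]
          · simp [e2]
        · by_cases e2 : i = i'
          · subst e2; simp [h1 rfl, e1]
          · simp [e1, e2]
  -- conjugating with the square root of a transposition
  have hz0 : z = 0 := by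
    obtain ⟨V, hV⟩ := exists_sqrt_swap b h₀
    have h3 := integral_twirl_mul_left b r V (fun m => starRingEnd ℂ (m p₀ p₀) * m p₀ p₀)
    simp only [twirl_mul_apply] at h3
    set w : Matrix ι ι ℂ := fun k l => matrixOf b (V : A →L[ℂ] A) p₀ k *
      starRingEnd ℂ (matrixOf b (V : A →L[ℂ] A) p₀ l) with hw
    have h4 := (integral_star_mul_sum_twirl b r w).symm.trans h3
    have h5 : ∀ i j i' j', (∫ U : unitary (A →L[ℂ] A), starRingEnd ℂ (twirl b r (U : A →L[ℂ] A) i j) *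
        twirl b r (U : A →L[ℂ] A) i' j' ∂haarUnitary A) = K i j i' j' := fun _ _ _ _ => rfl
    simp only [h5, hform] at h4
    rw [sum_star_mul_ite] at h4
    have e0 : ∀ k, w k k = (if k = p₀ then 1 / 2 else 0) + (if k = q₀ then 1 / 2 else 0) := by
      intro k
      simp only [hw, hV]
      by_cases hk : k = p₀
      · subst hk
        simp only [if_true, if_neg h₀, add_zero, map_div₀, map_add, map_one, Complex.conj_I,
          map_ofNat]
        linear_combination (-1 / 4 : ℂ) * Complex.I_mul_I
      · by_cases hk' : k = q₀
        · subst hk'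
          simp only [if_true, if_neg hk, zero_add, map_div₀, map_sub, map_one, Complex.conj_I,
            map_ofNat]
          linear_combination (-1 / 4 : ℂ) * Complex.I_mul_I
        · simp [hk, hk']
    have e1 : ∑ k, w k k = 1 := by
      simp_rw [e0, Finset.sum_add_distrib, Finset.sum_ite_eq', Finset.mem_univ, if_true]
      norm_num
    have e2 : ∑ k, starRingEnd ℂ (w k k) * w k k = 1 / 2 := by
      have : ∀ k, starRingEnd ℂ (w k k) * w k k =
          (if k = p₀ then 1 / 4 else 0) + (if k = q₀ then 1 / 4 else 0) := by
        intro k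
        rw [e0]
        by_cases hk : k = p₀
        · subst hk; rw [if_pos rfl, if_neg h₀, if_pos rfl, if_neg h₀]
          simp only [add_zero, map_div₀, map_one, map_ofNat]; norm_num
        · by_cases hk' : k = q₀
          · subst hk'; rw [if_pos rfl, if_neg hk, if_pos rfl, if_neg hk]
            simp only [zero_add, map_div₀, map_one, map_ofNat]; norm_num
          · simp [hk, hk']
      simp_rw [this, Finset.sum_add_distrib, Finset.sum_ite_eq', Finset.mem_univ, if_true]
      norm_num
    have e3 : ∑ k, ∑ l, starRingEnd ℂ (w k l) * w k l = 1 := by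
      have : ∀ k l, starRingEnd ℂ (w k l) * w k l = w k k * w l l := by
        intro k l; simp only [hw, map_mul, Complex.conj_conj]; ring
      simp only [this, ← Finset.mul_sum, ← Finset.sum_mul, e1, one_mul]
    rw [e1, e2, e3] at h4
    simp only [if_true, map_one, mul_one] at h4
    linear_combination (-2 : ℂ) * h4
  refine ⟨x, y, fun i j i' j' => ?_⟩
  change K i j i' j' = _
  rw [hform, hz0]
  simp

/-- The coefficients of the second moments, from the two invariants of `U r U⋆`. -/
theorem integral_star_mul_sum_twirl_eq [DecidableEq ι] [Nontrivial ι]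
    (b : OrthonormalBasis ι ℂ A) (r w : Matrix ι ι ℂ) (d W T R t : ℝ) (hd : d = Fintype.card ι)
    (hW : W = ∑ i, ∑ j, ‖w i j‖ ^ 2) (hT : T = ‖w.trace‖ ^ 2)
    (hR : R = ∑ i, ∑ j, ‖r i j‖ ^ 2) (ht : t = ‖r.trace‖ ^ 2) :
    ∫ U : unitary (A →L[ℂ] A), ‖∑ i, ∑ j, w i j * twirl b r (U : A →L[ℂ] A) i j‖ ^ 2
      ∂haarUnitary A = ((d * R - t) * W + (d * t - R) * T) / (d * (d ^ 2 - 1)) := by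
  obtain ⟨x, y, hxy⟩ := exists_integral_star_mul_twirl b r
  have hd1 : 1 < d := by rw [hd]; exact_mod_cast Fintype.one_lt_card
  have hxy' : ∀ i j i' j',
    ∫ U : unitary (A →L[ℂ] A), starRingEnd ℂ (twirl b r (U : A →L[ℂ] A) i j) *
      twirl b r (U : A →L[ℂ] A) i' j' ∂haarUnitary A =
      (if i = i' then if j = j' then x else 0 else 0) +
        (if i = j then if i' = j' then y else 0 else 0) +
        (if i = j then if i = i' then if i = j' then (0 : ℂ) else 0 else 0 else 0) := by
    intro i j i' j'; rw [hxy]; simp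
  have hsq : ∀ c : ℂ, starRingEnd ℂ c * c = ((‖c‖ ^ 2 : ℝ) : ℂ) := fun c => by
    rw [Complex.conj_mul']; push_cast; rfl
  have hgen : ∀ w : Matrix ι ι ℂ, ((∫ U : unitary (A →L[ℂ] A),
      ‖∑ i, ∑ j, w i j * twirl b r (U : A →L[ℂ] A) i j‖ ^ 2 ∂haarUnitary A : ℝ) : ℂ) =
      x * ((∑ i, ∑ j, ‖w i j‖ ^ 2 : ℝ) : ℂ) + y * ((‖w.trace‖ ^ 2 : ℝ) : ℂ) := by
    intro w
    rw [← integral_complex_ofReal]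
    simp_rw [← hsq]
    rw [integral_star_mul_sum_twirl]
    simp_rw [hxy']
    rw [sum_star_mul_ite (fun i j => w i j)]
    simp only [hsq, Matrix.trace, Matrix.diag_apply]
    push_cast
    ring
  have hint : ∀ i j, Integrable (fun U : unitary (A →L[ℂ] A) =>
      ‖twirl b r (U : A →L[ℂ] A) i j‖ ^ 2) (haarUnitary A) := fun i j =>
    integrable_of_continuous ((continuous_twirl b r i j).norm.pow 2)
  -- total weight
  have eq1 : (d : ℂ) ^ 2 * x + d * y = R := by
    have h1 : ∑ i, ∑ j, ∫ U : unitary (A →L[ℂ] A), ‖twirl b r (U : A →L[ℂ] A) i j‖ ^ 2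
        ∂haarUnitary A = R := by
      simp_rw [← integral_finsetSum _ fun j _ => hint _ j]
      rw [← integral_finsetSum _ fun i _ => integrable_finsetSum _ fun j _ => hint i j]
      simp_rw [sum_norm_twirl_sq]
      simp [hR]
    have h2 : ∀ i j, ((∫ U : unitary (A →L[ℂ] A), ‖twirl b r (U : A →L[ℂ] A) i j‖ ^ 2
        ∂haarUnitary A : ℝ) : ℂ) = x + if i = j then y else 0 := by
      intro i j
      rw [← integral_complex_ofReal]
      simp_rw [← hsq]
      rw [hxy]
      by_cases h : i = j <;> simp [h]
    have h3 := congrArg (fun z : ℝ => (z : ℂ)) h1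
    push_cast at h3
    rw [← h3]
    simp only [h2, Finset.sum_add_distrib, Finset.sum_const, Finset.sum_ite_eq, Finset.mem_univ,
      if_true, Finset.card_univ, nsmul_eq_mul, hd]
    push_cast
    ring
  -- the trace
  have eq2 : (d : ℂ) * x + d ^ 2 * y = t := by
    have h1 := hgen 1
    have h2 : ∀ U : unitary (A →L[ℂ] A), ∑ i, ∑ j, (1 : Matrix ι ι ℂ) i j *
        twirl b r (U : A →L[ℂ] A) i j = r.trace := by
      intro U
      rw [← trace_twirl b r U]
      simp only [Matrix.one_apply, ite_mul, one_mul, zero_mul, Finset.sum_ite_eq, Finset.mem_univ,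
        if_true]
      rfl
    have h4 : ∑ i, ∑ j, ‖(1 : Matrix ι ι ℂ) i j‖ ^ 2 = d := by
      have : ∀ i j, ‖(1 : Matrix ι ι ℂ) i j‖ ^ 2 = if i = j then (1 : ℝ) else 0 := by
        intro i j; rw [Matrix.one_apply]; split_ifs <;> simp
      simp [this, hd]
    simp only [h2, h4, Matrix.trace_one, integral_const, probReal_univ, one_smul, ← ht] at h1
    rw [h1, hd]
    simp
    ring
  have hdC : (d : ℂ) * (d ^ 2 - 1) ≠ 0 := by
    have : d * (d ^ 2 - 1) ≠ 0 := by
      have : 0 < d ^ 2 - 1 := by nlinarith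
      positivity
    exact_mod_cast this
  have hx : x = (d * R - t) / (d * (d ^ 2 - 1)) := by
    rw [eq_div_iff hdC]; linear_combination (d : ℂ) * eq1 - eq2
  have hy : y = (d * t - R) / (d * (d ^ 2 - 1)) := by
    rw [eq_div_iff hdC]; linear_combination (d : ℂ) * eq2 - eq1
  have := hgen w
  rw [← hW, ← hT, hx, hy] at this
  apply Complex.ofReal_injective
  rw [this]
  push_cast
  ring

theorem norm_trace_sq_le (w : Matrix ι ι ℂ) :
    ‖w.trace‖ ^ 2 ≤ Fintype.card ι * ∑ i, ∑ j, ‖w i j‖ ^ 2 := by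
  have h1 : ‖w.trace‖ ≤ ∑ i, ‖w i i‖ := norm_sum_le _ _
  have h2 := sq_sum_le_card_mul_sum_sq (s := Finset.univ) (f := fun i => ‖w i i‖)
  calc ‖w.trace‖ ^ 2 ≤ (∑ i, ‖w i i‖) ^ 2 := by gcongr
    _ ≤ Fintype.card ι * ∑ i, ‖w i i‖ ^ 2 := by simpa using h2
    _ ≤ _ := by
      gcongr with i _
      exact Finset.single_le_sum (f := fun j => ‖w i j‖ ^ 2) (fun _ _ => by positivity)
        (Finset.mem_univ i)

/-- The variance of the linear functionals of `U r U⋆`. The constant is attained in dimension two;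
in dimension one the left-hand side vanishes. -/
theorem integral_norm_sub_sq_le [DecidableEq ι] [Nonempty ι] (b : OrthonormalBasis ι ℂ A)
    (r w : Matrix ι ι ℂ) :
    ∫ U : unitary (A →L[ℂ] A), ‖(Fintype.card ι : ℂ) *
        (∑ i, ∑ j, w i j * twirl b r (U : A →L[ℂ] A) i j) - w.trace * r.trace‖ ^ 2 ∂haarUnitary A ≤
      4 / 3 * (∑ i, ∑ j, ‖w i j‖ ^ 2) * (∑ i, ∑ j, ‖r i j‖ ^ 2) := by
  have hpos : 0 ≤ 4 / 3 * (∑ i, ∑ j, ‖w i j‖ ^ 2) * (∑ i, ∑ j, ‖r i j‖ ^ 2) := by positivity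
  rcases subsingleton_or_nontrivial ι with hι | hι
  · refine le_trans (le_of_eq ?_) hpos
    obtain ⟨i₀⟩ := ‹Nonempty ι›
    have hc : Fintype.card ι = 1 :=
      le_antisymm (Fintype.card_le_one_iff_subsingleton.2 hι) Fintype.card_pos
    have htr : ∀ m : Matrix ι ι ℂ, m.trace = m i₀ i₀ := fun m => Fintype.sum_subsingleton _ i₀
    have hU : ∀ U : unitary (A →L[ℂ] A), twirl b r (U : A →L[ℂ] A) i₀ i₀ = r i₀ i₀ := by
      intro U
      rw [← htr (twirl b r (U : A →L[ℂ] A)), ← htr r, trace_twirl]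
    simp [Fintype.sum_subsingleton _ i₀, hU, hc, htr]
  set d : ℝ := (Fintype.card ι : ℝ) with hd
  set W : ℝ := ∑ i, ∑ j, ‖w i j‖ ^ 2 with hW
  set R : ℝ := ∑ i, ∑ j, ‖r i j‖ ^ 2 with hR
  have hmain := integral_star_mul_sum_twirl_eq b r w d W _ R _ hd hW rfl hR rfl
  have hT := norm_trace_sq_le w
  have ht := norm_trace_sq_le r
  rw [← hW, ← hd] at hT
  rw [← hR, ← hd] at ht
  set T := ‖w.trace‖ ^ 2 with hTdef
  set t := ‖r.trace‖ ^ 2 with htdef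
  have hd2 : 2 ≤ d := by rw [hd]; exact_mod_cast Fintype.one_lt_card
  set Z : unitary (A →L[ℂ] A) → ℂ := fun U => ∑ i, ∑ j, w i j * twirl b r (U : A →L[ℂ] A) i j
    with hZ
  have hZc : Continuous Z := by simp only [hZ]; fun_prop
  have hZ1 : ∫ U, Z U ∂haarUnitary A = w.trace * r.trace / d := by
    simp only [hZ]
    rw [integral_finsetSum _ fun i _ => integrable_of_continuous (by fun_prop)]
    have h1 : ∀ i, ∫ U : unitary (A →L[ℂ] A), ∑ j, w i j * twirl b r (U : A →L[ℂ] A) i j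
        ∂haarUnitary A = ∑ j, ∫ U : unitary (A →L[ℂ] A), w i j * twirl b r (U : A →L[ℂ] A) i j
        ∂haarUnitary A := fun i =>
      integral_finsetSum _ fun j _ => integrable_of_continuous (by fun_prop)
    simp only [h1, integral_const_mul, integral_twirl, mul_ite, mul_zero, Finset.sum_ite_eq,
      Finset.mem_univ, if_true, ← Finset.sum_mul, Matrix.trace, Matrix.diag_apply, hd]
    push_cast
    ring
  have hexp : ∀ U, ‖(Fintype.card ι : ℂ) * Z U - w.trace * r.trace‖ ^ 2 =
      d ^ 2 * ‖Z U‖ ^ 2 - (2 * d) * RCLike.re (starRingEnd ℂ (w.trace * r.trace) * Z U) + T * t := by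
    intro U
    rw [@norm_sub_sq ℂ, norm_mul, norm_mul, mul_pow, mul_pow, hd, hTdef, htdef,
      RCLike.inner_apply, map_mul (starRingEnd ℂ) (Fintype.card ι : ℂ)]
    simp
    ring_nf
  have hcalc : ∫ U, ‖(Fintype.card ι : ℂ) * Z U - w.trace * r.trace‖ ^ 2 ∂haarUnitary A =
      d ^ 2 * (((d * R - t) * W + (d * t - R) * T) / (d * (d ^ 2 - 1))) - T * t := by
    simp_rw [hexp]
    rw [integral_add (integrable_of_continuous (by fun_prop)) (integrable_const _), integral_sub
      (integrable_of_continuous (by fun_prop)) (integrable_of_continuous (by fun_prop)),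
      integral_const_mul, integral_const_mul, hmain]
    have h5 : ∫ U, RCLike.re (starRingEnd ℂ (w.trace * r.trace) * Z U) ∂haarUnitary A =
        T * t / d := by
      have := integral_re (𝕜 := ℂ) (μ := haarUnitary A)
        (f := fun U => starRingEnd ℂ (w.trace * r.trace) * Z U)
        (integrable_of_continuous (by fun_prop))
      rw [this, integral_const_mul, hZ1, mul_div_assoc', Complex.conj_mul', norm_mul, hTdef, htdef]
      rw [← mul_pow]
      norm_cast
    rw [h5]
    simp
    field_simp
    ring
  rw [hcalc]
  have hdd : 0 < d ^ 2 - 1 := by nlinarith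
  have hid : d ^ 2 * (((d * R - t) * W + (d * t - R) * T) / (d * (d ^ 2 - 1))) - T * t =
      d ^ 2 / (d ^ 2 - 1) * ((W - T / d) * (R - t / d)) := by
    field_simp
    ring
  rw [hid, mul_assoc (4 / 3 : ℝ)]
  have hT0 : 0 ≤ T := by positivity
  have ht0 : 0 ≤ t := by positivity
  have hd0 : 0 < d := by linarith
  have a1 : 0 ≤ W - T / d := by rw [sub_nonneg, div_le_iff₀ hd0]; linarith
  have a2 : 0 ≤ R - t / d := by rw [sub_nonneg, div_le_iff₀ hd0]; linarith
  have a3 : T / d ≥ 0 := by positivity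
  have a4 : t / d ≥ 0 := by positivity
  have a5 : d ^ 2 / (d ^ 2 - 1) ≤ 4 / 3 := by rw [div_le_div_iff₀ hdd (by norm_num)]; nlinarith
  gcongr <;> linarith

/-- The entries of a Haar random unitary are orthogonal with mean square `1 / d`. -/
theorem integral_matrixOf_mul_star [DecidableEq ι] [Nonempty ι] (b : OrthonormalBasis ι ℂ A)
    (i k i' k' : ι) :
    ∫ U : unitary (A →L[ℂ] A), matrixOf b (U : A →L[ℂ] A) i k *
      starRingEnd ℂ (matrixOf b (U : A →L[ℂ] A) i' k') ∂haarUnitary A =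
      if i = i' then if k = k' then (Fintype.card ι : ℂ)⁻¹ else 0 else 0 := by
  have h1 := integral_twirl b (Matrix.single k k' 1) i i'
  have h2 : ∀ U : A →L[ℂ] A, twirl b (Matrix.single k k' 1) U i i' = matrixOf b U i k *
      starRingEnd ℂ (matrixOf b U i' k') := by
    intro U
    rw [twirl_apply, Finset.sum_eq_single k, Finset.sum_eq_single k']
    · simp
    · intro l _ hl; simp [hl.symm]
    · simp
    · intro l _ hl; simp [hl.symm]
    · simp
  simp only [h2] at h1
  rw [h1]
  by_cases hk : k = k'
  · subst hk; simp
  · simp [hk, Matrix.trace_single_eq_of_ne]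

theorem integral_norm_sum_matrixOf_sq [DecidableEq ι] [Nonempty ι] (b : OrthonormalBasis ι ℂ A)
    (c : ι → ι → ℂ) :
    ∫ U : unitary (A →L[ℂ] A), ‖∑ i, ∑ k, matrixOf b (U : A →L[ℂ] A) i k * c i k‖ ^ 2
      ∂haarUnitary A = (∑ i, ∑ k, ‖c i k‖ ^ 2) / Fintype.card ι := by
  have hm := continuous_matrixOf b
  apply Complex.ofReal_injective
  rw [← integral_complex_ofReal]
  have hexp : ∀ U : unitary (A →L[ℂ] A),
      ((‖∑ i, ∑ k, matrixOf b (U : A →L[ℂ] A) i k * c i k‖ ^ 2 : ℝ) : ℂ) =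
      ∑ p : ι × ι, ∑ q : ι × ι, c p.1 p.2 * starRingEnd ℂ (c q.1 q.2) *
        (matrixOf b (U : A →L[ℂ] A) p.1 p.2 *
          starRingEnd ℂ (matrixOf b (U : A →L[ℂ] A) q.1 q.2)) := by
    intro U
    push_cast
    rw [← Complex.mul_conj', ← Fintype.sum_prod_type', map_sum, Finset.sum_mul_sum]
    refine Finset.sum_congr rfl fun p _ => Finset.sum_congr rfl fun q _ => ?_
    rw [map_mul]; ring
  simp_rw [hexp]
  rw [integral_finsetSum _ fun p _ => integrable_of_continuous (by fun_prop)]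
  have hsum : ∀ p : ι × ι, ∫ U : unitary (A →L[ℂ] A), ∑ q : ι × ι, c p.1 p.2 *
        starRingEnd ℂ (c q.1 q.2) * (matrixOf b (U : A →L[ℂ] A) p.1 p.2 *
          starRingEnd ℂ (matrixOf b (U : A →L[ℂ] A) q.1 q.2)) ∂haarUnitary A =
      ∑ q : ι × ι, ∫ U : unitary (A →L[ℂ] A), c p.1 p.2 *
        starRingEnd ℂ (c q.1 q.2) * (matrixOf b (U : A →L[ℂ] A) p.1 p.2 *
          starRingEnd ℂ (matrixOf b (U : A →L[ℂ] A) q.1 q.2)) ∂haarUnitary A := fun p =>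
    integral_finsetSum _ fun q _ => integrable_of_continuous (by fun_prop)
  simp only [hsum, integral_const_mul, integral_matrixOf_mul_star]
  simp only [Fintype.sum_prod_type, mul_ite, mul_zero,
    Finset.sum_ite_irrel, Finset.sum_ite_eq, Finset.mem_univ, Finset.sum_const_zero, if_true,
    Complex.mul_conj', ← Finset.sum_mul]
  push_cast
  rw [div_eq_mul_inv]

theorem continuous_decouplingCoeff [DecidableEq ι] (b : OrthonormalBasis ι ℂ A) (i j k l : ι) :
    Continuous fun U : unitary (A →L[ℂ] A) => decouplingCoeff b (U : A →L[ℂ] A) i j k l := by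
  have hm := continuous_matrixOf b
  have : ∀ U : unitary (A →L[ℂ] A), decouplingCoeff b (U : A →L[ℂ] A) i j k l =
      (Fintype.card ι : ℂ) * (matrixOf b (U : A →L[ℂ] A) i k *
        starRingEnd ℂ (matrixOf b (U : A →L[ℂ] A) j l)) -
        (if i = j then 1 else 0) * (if k = l then 1 else 0) := fun U => rfl
  simp only [this]
  fun_prop

theorem integral_decouplingCoeff [DecidableEq ι] [Nonempty ι] (b : OrthonormalBasis ι ℂ A)
    (i j k l : ι) :
    ∫ U : unitary (A →L[ℂ] A), decouplingCoeff b (U : A →L[ℂ] A) i j k l ∂haarUnitary A = 0 := by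
  have hm := continuous_matrixOf b
  have : ∀ U : unitary (A →L[ℂ] A), decouplingCoeff b (U : A →L[ℂ] A) i j k l =
      (Fintype.card ι : ℂ) * (matrixOf b (U : A →L[ℂ] A) i k *
        starRingEnd ℂ (matrixOf b (U : A →L[ℂ] A) j l)) -
        (if i = j then 1 else 0) * (if k = l then 1 else 0) := fun U => rfl
  simp only [this]
  rw [integral_sub (integrable_of_continuous (by fun_prop)) (integrable_const _),
    integral_const_mul, integral_matrixOf_mul_star]
  by_cases h1 : i = j <;> by_cases h2 : k = l <;> simp [h1, h2]

theorem sum_decouplingCoeff_mul [DecidableEq ι] (b : OrthonormalBasis ι ℂ A) (U : A →L[ℂ] A)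
    (w r : Matrix ι ι ℂ) :
    ∑ i, ∑ j, ∑ k, ∑ l, decouplingCoeff b U i j k l * (w i j * r k l) =
      (Fintype.card ι : ℂ) * (∑ i, ∑ j, w i j * twirl b r U i j) - w.trace * r.trace := by
  have : ∀ i j k l, decouplingCoeff b U i j k l =
      (Fintype.card ι : ℂ) * (matrixOf b U i k * starRingEnd ℂ (matrixOf b U j l)) -
        (if i = j then 1 else 0) * (if k = l then 1 else 0) := fun _ _ _ _ => rfl
  simp only [this, sub_mul, Finset.sum_sub_distrib]
  congr 1
  · simp only [twirl_apply, Finset.mul_sum]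
    refine Finset.sum_congr rfl fun i _ => Finset.sum_congr rfl fun j _ =>
      Finset.sum_congr rfl fun k _ => Finset.sum_congr rfl fun l _ => ?_
    ring
  · simp only [ite_mul, one_mul, zero_mul, Finset.sum_ite_irrel, Finset.sum_const_zero,
      Finset.sum_ite_eq, Finset.mem_univ, if_true, Matrix.trace, Matrix.diag_apply,
      Finset.sum_mul_sum]

end Haar


/-! ### Trace-class matrices as functionals on bounded operators -/

section Interpolation

variable {H : Type u} [NormedAddCommGroup H] [InnerProductSpace ℂ H]
  {N : Type*} [Fintype N]

variable (H) in
/-- The dual of `B(H)`, in which the trace class operators embed isometrically by `R ↦ Tr (· R)`. A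
separate type keeps instance search from unfolding it. -/
def TraceDual : Type u := StrongDual ℂ (H →L[ℂ] H)

instance : NormedAddCommGroup (TraceDual H) :=
  inferInstanceAs (NormedAddCommGroup (StrongDual ℂ (H →L[ℂ] H)))

instance : NormedSpace ℂ (TraceDual H) :=
  inferInstanceAs (NormedSpace ℂ (StrongDual ℂ (H →L[ℂ] H)))

instance : CompleteSpace (TraceDual H) :=
  inferInstanceAs (CompleteSpace (StrongDual ℂ (H →L[ℂ] H)))

namespace TraceDual

/-- Evaluation of a functional at an operator. -/
def eval (Z : H →L[ℂ] H) : TraceDual H →ₗ[ℂ] ℂ where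
  toFun f := (show StrongDual ℂ (H →L[ℂ] H) from f) Z
  map_add' _ _ := rfl
  map_smul' _ _ := rfl

theorem norm_le {f : TraceDual H} {c : ℝ} (hc : 0 ≤ c) (h : ∀ Z, ‖eval Z f‖ ≤ c * ‖Z‖) :
    ‖f‖ ≤ c :=
  ContinuousLinearMap.opNorm_le_bound (show StrongDual ℂ (H →L[ℂ] H) from f) hc h

theorem norm_eval_le (f : TraceDual H) (Z : H →L[ℂ] H) : ‖eval Z f‖ ≤ ‖f‖ * ‖Z‖ :=
  ContinuousLinearMap.le_opNorm (show StrongDual ℂ (H →L[ℂ] H) from f) Z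

/-- The functional `Z ↦ Tr (Z |x⟩⟨y|) = ⟨y, Z x⟩`. -/
def ketBra (x y : H) : TraceDual H :=
  show StrongDual ℂ (H →L[ℂ] H) from innerSL ℂ y ∘L ContinuousLinearMap.apply ℂ H x

theorem eval_ketBra (x y : H) (Z : H →L[ℂ] H) : eval Z (ketBra x y) = ⟪y, Z x⟫_ℂ := rfl

end TraceDual

/-- The functional `Z ↦ Tr (Z M)` on `B(H)`, for a matrix `M` with entries in an orthonormal family
`g`. Its norm is the trace norm of `M`. -/
def traceForm (g : N → H) (M : N → N → ℂ) : TraceDual H :=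
  ∑ a, ∑ a', M a a' • TraceDual.ketBra (g a) (g a')

theorem eval_traceForm (g : N → H) (M : N → N → ℂ) (Z : H →L[ℂ] H) :
    TraceDual.eval Z (traceForm g M) = ∑ a, ∑ a', M a a' * ⟪g a', Z (g a)⟫_ℂ := by
  simp [traceForm, TraceDual.eval_ketBra]

theorem norm_sum_smul_sq [DecidableEq N] {g : N → H} (hg : Orthonormal ℂ g) (c : N → ℂ) :
    ‖∑ a, c a • g a‖ ^ 2 = ∑ a, ‖c a‖ ^ 2 := by
  have h := hg.inner_sum c c Finset.univ
  have h2 : ((‖∑ a, c a • g a‖ ^ 2 : ℝ) : ℂ) = ((∑ a, ‖c a‖ ^ 2 : ℝ) : ℂ) := by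
    rw [Complex.ofReal_pow]
    refine (inner_self_eq_norm_sq_to_K (𝕜 := ℂ) (∑ a, c a • g a)).symm.trans ?_
    rw [h]
    push_cast
    exact Finset.sum_congr rfl fun i _ => Complex.conj_mul' _
  exact_mod_cast h2

/-- The trace norm of `|x⟩⟨y|`. -/
theorem norm_traceForm_rankOne_le [DecidableEq N] {g : N → H} (hg : Orthonormal ℂ g) (x y : N → ℂ) :
    ‖traceForm g fun a a' => x a * starRingEnd ℂ (y a')‖ ≤
      √(∑ a, ‖x a‖ ^ 2) * √(∑ a, ‖y a‖ ^ 2) := by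
  refine TraceDual.norm_le (by positivity) fun Z => ?_
  have h1 : TraceDual.eval Z (traceForm g fun a a' => x a * starRingEnd ℂ (y a')) =
      ⟪∑ a, y a • g a, Z (∑ a, x a • g a)⟫_ℂ := by
    rw [eval_traceForm, map_sum, inner_sum]
    refine Finset.sum_congr rfl fun a _ => ?_
    rw [map_smul, inner_smul_right, sum_inner, Finset.mul_sum]
    refine Finset.sum_congr rfl fun a' _ => ?_
    rw [inner_smul_left]; ring
  have hx := norm_sum_smul_sq hg x
  have hy := norm_sum_smul_sq hg y
  rw [h1, ← hx, ← hy, Real.sqrt_sq (norm_nonneg _), Real.sqrt_sq (norm_nonneg _)]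
  calc ‖⟪∑ a, y a • g a, Z (∑ a, x a • g a)⟫_ℂ‖
      ≤ ‖∑ a, y a • g a‖ * (‖Z‖ * ‖∑ a, x a • g a‖) :=
        (norm_inner_le_norm _ _).trans (by gcongr; exact Z.le_opNorm _)
    _ = _ := by ring

/-- Hölder's inequality `‖W M W‖₁ ≤ ‖W‖₄ ‖M‖₂ ‖W‖₄` for a diagonal matrix `W`. -/
theorem norm_traceForm_weighted_le [CompleteSpace H] {g : N → H} (hg : Orthonormal ℂ g)
    (M : N → N → ℂ) (w : N → ℂ) :
    ‖traceForm g fun a a' => w a * w a' * M a a'‖ ≤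
      √(∑ a, ∑ a', ‖M a a'‖ ^ 2) * √(∑ a, ‖w a‖ ^ 4) := by
  refine TraceDual.norm_le (by positivity) fun Z => ?_
  have hcol : ∀ a, ∑ a', ‖⟪g a', Z (g a)⟫_ℂ‖ ^ 2 ≤ ‖Z‖ ^ 2 := by
    intro a
    refine (hg.sum_inner_products_le (Z (g a))).trans ?_
    have := Z.le_opNorm (g a)
    rw [hg.1, mul_one] at this
    gcongr
  have hrow : ∀ a', ∑ a, ‖⟪g a', Z (g a)⟫_ℂ‖ ^ 2 ≤ ‖Z‖ ^ 2 := by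
    intro a'
    have h : ∀ a, ‖⟪g a', Z (g a)⟫_ℂ‖ = ‖⟪g a, ContinuousLinearMap.adjoint Z (g a')⟫_ℂ‖ := fun a => by
      rw [ContinuousLinearMap.adjoint_inner_right, norm_inner_symm]
    simp_rw [h]
    refine (hg.sum_inner_products_le _).trans ?_
    have := (ContinuousLinearMap.adjoint Z).le_opNorm (g a')
    rw [hg.1, mul_one, LinearIsometryEquiv.norm_map] at this
    gcongr
  have h2 : ∑ a, ∑ a', (‖w a‖ * ‖w a'‖ * ‖⟪g a', Z (g a)⟫_ℂ‖) ^ 2 ≤ ‖Z‖ ^ 2 * ∑ a, ‖w a‖ ^ 4 := by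
    calc ∑ a, ∑ a', (‖w a‖ * ‖w a'‖ * ‖⟪g a', Z (g a)⟫_ℂ‖) ^ 2
        ≤ ∑ a, ∑ a', (1 / 2 * (‖w a‖ ^ 4 * ‖⟪g a', Z (g a)⟫_ℂ‖ ^ 2) +
            1 / 2 * (‖w a'‖ ^ 4 * ‖⟪g a', Z (g a)⟫_ℂ‖ ^ 2)) := by
          refine Finset.sum_le_sum fun a _ => Finset.sum_le_sum fun a' _ => ?_
          have := mul_nonneg (sq_nonneg (‖w a‖ ^ 2 - ‖w a'‖ ^ 2)) (sq_nonneg ‖⟪g a', Z (g a)⟫_ℂ‖)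
          nlinarith
      _ = 1 / 2 * ∑ a, ‖w a‖ ^ 4 * ∑ a', ‖⟪g a', Z (g a)⟫_ℂ‖ ^ 2 +
          1 / 2 * ∑ a', ‖w a'‖ ^ 4 * ∑ a, ‖⟪g a', Z (g a)⟫_ℂ‖ ^ 2 := by
          simp only [Finset.sum_add_distrib, Finset.mul_sum]
          congr 1
          exact Finset.sum_comm
      _ ≤ 1 / 2 * ∑ a, ‖w a‖ ^ 4 * ‖Z‖ ^ 2 + 1 / 2 * ∑ a', ‖w a'‖ ^ 4 * ‖Z‖ ^ 2 := by
          gcongr with a _ a' _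
          · exact hcol a
          · exact hrow a'
      _ = _ := by rw [← Finset.sum_mul]; ring
  have h3 : ‖TraceDual.eval Z (traceForm g fun a a' => w a * w a' * M a a')‖ ≤
      ∑ p : N × N, ‖M p.1 p.2‖ * (‖w p.1‖ * ‖w p.2‖ * ‖⟪g p.2, Z (g p.1)⟫_ℂ‖) := by
    rw [eval_traceForm, ← Fintype.sum_prod_type']
    refine (norm_sum_le _ _).trans (Finset.sum_le_sum fun p _ => le_of_eq ?_)
    rw [norm_mul, norm_mul, norm_mul]; ring
  refine h3.trans ((Real.sum_mul_le_sqrt_mul_sqrt _ _ _).trans ?_)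
  rw [Fintype.sum_prod_type, Fintype.sum_prod_type, mul_assoc]
  gcongr
  refine (Real.sqrt_le_sqrt h2).trans (le_of_eq ?_)
  rw [Real.sqrt_mul (sq_nonneg _), Real.sqrt_sq (norm_nonneg _), mul_comm]

theorem traceForm_add (g : N → H) (M M' : N → N → ℂ) :
    traceForm g (fun a a' => M a a' + M' a a') = traceForm g M + traceForm g M' := by
  simp only [traceForm, add_smul, Finset.sum_add_distrib]

theorem traceForm_smul (g : N → H) (c : ℂ) (M : N → N → ℂ) :
    traceForm g (fun a a' => c * M a a') = c • traceForm g M := by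
  simp only [traceForm, mul_smul, Finset.smul_sum]

theorem traceForm_sum {κ : Type*} (s : Finset κ) (g : N → H) (M : κ → N → N → ℂ) :
    traceForm g (fun a a' => ∑ k ∈ s, M k a a') = ∑ k ∈ s, traceForm g (M k) := by
  simp only [traceForm, Finset.sum_smul]
  rw [Finset.sum_comm (s := s)]
  exact Finset.sum_congr rfl fun a _ => Finset.sum_comm

theorem continuous_traceForm {X : Type*} [TopologicalSpace X] (g : N → H) {M : X → N → N → ℂ}
    (hM : ∀ a a', Continuous fun x => M x a a') : Continuous fun x => traceForm g (M x) := by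
  simp only [traceForm]
  exact continuous_finsetSum _ fun a _ => continuous_finsetSum _ fun a' _ =>
    (hM a a').smul continuous_const

end Interpolation

/-! ### The two endpoint bounds -/

section Unitary

variable {A : Type u} [NormedAddCommGroup A] [InnerProductSpace ℂ A] [CompleteSpace A]
  [FiniteDimensional ℂ A] {ι : Type*} [Fintype ι] [DecidableEq ι]
  {H : Type v} [NormedAddCommGroup H] [InnerProductSpace ℂ H]
  {P Q K L : Type*} [Fintype P] [Fintype Q] [Fintype K] [Fintype L]

/-- The matrix of `∑ g_{ijkl}(U) ω_{ij} ⊗ ρ_{kl}`, where the blocks `ω_{ij}` and `ρ_{kl}` are given by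
their entries. -/
def decouplingMatrix (b : OrthonormalBasis ι ℂ A) (ω : ι → P → ι → P → ℂ) (ρ : ι → Q → ι → Q → ℂ)
    (U : A →L[ℂ] A) (a a' : P × Q) : ℂ :=
  ∑ i, ∑ j, ∑ k, ∑ l, decouplingCoeff b U i j k l * (ω i a.1 j a'.1 * ρ k a.2 l a'.2)

theorem decouplingMatrix_eq_sum_prod (b : OrthonormalBasis ι ℂ A) (ω : ι → P → ι → P → ℂ)
    (ρ : ι → Q → ι → Q → ℂ) (U : A →L[ℂ] A) (a a' : P × Q) :
    decouplingMatrix b ω ρ U a a' = ∑ x : ι × ι × ι × ι,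
      decouplingCoeff b U x.1 x.2.1 x.2.2.1 x.2.2.2 *
        (ω x.1 a.1 x.2.1 a'.1 * ρ x.2.2.1 a.2 x.2.2.2 a'.2) := by
  simp only [Fintype.sum_prod_type, decouplingMatrix]

theorem continuous_decouplingMatrix (b : OrthonormalBasis ι ℂ A) (ω : ι → P → ι → P → ℂ)
    (ρ : ι → Q → ι → Q → ℂ) (a a' : P × Q) :
    Continuous fun U : unitary (A →L[ℂ] A) => decouplingMatrix b ω ρ (U : A →L[ℂ] A) a a' := by
  simp only [decouplingMatrix]
  have := continuous_decouplingCoeff b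
  fun_prop

theorem integral_traceForm_decouplingMatrix [Nonempty ι] (b : OrthonormalBasis ι ℂ A)
    (g : P × Q → H) (ω : ι → P → ι → P → ℂ) (ρ : ι → Q → ι → Q → ℂ) :
    ∫ U : unitary (A →L[ℂ] A), traceForm g (decouplingMatrix b ω ρ (U : A →L[ℂ] A))
      ∂haarUnitary A = 0 := by
  have hc := continuous_decouplingMatrix b ω ρ
  have hd := continuous_decouplingCoeff b
  have h0 : ∀ a a', ∫ U : unitary (A →L[ℂ] A), decouplingMatrix b ω ρ (U : A →L[ℂ] A) a a'
      ∂haarUnitary A = 0 := by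
    intro a a'
    simp only [decouplingMatrix]
    rw [integral_finsetSum _ fun i _ => integrable_of_continuous (by fun_prop)]
    refine Finset.sum_eq_zero fun i _ => ?_
    rw [integral_finsetSum _ fun i _ => integrable_of_continuous (by fun_prop)]
    refine Finset.sum_eq_zero fun j _ => ?_
    rw [integral_finsetSum _ fun i _ => integrable_of_continuous (by fun_prop)]
    refine Finset.sum_eq_zero fun k _ => ?_
    rw [integral_finsetSum _ fun i _ => integrable_of_continuous (by fun_prop)]
    refine Finset.sum_eq_zero fun l _ => ?_
    rw [integral_mul_const, integral_decouplingCoeff, zero_mul]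
  simp only [traceForm]
  rw [integral_finsetSum _ fun a _ => integrable_of_continuous (by fun_prop)]
  refine Finset.sum_eq_zero fun a _ => ?_
  rw [integral_finsetSum _ fun a' _ => integrable_of_continuous (by fun_prop)]
  refine Finset.sum_eq_zero fun a' _ => ?_
  rw [integral_smul_const, h0, zero_smul]

/-- First moments: a rank-one argument has mean square norm `1 / d` after contraction with a
random unitary. -/
theorem integral_sum_norm_sq_le [Nonempty ι] (b : OrthonormalBasis ι ℂ A) (x : ι → P → ℂ)
    (y : ι → Q → ℂ) (hx : ∑ i, ∑ p, ‖x i p‖ ^ 2 ≤ 1) (hy : ∑ i, ∑ q, ‖y i q‖ ^ 2 ≤ 1) :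
    ∫ U : unitary (A →L[ℂ] A), ∑ a : P × Q, ‖∑ i, ∑ k, matrixOf b (U : A →L[ℂ] A) i k *
      (x i a.1 * y k a.2)‖ ^ 2 ∂haarUnitary A ≤ 1 / Fintype.card ι := by
  have hm := continuous_matrixOf b
  rw [integral_finsetSum _ fun a _ => integrable_of_continuous (by fun_prop)]
  simp only [integral_norm_sum_matrixOf_sq b fun i k => x i _ * y k _]
  rw [← Finset.sum_div]
  gcongr
  have : ∑ a : P × Q, ∑ i, ∑ k, ‖x i a.1 * y k a.2‖ ^ 2 =
      (∑ i, ∑ p, ‖x i p‖ ^ 2) * ∑ k, ∑ q, ‖y k q‖ ^ 2 := by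
    rw [Finset.sum_comm (f := fun i p => ‖x i p‖ ^ 2), Finset.sum_comm (f := fun k q => ‖y k q‖ ^ 2),
      Finset.sum_mul_sum, Fintype.sum_prod_type]
    refine Finset.sum_congr rfl fun p _ => Finset.sum_congr rfl fun q _ => ?_
    rw [Finset.sum_mul_sum]
    simp only [norm_mul, mul_pow]
  rw [this]
  exact mul_le_one₀ hx (by positivity) hy

/-- For rank one arguments the trace norm factorizes, and both factors have mean square `1 / d`. The
product of the marginals is the mean of the first term, so that it obeys the same bound. -/
theorem integral_norm_traceForm_rankOne_le [DecidableEq P] [DecidableEq Q] [Nonempty ι]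
    (b : OrthonormalBasis ι ℂ A)
    {g : P × Q → H} (hg : Orthonormal ℂ g) (x x' : ι → P → ℂ) (y y' : ι → Q → ℂ)
    (hx : ∑ i, ∑ p, ‖x i p‖ ^ 2 ≤ 1) (hx' : ∑ i, ∑ p, ‖x' i p‖ ^ 2 ≤ 1)
    (hy : ∑ i, ∑ q, ‖y i q‖ ^ 2 ≤ 1) (hy' : ∑ i, ∑ q, ‖y' i q‖ ^ 2 ≤ 1) :
    ∫ U : unitary (A →L[ℂ] A), ‖traceForm g (decouplingMatrix b
      (fun i p j p' => x i p * starRingEnd ℂ (x' j p'))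
      (fun i q j q' => y i q * starRingEnd ℂ (y' j q')) (U : A →L[ℂ] A))‖ ∂haarUnitary A ≤ 2 := by
  have hm := continuous_matrixOf b
  set ω : ι → P → ι → P → ℂ := fun i p j p' => x i p * starRingEnd ℂ (x' j p')
  set ρ : ι → Q → ι → Q → ℂ := fun i p j p' => y i p * starRingEnd ℂ (y' j p')
  set ξ : unitary (A →L[ℂ] A) → P × Q → ℂ := fun U a =>
    ∑ i, ∑ k, matrixOf b (U : A →L[ℂ] A) i k * (x i a.1 * y k a.2) with hξ
  set η : unitary (A →L[ℂ] A) → P × Q → ℂ := fun U a =>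
    ∑ i, ∑ k, matrixOf b (U : A →L[ℂ] A) i k * (x' i a.1 * y' k a.2) with hη
  have hξc : ∀ a, Continuous fun U => ξ U a := by simp only [hξ]; fun_prop
  have hηc : ∀ a, Continuous fun U => η U a := by simp only [hη]; fun_prop
  set F : unitary (A →L[ℂ] A) → TraceDual H := fun U =>
    (Fintype.card ι : ℂ) • traceForm g fun a a' => ξ U a * starRingEnd ℂ (η U a')
  set B : TraceDual H := traceForm g fun a a' =>
    (∑ i, ω i a.1 i a'.1) * ∑ k, ρ k a.2 k a'.2
  have hFc : Continuous F := by
    exact (continuous_traceForm g fun a a' =>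
      (hξc a).mul (Complex.continuous_conj.comp (hηc a'))).const_smul (Fintype.card ι : ℂ)
  have hdec : ∀ U : unitary (A →L[ℂ] A),
      traceForm g (decouplingMatrix b ω ρ (U : A →L[ℂ] A)) = F U - B := by
    intro U
    rw [eq_sub_iff_add_eq, ← traceForm_add]
    simp only [F]
    rw [← traceForm_smul]
    congr 1
    funext a a'
    have h0 := sum_decouplingCoeff_mul b (U : A →L[ℂ] A)
      (Matrix.of fun i j => ω i a.1 j a'.1) (Matrix.of fun i j => ρ i a.2 j a'.2)
    simp only [Matrix.trace, Matrix.diag_apply, Matrix.of_apply] at h0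
    rw [decouplingMatrix, h0]
    have h1 : ∑ i, ∑ j, ω i a.1 j a'.1 *
        twirl b (Matrix.of fun k l => ρ k a.2 l a'.2) (U : A →L[ℂ] A) i j =
        ξ U a * starRingEnd ℂ (η U a') := by
      simp only [hξ, hη, map_sum]
      rw [Finset.sum_mul]
      refine Finset.sum_congr rfl fun i _ => ?_
      rw [Finset.mul_sum]
      refine Finset.sum_congr rfl fun j _ => ?_
      rw [twirl_apply, Finset.mul_sum, Finset.sum_mul]
      refine Finset.sum_congr rfl fun k _ => ?_
      rw [Finset.mul_sum, Finset.mul_sum]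
      refine Finset.sum_congr rfl fun l _ => ?_
      simp only [ω, ρ, map_mul, Matrix.of_apply]
      ring
    rw [h1]
    exact sub_add_cancel _ _
  have hF1 : ∫ U, ‖F U‖ ∂haarUnitary A ≤ 1 := by
    have hle : ∀ U, ‖F U‖ ≤ (Fintype.card ι : ℝ) *
        (1 / 2 * (∑ a, ‖ξ U a‖ ^ 2) + 1 / 2 * ∑ a, ‖η U a‖ ^ 2) := by
      intro U
      simp only [F]
      rw [norm_smul, Complex.norm_natCast]
      gcongr
      refine (norm_traceForm_rankOne_le hg _ _).trans ?_
      have h1 := Real.sq_sqrt (Finset.sum_nonneg fun a (_ : a ∈ Finset.univ) => sq_nonneg ‖ξ U a‖)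
      have h2 := Real.sq_sqrt (Finset.sum_nonneg fun a (_ : a ∈ Finset.univ) => sq_nonneg ‖η U a‖)
      nlinarith [sq_nonneg (√(∑ a, ‖ξ U a‖ ^ 2) - √(∑ a, ‖η U a‖ ^ 2))]
    refine (integral_mono (integrable_of_continuous hFc.norm) (integrable_of_continuous
      (by fun_prop)) hle).trans ?_
    rw [integral_const_mul, integral_add (integrable_of_continuous (by fun_prop))
      (integrable_of_continuous (by fun_prop)), integral_const_mul, integral_const_mul]
    have h1 := integral_sum_norm_sq_le b x y hx hy
    have h2 := integral_sum_norm_sq_le b x' y' hx' hy'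
    have hd : (0 : ℝ) < Fintype.card ι := by exact_mod_cast Fintype.card_pos
    calc _ ≤ (Fintype.card ι : ℝ) * (1 / 2 * (1 / Fintype.card ι) + 1 / 2 * (1 / Fintype.card ι)) := by
          gcongr
      _ = 1 := by field_simp; norm_num
  have hB : ‖B‖ ≤ 1 := by
    have h1 := integral_traceForm_decouplingMatrix b g ω ρ
    simp only [hdec] at h1
    rw [integral_sub (integrable_of_continuous hFc) (integrable_const _), integral_const,
      probReal_univ, one_smul, sub_eq_zero] at h1
    rw [← h1]
    exact (norm_integral_le_integral_norm _).trans hF1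
  simp only [hdec]
  calc ∫ U, ‖F U - B‖ ∂haarUnitary A ≤ ∫ U, (‖F U‖ + ‖B‖) ∂haarUnitary A :=
        integral_mono (integrable_of_continuous (by fun_prop))
          (integrable_of_continuous (by fun_prop)) fun U => norm_sub_le _ _
    _ = (∫ U, ‖F U‖ ∂haarUnitary A) + ‖B‖ := by
        rw [integral_add (integrable_of_continuous hFc.norm) (integrable_const _)]; simp
    _ ≤ 2 := by linarith

/-- Bessel's inequality in coordinates, in the dual form: the synthesis operator of the family is a
contraction. -/
def IsCoordBessel (e : K → ι → P → ℂ) : Prop :=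
  ∀ c : K → ℂ, ∑ i, ∑ p, ‖∑ k, c k * e k i p‖ ^ 2 ≤ ∑ k, ‖c k‖ ^ 2

theorem IsCoordBessel.le_one [DecidableEq K] {e : K → ι → P → ℂ} (he : IsCoordBessel e) (k : K) :
    ∑ i, ∑ p, ‖e k i p‖ ^ 2 ≤ 1 := by
  have h := he (fun k' => if k' = k then 1 else 0)
  simpa [apply_ite (fun z : ℂ => ‖z‖), ite_pow] using h

/-- The operator `w (∑ c_k |v_k⟩⟨e_k|) w` in coordinates, where `w` is a diagonal weight. -/
def weightedSum (w : P → ℂ) (c : K → ℂ) (v e : K → ι → P → ℂ) : ι → P → ι → P → ℂ :=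
  fun i p j p' => w p * w p' * ∑ k, c k * (v k i p * starRingEnd ℂ (e k j p'))

/-- The Hilbert–Schmidt norm of a sum `∑ cₖ |vₖ⟩⟨eₖ|` over Bessel families. -/
theorem sum_norm_weightedSum_one_le [DecidableEq K] (c : K → ℂ) {v e : K → ι → P → ℂ}
    (hv : IsCoordBessel v) (he : IsCoordBessel e) :
    ∑ i, ∑ p, ∑ j, ∑ p', ‖∑ k, c k * (v k i p * starRingEnd ℂ (e k j p'))‖ ^ 2 ≤
      ∑ k, ‖c k‖ ^ 2 := by
  have h1 : ∀ i p, ∑ j, ∑ p', ‖∑ k, c k * (v k i p * starRingEnd ℂ (e k j p'))‖ ^ 2 ≤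
      ∑ k, ‖c k‖ ^ 2 * ‖v k i p‖ ^ 2 := by
    intro i p
    have h := he (fun k => starRingEnd ℂ (c k * v k i p))
    simp only [RCLike.norm_conj, norm_mul, mul_pow] at h
    refine le_trans (le_of_eq ?_) h
    refine Finset.sum_congr rfl fun j _ => Finset.sum_congr rfl fun p' _ => ?_
    rw [← RCLike.norm_conj (K := ℂ), map_sum]
    simp only [map_mul, Complex.conj_conj, mul_assoc]
  calc _ ≤ ∑ i, ∑ p, ∑ k, ‖c k‖ ^ 2 * ‖v k i p‖ ^ 2 :=
        Finset.sum_le_sum fun i _ => Finset.sum_le_sum fun p _ => h1 i p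
    _ = ∑ k, ‖c k‖ ^ 2 * ∑ i, ∑ p, ‖v k i p‖ ^ 2 := by
        simp only [Finset.mul_sum]
        rw [Finset.sum_comm]
        rw [Finset.sum_comm]
        simp_rw [Finset.sum_comm (s := (Finset.univ : Finset P)) (t := (Finset.univ : Finset K))]
        rw [Finset.sum_comm]
    _ ≤ ∑ k, ‖c k‖ ^ 2 * 1 := by gcongr with k _; exact hv.le_one k
    _ = _ := by simp

/-- The trace norm bound: on the imaginary axis. -/
theorem integral_norm_traceForm_le_two_mul [DecidableEq P] [DecidableEq Q] [DecidableEq K]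
    [DecidableEq L] [Nonempty ι]
    (b : OrthonormalBasis ι ℂ A) {g : P × Q → H} (hg : Orthonormal ℂ g) {w : P → ℂ} {w' : Q → ℂ}
    (hw : ∀ p, ‖w p‖ ≤ 1) (hw' : ∀ q, ‖w' q‖ ≤ 1) (c : K → ℂ) (c' : L → ℂ)
    {v e : K → ι → P → ℂ} {v' e' : L → ι → Q → ℂ} (hv : IsCoordBessel v) (he : IsCoordBessel e)
    (hv' : IsCoordBessel v') (he' : IsCoordBessel e') :
    ∫ U : unitary (A →L[ℂ] A), ‖traceForm g (decouplingMatrix b (weightedSum w c v e)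
      (weightedSum w' c' v' e') (U : A →L[ℂ] A))‖ ∂haarUnitary A ≤
      2 * (∑ k, ‖c k‖) * ∑ l, ‖c' l‖ := by
  set R : K → L → unitary (A →L[ℂ] A) → TraceDual H := fun k l U => traceForm g (decouplingMatrix b
      (fun i p j p' => (w p * v k i p) * starRingEnd ℂ (starRingEnd ℂ (w p') * e k j p'))
      (fun i p j p' => (w' p * v' l i p) * starRingEnd ℂ (starRingEnd ℂ (w' p') * e' l j p'))
      (U : A →L[ℂ] A)) with hR
  have hRc : ∀ k l, Continuous (R k l) := fun k l =>
    continuous_traceForm g fun a a' => continuous_decouplingMatrix b _ _ a a'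
  have hdec : ∀ U : unitary (A →L[ℂ] A), traceForm g (decouplingMatrix b (weightedSum w c v e)
      (weightedSum w' c' v' e') (U : A →L[ℂ] A)) = ∑ k, ∑ l, (c k * c' l) • R k l U := by
    intro U
    simp only [hR, ← traceForm_smul, ← traceForm_sum]
    congr 1
    funext a a'
    simp only [decouplingMatrix_eq_sum_prod, ← Fintype.sum_prod_type']
    simp only [Finset.mul_sum]
    rw [Finset.sum_comm]
    refine Finset.sum_congr rfl fun x _ => ?_
    simp only [weightedSum]
    rw [mul_mul_mul_comm, Finset.sum_mul_sum, ← Fintype.sum_prod_type', Finset.mul_sum,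
      Finset.mul_sum]
    refine Finset.sum_congr rfl fun κ _ => ?_
    simp only [map_mul, Complex.conj_conj]
    ring
  have h2 : ∀ k l, ∫ U, ‖R k l U‖ ∂haarUnitary A ≤ 2 := by
    intro k l
    refine integral_norm_traceForm_rankOne_le b hg _ _ _ _ ?_ ?_ ?_ ?_
    · refine le_trans (Finset.sum_le_sum fun i _ => Finset.sum_le_sum fun p _ => ?_) (hv.le_one k)
      rw [norm_mul]; gcongr; exact mul_le_of_le_one_left (norm_nonneg _) (hw p)
    · refine le_trans (Finset.sum_le_sum fun i _ => Finset.sum_le_sum fun p _ => ?_) (he.le_one k)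
      rw [norm_mul, RCLike.norm_conj]; gcongr; exact mul_le_of_le_one_left (norm_nonneg _) (hw p)
    · refine le_trans (Finset.sum_le_sum fun i _ => Finset.sum_le_sum fun p _ => ?_) (hv'.le_one l)
      rw [norm_mul]; gcongr; exact mul_le_of_le_one_left (norm_nonneg _) (hw' p)
    · refine le_trans (Finset.sum_le_sum fun i _ => Finset.sum_le_sum fun p _ => ?_) (he'.le_one l)
      rw [norm_mul, RCLike.norm_conj]; gcongr; exact mul_le_of_le_one_left (norm_nonneg _) (hw' p)
  have hi : ∀ k l, Integrable (fun U => ‖c k‖ * ‖c' l‖ * ‖R k l U‖) (haarUnitary A) := fun k l =>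
    integrable_of_continuous ((hRc k l).norm.const_mul _)
  simp only [hdec]
  calc ∫ U, ‖∑ k, ∑ l, (c k * c' l) • R k l U‖ ∂haarUnitary A
      ≤ ∫ U, ∑ k, ∑ l, ‖c k‖ * ‖c' l‖ * ‖R k l U‖ ∂haarUnitary A := by
        refine integral_mono (integrable_of_continuous ?_)
          (integrable_finsetSum _ fun k _ => integrable_finsetSum _ fun l _ => hi k l) fun U => ?_
        · exact (continuous_finsetSum _ fun k _ => continuous_finsetSum _ fun l _ =>
            (hRc k l).const_smul (c k * c' l)).norm
        · refine (norm_sum_le _ _).trans (Finset.sum_le_sum fun k _ => ?_)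
          refine (norm_sum_le _ _).trans (Finset.sum_le_sum fun l _ => ?_)
          rw [norm_smul, norm_mul]
    _ = ∑ k, ∑ l, ‖c k‖ * ‖c' l‖ * ∫ U, ‖R k l U‖ ∂haarUnitary A := by
        rw [integral_finsetSum _ fun k _ => integrable_finsetSum _ fun l _ => hi k l]
        refine Finset.sum_congr rfl fun k _ => ?_
        rw [integral_finsetSum _ fun l _ => hi k l]
        exact Finset.sum_congr rfl fun l _ => integral_const_mul _ _
    _ ≤ ∑ k, ∑ l, ‖c k‖ * ‖c' l‖ * 2 := by
        gcongr with k _ l _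
        exact h2 k l
    _ = _ := by
        simp only [← Finset.sum_mul, ← Finset.mul_sum]
        ring

theorem sq_integral_le_integral_sq {f : unitary (A →L[ℂ] A) → ℝ} (hf : Continuous f) :
    (∫ U, f U ∂haarUnitary A) ^ 2 ≤ ∫ U, f U ^ 2 ∂haarUnitary A := by
  set m := ∫ U, f U ∂haarUnitary A with hm
  have h : 0 ≤ ∫ U, (f U - m) ^ 2 ∂haarUnitary A := integral_nonneg fun _ => sq_nonneg _
  have h2 : ∀ U, (f U - m) ^ 2 = f U ^ 2 - 2 * m * f U + m ^ 2 := fun U => by ring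
  simp_rw [h2] at h
  rw [integral_add (integrable_of_continuous (by fun_prop)) (integrable_const _),
    integral_sub (integrable_of_continuous (by fun_prop)) (integrable_of_continuous (by fun_prop)),
    integral_const_mul, ← hm] at h
  simp at h
  nlinarith

theorem sum_comm_coord (f : ι → P → ι → P → ℝ) :
    ∑ i, ∑ p, ∑ j, ∑ p', f i p j p' = ∑ p, ∑ p', ∑ i, ∑ j, f i p j p' := by
  rw [Finset.sum_comm]
  refine Finset.sum_congr rfl fun p _ => ?_
  rw [Finset.sum_comm (s := (Finset.univ : Finset P))]
  refine Finset.sum_congr rfl fun i _ => ?_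
  rw [Finset.sum_comm]

/-- The Hilbert–Schmidt bound: on the line `re z = 1`. -/
theorem integral_norm_traceForm_le_sqrt [DecidableEq P] [DecidableEq Q] [DecidableEq K]
    [DecidableEq L] [Nonempty ι] [CompleteSpace H]
    (b : OrthonormalBasis ι ℂ A) {g : P × Q → H} (hg : Orthonormal ℂ g) {w : P → ℂ} {w' : Q → ℂ}
    (hw : ∑ p, ‖w p‖ ^ 4 ≤ 1) (hw' : ∑ q, ‖w' q‖ ^ 4 ≤ 1) (c : K → ℂ) (c' : L → ℂ)
    {v e : K → ι → P → ℂ} {v' e' : L → ι → Q → ℂ} (hv : IsCoordBessel v) (he : IsCoordBessel e)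
    (hv' : IsCoordBessel v') (he' : IsCoordBessel e') :
    ∫ U : unitary (A →L[ℂ] A), ‖traceForm g (decouplingMatrix b (weightedSum w c v e)
      (weightedSum w' c' v' e') (U : A →L[ℂ] A))‖ ∂haarUnitary A ≤
      √(4 / 3 * (∑ k, ‖c k‖ ^ 2) * ∑ l, ‖c' l‖ ^ 2) := by
  set ω : ι → P → ι → P → ℂ := fun i p j p' => ∑ k, c k * (v k i p * starRingEnd ℂ (e k j p'))
    with hω
  set ρ : ι → Q → ι → Q → ℂ := fun i p j p' => ∑ k, c' k * (v' k i p * starRingEnd ℂ (e' k j p'))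
    with hρ
  set M : unitary (A →L[ℂ] A) → P × Q → P × Q → ℂ := fun U => decouplingMatrix b ω ρ (U : A →L[ℂ] A)
    with hM
  have hMc : ∀ a a', Continuous fun U => M U a a' := continuous_decouplingMatrix b ω ρ
  have hdec : ∀ U : unitary (A →L[ℂ] A), decouplingMatrix b (weightedSum w c v e)
      (weightedSum w' c' v' e') (U : A →L[ℂ] A) =
      fun a a' => (w a.1 * w' a.2) * (w a'.1 * w' a'.2) * M U a a' := by
    intro U
    funext a a'
    simp only [hM, decouplingMatrix, Finset.mul_sum (Finset.univ : Finset ι)]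
    refine Finset.sum_congr rfl fun i _ => Finset.sum_congr rfl fun j _ =>
      Finset.sum_congr rfl fun k _ => Finset.sum_congr rfl fun l _ => ?_
    simp only [weightedSum, hω, hρ]
    ring
  set S : unitary (A →L[ℂ] A) → ℝ := fun U => ∑ a, ∑ a', ‖M U a a'‖ ^ 2 with hS
  have hSc : Continuous S := by simp only [hS]; fun_prop
  have hle : ∀ U : unitary (A →L[ℂ] A), ‖traceForm g (decouplingMatrix b (weightedSum w c v e)
      (weightedSum w' c' v' e') (U : A →L[ℂ] A))‖ ≤ √(S U) := by
    intro U
    rw [hdec]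
    refine (norm_traceForm_weighted_le hg (M U) fun a => w a.1 * w' a.2).trans ?_
    refine mul_le_of_le_one_right (Real.sqrt_nonneg _) (Real.sqrt_le_one.2 ?_)
    rw [Fintype.sum_prod_type]
    simp only [norm_mul, mul_pow]
    rw [← Finset.sum_mul_sum]
    exact mul_le_one₀ hw (by positivity) hw'
  have hSint : ∫ U, S U ∂haarUnitary A ≤ 4 / 3 * (∑ k, ‖c k‖ ^ 2) * ∑ l, ‖c' l‖ ^ 2 := by
    simp only [hS]
    rw [integral_finsetSum _ fun a _ => integrable_of_continuous (by fun_prop)]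
    have h1 : ∀ a : P × Q, ∫ U, ∑ a', ‖M U a a'‖ ^ 2 ∂haarUnitary A ≤
        ∑ a' : P × Q, 4 / 3 * (∑ i, ∑ j, ‖ω i a.1 j a'.1‖ ^ 2) * ∑ i, ∑ j, ‖ρ i a.2 j a'.2‖ ^ 2 := by
      intro a
      rw [integral_finsetSum _ fun a' _ => integrable_of_continuous (by fun_prop)]
      refine Finset.sum_le_sum fun a' _ => ?_
      simp only [hM, decouplingMatrix]
      simp_rw [sum_decouplingCoeff_mul b _ (fun i j => ω i a.1 j a'.1) (fun i j => ρ i a.2 j a'.2)]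
      exact integral_norm_sub_sq_le b _ _
    refine (Finset.sum_le_sum fun a _ => h1 a).trans ?_
    have h2 := sum_norm_weightedSum_one_le c hv he
    have h3 := sum_norm_weightedSum_one_le c' hv' he'
    have h4 : ∑ a : P × Q, ∑ a' : P × Q, 4 / 3 * (∑ i, ∑ j, ‖ω i a.1 j a'.1‖ ^ 2) *
        ∑ i, ∑ j, ‖ρ i a.2 j a'.2‖ ^ 2 = 4 / 3 * (∑ i, ∑ p, ∑ j, ∑ p', ‖ω i p j p'‖ ^ 2) *
        ∑ i, ∑ p, ∑ j, ∑ p', ‖ρ i p j p'‖ ^ 2 := by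
      rw [sum_comm_coord fun i p j p' => ‖ω i p j p'‖ ^ 2,
        sum_comm_coord fun i p j p' => ‖ρ i p j p'‖ ^ 2]
      obtain ⟨X, hX⟩ : ∃ X : P → P → ℝ, ∀ p p', ∑ i, ∑ j, ‖ω i p j p'‖ ^ 2 = X p p' :=
        ⟨_, fun _ _ => rfl⟩
      obtain ⟨Y, hY⟩ : ∃ Y : Q → Q → ℝ, ∀ p p', ∑ i, ∑ j, ‖ρ i p j p'‖ ^ 2 = Y p p' :=
        ⟨_, fun _ _ => rfl⟩
      simp only [Fintype.sum_prod_type, hX, hY, mul_assoc, ← Finset.mul_sum, Finset.sum_mul_sum]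
    rw [h4]
    gcongr
  refine (integral_mono (integrable_of_continuous ?_) (integrable_of_continuous hSc.sqrt) hle).trans ?_
  · exact (continuous_traceForm g fun a a' => continuous_decouplingMatrix b _ _ a a').norm
  · refine Real.le_sqrt_of_sq_le ((sq_integral_le_integral_sq hSc.sqrt).trans ?_)
    have : ∀ U, √(S U) ^ 2 = S U := fun U => Real.sq_sqrt (by simp only [hS]; positivity)
    simp_rw [this]
    exact hSint

end Unitary


/-! ### The three lines theorem for linear combinations of exponentials -/

section Strip

open Complex.HadamardThreeLines

/-- The complex powers `m ^ z` of a nonnegative real number, with the convention `0 ^ z = 0`. -/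
def cpowNonneg (m : ℝ) (z : ℂ) : ℂ := if m = 0 then 0 else Complex.exp (z * Real.log m)

theorem norm_cpowNonneg {m : ℝ} (hm : 0 ≤ m) (z : ℂ) :
    ‖cpowNonneg m z‖ = if m = 0 then 0 else m ^ z.re := by
  by_cases h : m = 0
  · simp [cpowNonneg, h]
  · have hm' : 0 < m := lt_of_le_of_ne hm (Ne.symm h)
    rw [cpowNonneg, if_neg h, if_neg h, Complex.norm_exp, Real.rpow_def_of_pos hm', Complex.re_mul_ofReal,
      mul_comm]

theorem cpowNonneg_ofReal {m : ℝ} (hm : 0 ≤ m) {r : ℝ} (hr : r ≠ 0) :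
    cpowNonneg m r = ((m ^ r : ℝ) : ℂ) := by
  by_cases h : m = 0
  · simp [cpowNonneg, h, Real.zero_rpow hr]
  · have hm' : 0 < m := lt_of_le_of_ne hm (Ne.symm h)
    rw [cpowNonneg, if_neg h, Real.rpow_def_of_pos hm', mul_comm]
    push_cast
    rfl

/-- Entire functions that are bounded on the closed unit strip. -/
def stripAlgebra : Subalgebra ℂ (ℂ → ℂ) where
  carrier := {φ | Differentiable ℂ φ ∧ ∃ c, ∀ z ∈ verticalClosedStrip 0 1, ‖φ z‖ ≤ c}
  mul_mem' := by
    rintro φ ψ ⟨h1, c, hc⟩ ⟨h2, c', hc'⟩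
    refine ⟨h1.mul h2, c * c', fun z hz => ?_⟩
    rw [Pi.mul_apply, norm_mul]
    exact mul_le_mul (hc z hz) (hc' z hz) (norm_nonneg _) ((norm_nonneg _).trans (hc z hz))
  add_mem' := by
    rintro φ ψ ⟨h1, c, hc⟩ ⟨h2, c', hc'⟩
    exact ⟨h1.add h2, c + c', fun z hz => (norm_add_le _ _).trans (add_le_add (hc z hz) (hc' z hz))⟩
  algebraMap_mem' := fun r => ⟨differentiable_const r, ‖r‖, fun _ _ => le_rfl⟩

theorem cpowNonneg_mem_stripAlgebra {m : ℝ} (hm : 0 ≤ m) (a c : ℝ) :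
    (fun z => cpowNonneg m (a * z + c)) ∈ stripAlgebra := by
  by_cases h : m = 0
  · have : (fun z => cpowNonneg m (a * z + c)) = 0 := by funext z; simp [cpowNonneg, h]
    rw [this]; exact zero_mem _
  refine ⟨?_, Real.exp ((|a| + |c|) * |Real.log m|), fun z hz => ?_⟩
  · simp only [cpowNonneg, if_neg h]
    fun_prop
  · rw [norm_cpowNonneg hm, if_neg h, Real.rpow_def_of_pos (lt_of_le_of_ne hm (Ne.symm h))]
    refine Real.exp_le_exp.2 (le_trans (le_abs_self _) ?_)
    rw [abs_mul, mul_comm]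
    gcongr
    have hz' : 0 ≤ z.re ∧ z.re ≤ 1 := hz
    have : (a * z + c : ℂ).re = a * z.re + c := by simp
    rw [this]
    refine (abs_add_le _ _).trans (add_le_add ?_ le_rfl)
    rw [abs_mul, abs_of_nonneg hz'.1]
    exact mul_le_of_le_one_right (abs_nonneg _) hz'.2

/-- Hadamard's three lines theorem on `0 ≤ re z ≤ 1`, for vector-valued functions with
coefficients in `stripAlgebra`. -/
theorem norm_sum_smul_le_interp {T V : Type*} [Fintype T] [NormedAddCommGroup V] [NormedSpace ℂ V]
    {φ : T → ℂ → ℂ} (hφ : ∀ t, φ t ∈ stripAlgebra) (G : T → V) {a c θ : ℝ} (h0 : 0 ≤ θ) (h1 : θ ≤ 1)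
    (ha : ∀ z : ℂ, z.re = 0 → ‖∑ t, φ t z • G t‖ ≤ a)
    (hc : ∀ z : ℂ, z.re = 1 → ‖∑ t, φ t z • G t‖ ≤ c) :
    ‖∑ t, φ t θ • G t‖ ≤ a ^ (1 - θ) * c ^ θ := by
  have h := norm_le_interp_of_mem_verticalClosedStrip₀₁' (fun z => ∑ t, φ t z • G t) (z := θ)
    (a := a) (b := c) (by simp [verticalClosedStrip, h0, h1]) ?_ ?_ (fun z hz => ha z hz) fun z hz => hc z hz
  · simpa using h
  · refine Differentiable.diffContOnCl ?_
    have := fun t => (hφ t).1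
    fun_prop
  · choose B hB using fun t => (hφ t).2
    refine ⟨∑ t, B t * ‖G t‖, ?_⟩
    rintro _ ⟨z, hz, rfl⟩
    refine (norm_sum_le _ _).trans (Finset.sum_le_sum fun t _ => ?_)
    rw [norm_smul]
    gcongr
    exact hB t z hz

end Strip

/-! ### The interpolated bound for finite matrices -/

section Unitary

variable {A : Type u} [NormedAddCommGroup A] [InnerProductSpace ℂ A] [CompleteSpace A]
  [FiniteDimensional ℂ A] {ι : Type*} [Fintype ι] [DecidableEq ι]
  {H : Type v} [NormedAddCommGroup H] [InnerProductSpace ℂ H]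
  {P Q K L : Type*} [Fintype P] [Fintype Q] [Fintype K] [Fintype L]

theorem secondCountable_unitary : SecondCountableTopology (unitary (A →L[ℂ] A)) := by
  have : FiniteDimensional ℂ (A →L[ℂ] A) := inferInstance
  have : ProperSpace (A →L[ℂ] A) := FiniteDimensional.proper ℂ _
  infer_instance

/-- Interpolation of mean norms of functions on the unitary group. -/
theorem integral_norm_sum_smul_le_interp {T V : Type*} [Fintype T] [NormedAddCommGroup V]
    [NormedSpace ℂ V]
    {φ : T → ℂ → ℂ} (hφ : ∀ t, φ t ∈ stripAlgebra) {G : T → unitary (A →L[ℂ] A) → V}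
    (hG : ∀ t, Continuous (G t)) {a c θ : ℝ} (h0 : 0 ≤ θ) (h1 : θ ≤ 1)
    (ha : ∀ z : ℂ, z.re = 0 → ∫ U, ‖∑ t, φ t z • G t U‖ ∂haarUnitary A ≤ a)
    (hc : ∀ z : ℂ, z.re = 1 → ∫ U, ‖∑ t, φ t z • G t U‖ ∂haarUnitary A ≤ c) :
    ∫ U, ‖∑ t, φ t θ • G t U‖ ∂haarUnitary A ≤ a ^ (1 - θ) * c ^ θ := by
  have := secondCountable_unitary (A := A)
  set Gc : T → C(unitary (A →L[ℂ] A), V) := fun t => ⟨G t, hG t⟩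
  set Gp : T → Lp V 1 (haarUnitary A) := fun t => ContinuousMap.toLp 1 (haarUnitary A) ℂ (Gc t)
  have hn : ∀ z, ‖∑ t, φ t z • Gp t‖ = ∫ U, ‖∑ t, φ t z • G t U‖ ∂haarUnitary A := by
    intro z
    have h2 : ∑ t, φ t z • Gp t = ContinuousMap.toLp 1 (haarUnitary A) ℂ (∑ t, φ t z • Gc t) := by
      simp only [Gp, map_sum, map_smul]
    rw [h2, L1.norm_eq_integral_norm]
    refine integral_congr_ae ?_
    filter_upwards [ContinuousMap.coeFn_toLp (E := V) (p := 1) (𝕜 := ℂ) (haarUnitary A)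
      (∑ t, φ t z • Gc t)] with U hU
    rw [hU]
    simp [Gc, ContinuousMap.sum_apply]
  have := norm_sum_smul_le_interp hφ Gp h0 h1 (fun z hz => (hn z).le.trans (ha z hz))
    fun z hz => (hn z).le.trans (hc z hz)
  rwa [hn] at this

theorem weightedSum_mem_stripAlgebra {m : P → ℝ} (hm : ∀ p, 0 ≤ m p) {y : K → ℝ}
    (hy : ∀ k, 0 ≤ y k) (v e : K → ι → P → ℂ) (α : ℝ) (i : ι) (p : P) (j : ι) (p' : P) :
    (fun z : ℂ => weightedSum (fun p => cpowNonneg (m p) (z / 4))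
      (fun k => cpowNonneg (y k) (α * (1 - z / 2))) v e i p j p') ∈ stripAlgebra := by
  have h1 : ∀ p, (fun z : ℂ => cpowNonneg (m p) (z / 4)) ∈ stripAlgebra := fun p => by
    have := cpowNonneg_mem_stripAlgebra (hm p) (1 / 4) 0
    convert this using 3
    push_cast; ring
  have h2 : ∀ k, (fun z : ℂ => cpowNonneg (y k) (α * (1 - z / 2))) ∈ stripAlgebra := fun k => by
    have := cpowNonneg_mem_stripAlgebra (hy k) (-α / 2) α
    convert this using 3
    push_cast; ring
  have h3 := mul_mem (mul_mem (h1 p) (h1 p')) (sum_mem (S := stripAlgebra) (t := Finset.univ)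
    fun k (_ : k ∈ Finset.univ) => mul_mem (h2 k)
      (stripAlgebra.algebraMap_mem (v k i p * starRingEnd ℂ (e k j p'))))
  convert h3 using 1
  funext z
  simp [weightedSum, Finset.sum_apply, Pi.mul_apply]

/-- The finite-dimensional form of the decoupling bound, by Stein interpolation between the trace
norm (`re z = 0`) and the weighted Hilbert–Schmidt norm (`re z = 1`). -/
theorem integral_norm_traceForm_le [DecidableEq P] [DecidableEq Q] [DecidableEq K]
    [DecidableEq L] [Nonempty ι] [CompleteSpace H]
    (b : OrthonormalBasis ι ℂ A) {g : P × Q → H} (hg : Orthonormal ℂ g) {m : P → ℝ} {n : Q → ℝ}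
    (hm : ∀ p, 0 ≤ m p) (hm1 : ∑ p, m p ≤ 1) (hn : ∀ q, 0 ≤ n q) (hn1 : ∑ q, n q ≤ 1)
    {y : K → ℝ} {y' : L → ℝ} (hy : ∀ k, 0 ≤ y k) (hy' : ∀ l, 0 ≤ y' l)
    {v e : K → ι → P → ℂ} {v' e' : L → ι → Q → ℂ} (hv : IsCoordBessel v) (he : IsCoordBessel e)
    (hv' : IsCoordBessel v') (he' : IsCoordBessel e') {α : ℝ} (h1 : 1 < α) (h2 : α ≤ 2) :
    ∫ U : unitary (A →L[ℂ] A), ‖traceForm g (decouplingMatrix b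
      (weightedSum (fun p => ((m p ^ ((α - 1) / (2 * α)) : ℝ) : ℂ)) (fun k => (y k : ℂ)) v e)
      (weightedSum (fun q => ((n q ^ ((α - 1) / (2 * α)) : ℝ) : ℂ)) (fun l => (y' l : ℂ)) v' e')
        (U : A →L[ℂ] A))‖ ∂haarUnitary A ≤
      2 * (3 : ℝ) ^ (-((α - 1) / α)) * ((∑ k, y k ^ α) ^ (1 / α) * (∑ l, y' l ^ α) ^ (1 / α)) := by
  have hα : 0 < α := by linarith
  set θ : ℝ := 2 * (α - 1) / α with hθ
  have hθ0 : 0 < θ := by rw [hθ]; exact div_pos (by linarith) hα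
  have hθ1 : θ ≤ 1 := by rw [hθ, div_le_one hα]; linarith
  set W : ℂ → ι → P → ι → P → ℂ := fun z => weightedSum (fun p => cpowNonneg (m p) (z / 4))
      (fun k => cpowNonneg (y k) (α * (1 - z / 2))) v e with hW
  set W' : ℂ → ι → Q → ι → Q → ℂ := fun z => weightedSum (fun p => cpowNonneg (n p) (z / 4))
      (fun k => cpowNonneg (y' k) (α * (1 - z / 2))) v' e' with hW'
  set φ : (ι × ι × ι × ι) × (P × Q) × (P × Q) → ℂ → ℂ := fun t z =>
    W z t.1.1 t.2.1.1 t.1.2.1 t.2.2.1 * W' z t.1.2.2.1 t.2.1.2 t.1.2.2.2 t.2.2.2 with hφd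
  have hφ : ∀ t, φ t ∈ stripAlgebra := fun t =>
    mul_mem (weightedSum_mem_stripAlgebra hm hy v e α _ _ _ _)
      (weightedSum_mem_stripAlgebra hn hy' v' e' α _ _ _ _)
  set G : (ι × ι × ι × ι) × (P × Q) × (P × Q) → unitary (A →L[ℂ] A) → TraceDual H := fun t U =>
    decouplingCoeff b (U : A →L[ℂ] A) t.1.1 t.1.2.1 t.1.2.2.1 t.1.2.2.2 •
      TraceDual.ketBra (g t.2.1) (g t.2.2) with hGd
  have hG : ∀ t, Continuous (G t) := fun t =>
    (continuous_decouplingCoeff b _ _ _ _).smul continuous_const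
  have hsum : ∀ z U, ∑ t, φ t z • G t U =
      traceForm g (decouplingMatrix b (W z) (W' z) (U : A →L[ℂ] A)) := by
    intro z U
    rw [Fintype.sum_prod_type, Finset.sum_comm, Fintype.sum_prod_type, traceForm]
    refine Finset.sum_congr rfl fun a _ => Finset.sum_congr rfl fun a' _ => ?_
    rw [decouplingMatrix_eq_sum_prod, Finset.sum_smul]
    refine Finset.sum_congr rfl fun x _ => ?_
    simp only [hφd, hGd, smul_smul]
    rw [mul_comm]
  set S := ∑ k, y k ^ α with hS
  set S' := ∑ l, y' l ^ α with hS'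
  have hS0 : 0 ≤ S := Finset.sum_nonneg fun k _ => Real.rpow_nonneg (hy k) _
  have hS0' : 0 ≤ S' := Finset.sum_nonneg fun k _ => Real.rpow_nonneg (hy' k) _
  have hw0 : ∀ {m : ℝ} (hm : 0 ≤ m) {z : ℂ} (hz : z.re = 0), ‖cpowNonneg m (z / 4)‖ ≤ 1 := by
    intro m hm z hz
    rw [norm_cpowNonneg hm]
    have : (z / 4).re = 0 := by simp [hz]
    split_ifs <;> simp [this]
  have hw1 : ∀ {m : ℝ} (hm : 0 ≤ m) {z : ℂ} (hz : z.re = 1), ‖cpowNonneg m (z / 4)‖ ^ 4 = m := by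
    intro m hm z hz
    rw [norm_cpowNonneg hm]
    have : (z / 4).re = 1 / 4 := by simp [hz]
    split_ifs with h
    · simp [h]
    · rw [this, ← Real.rpow_natCast, ← Real.rpow_mul hm]; norm_num
  have hc0 : ∀ {y : ℝ} (hy : 0 ≤ y) {z : ℂ} (hz : z.re = 0),
      ‖cpowNonneg y (α * (1 - z / 2))‖ = y ^ α := by
    intro y hy z hz
    rw [norm_cpowNonneg hy]
    have : ((α : ℂ) * (1 - z / 2)).re = α := by simp [hz]
    split_ifs with h
    · rw [h, Real.zero_rpow hα.ne']
    · rw [this]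
  have hc1 : ∀ {y : ℝ} (hy : 0 ≤ y) {z : ℂ} (hz : z.re = 1),
      ‖cpowNonneg y (α * (1 - z / 2))‖ ^ 2 = y ^ α := by
    intro y hy z hz
    rw [norm_cpowNonneg hy]
    have : ((α : ℂ) * (1 - z / 2)).re = α / 2 := by simp [hz]; ring
    split_ifs with h
    · rw [h, Real.zero_rpow hα.ne']; simp
    · rw [this, ← Real.rpow_natCast, ← Real.rpow_mul hy]; norm_num
  have key := integral_norm_sum_smul_le_interp hφ hG (a := 2 * (S * S'))
    (c := √(4 / 3 * (S * S'))) hθ0.le hθ1 ?_ ?_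
  · simp only [hsum] at key
    have e1 : ∀ {m : ℝ} (hm : 0 ≤ m), cpowNonneg m ((θ : ℂ) / 4) =
        ((m ^ ((α - 1) / (2 * α)) : ℝ) : ℂ) := by
      intro m hm
      have : ((θ : ℂ) / 4) = (((α - 1) / (2 * α) : ℝ) : ℂ) := by
        rw [hθ]; push_cast; field_simp; ring
      rw [this, cpowNonneg_ofReal hm]
      exact (div_pos (by linarith) (by linarith)).ne'
    have e2 : ∀ {y : ℝ} (hy : 0 ≤ y), cpowNonneg y ((α : ℂ) * (1 - θ / 2)) = (y : ℂ) := by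
      intro y hy
      have : ((α : ℂ) * (1 - θ / 2)) = ((1 : ℝ) : ℂ) := by
        have hα' : (α : ℂ) ≠ 0 := by exact_mod_cast hα.ne'
        rw [hθ]; push_cast; field_simp; ring
      rw [this, cpowNonneg_ofReal hy one_ne_zero, Real.rpow_one]
    simp only [hW, hW', e1 (hm _), e1 (hn _), e2 (hy _), e2 (hy' _)] at key
    refine key.trans (le_of_eq ?_)
    have hSS : 0 ≤ S * S' := mul_nonneg hS0 hS0'
    rw [← Real.mul_rpow hS0 hS0', Real.mul_rpow (by norm_num) hSS, Real.sqrt_eq_rpow,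
      ← Real.rpow_mul (by positivity), Real.mul_rpow (by norm_num) hSS]
    have e3 : (S * S') ^ (1 - θ) * (S * S') ^ (1 / 2 * θ) = (S * S') ^ (1 / α) := by
      rw [← Real.rpow_add_of_nonneg hSS (by linarith) (by positivity)]
      congr 1
      rw [hθ]; field_simp; ring
    have e4 : (2 : ℝ) ^ (1 - θ) * (4 / 3) ^ (1 / 2 * θ) = 2 * 3 ^ (-((α - 1) / α)) := by
      have h43 : (4 / 3 : ℝ) = 2 ^ (2 : ℝ) * 3 ^ (-1 : ℝ) := by
        rw [Real.rpow_neg_one]; norm_num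
      rw [h43, Real.mul_rpow (by positivity) (by positivity), ← Real.rpow_mul (by norm_num),
        ← Real.rpow_mul (by norm_num), ← mul_assoc, ← Real.rpow_add (by norm_num)]
      congr 1
      · rw [show 1 - θ + 2 * (1 / 2 * θ) = 1 by ring, Real.rpow_one]
      · congr 1; rw [hθ]; ring
    rw [← e3, ← e4]
    ring
  · intro z hz
    simp only [hsum]
    refine (integral_norm_traceForm_le_two_mul b hg (fun p => hw0 (hm p) hz)
      (fun q => hw0 (hn q) hz) _ _ hv he hv' he').trans (le_of_eq ?_)
    simp only [hc0 (hy _) hz, hc0 (hy' _) hz]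
    ring
  · intro z hz
    simp only [hsum]
    refine (integral_norm_traceForm_le_sqrt b hg ?_ ?_ _ _ hv he hv' he').trans (le_of_eq ?_)
    · simpa only [hw1 (hm _) hz] using hm1
    · simpa only [hw1 (hn _) hz] using hn1
    · simp only [hc1 (hy _) hz, hc1 (hy' _) hz]
      rw [mul_assoc]

end Unitary


/-! ### Finite cutoffs of the trace norm -/

section Hilbert

variable {H : Type u} [NormedAddCommGroup H] [InnerProductSpace ℂ H] [CompleteSpace H]

theorem countable_hilbertBasis [TopologicalSpace.SeparableSpace H] {κ : Type*}
    (g : HilbertBasis κ ℂ H) : Countable κ := by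
  rw [← Set.countable_univ_iff]
  refine Set.PairwiseDisjoint.countable_of_isOpen (s := fun i => Metric.ball (g i) (1 / 2)) ?_
    (fun i _ => Metric.isOpen_ball) fun i _ => Metric.nonempty_ball.2 (by norm_num)
  intro i _ j _ hij
  refine Metric.ball_disjoint_ball ?_
  have h : ‖g i - g j‖ ^ 2 = 2 := by
    rw [@norm_sub_sq ℂ, g.orthonormal.1, g.orthonormal.1, g.orthonormal.2 hij]
    norm_num
  rw [dist_eq_norm]
  nlinarith [norm_nonneg (g i - g j)]

theorem IsBessel.norm_sum_smul_sq_le {K : Type*} [Fintype K] {x : K → H} (hx : IsBessel x)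
    (c : K → ℂ) : ‖∑ k, c k • x k‖ ^ 2 ≤ ∑ k, ‖c k‖ ^ 2 := by
  set y := ∑ k, c k • x k with hy
  have h1 : ‖y‖ ^ 2 ≤ ∑ k, ‖c k‖ * ‖⟪x k, y⟫_ℂ‖ := by
    have h2 : ((‖y‖ ^ 2 : ℝ) : ℂ) = ∑ k, starRingEnd ℂ (c k) * ⟪x k, y⟫_ℂ := by
      rw [Complex.ofReal_pow]
      refine (inner_self_eq_norm_sq_to_K (𝕜 := ℂ) y).symm.trans ?_
      conv_lhs => rw [hy, sum_inner]
      simp only [inner_smul_left, ← hy]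
    have h3 : ‖y‖ ^ 2 = ‖((‖y‖ ^ 2 : ℝ) : ℂ)‖ := by
      rw [Complex.norm_real, Real.norm_of_nonneg (sq_nonneg _)]
    rw [h3, h2]
    refine (norm_sum_le _ _).trans (le_of_eq (Finset.sum_congr rfl fun k _ => ?_))
    rw [norm_mul, RCLike.norm_conj]
  have h2 := hx Finset.univ y
  have h3 := Finset.sum_mul_sq_le_sq_mul_sq Finset.univ (fun k => ‖c k‖) fun k => ‖⟪x k, y⟫_ℂ‖
  have h4 : 0 ≤ ∑ k, ‖c k‖ ^ 2 := Finset.sum_nonneg fun _ _ => sq_nonneg _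
  by_cases hy0 : ‖y‖ = 0
  · rw [hy0]; simpa using h4
  · have hpos : 0 < ‖y‖ ^ 2 := by positivity
    have h5 : (‖y‖ ^ 2) ^ 2 ≤ (∑ k, ‖c k‖ ^ 2) * ‖y‖ ^ 2 :=
      calc (‖y‖ ^ 2) ^ 2 ≤ (∑ k, ‖c k‖ * ‖⟪x k, y⟫_ℂ‖) ^ 2 := by gcongr
        _ ≤ _ := h3
        _ ≤ _ := by gcongr
    rw [sq] at h5
    exact le_of_mul_le_mul_right h5 hpos

theorem IsBessel.comp {K L : Type*} {x : K → H} (hx : IsBessel x) {φ : L → K}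
    (hφ : Function.Injective φ) : IsBessel fun l => x (φ l) := by
  intro F y
  have h := hx (F.map ⟨φ, hφ⟩) y
  rwa [Finset.sum_map] at h

theorem IsBessel.isCoordBessel {ι P K : Type*} [Fintype ι] [Fintype P] [Fintype K] {x : K → H}
    (hx : IsBessel x) {g : ι × P → H} (hg : Orthonormal ℂ g) :
    IsCoordBessel fun k i p => ⟪g (i, p), x k⟫_ℂ := by
  intro c
  have h : ∀ i p, ∑ k, c k * ⟪g (i, p), x k⟫_ℂ = ⟪g (i, p), ∑ k, c k • x k⟫_ℂ := fun i p => by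
    simp only [inner_sum, inner_smul_right]
  simp only [h]
  rw [← Fintype.sum_prod_type' fun i p => ‖⟪g (i, p), ∑ k, c k • x k⟫_ℂ‖ ^ 2]
  exact (hg.sum_inner_products_le _).trans (hx.norm_sum_smul_sq_le c)

/-- The matrix of an operator in a product basis, cut off to finitely many indices. -/
def cutoff {κ₁ κ₂ : Type*} (g : κ₁ × κ₂ → H) (P : Finset κ₁) (Q : Finset κ₂) (R : H →L[ℂ] H)
    (a a' : P × Q) : ℂ :=
  ⟪g (a.1, a.2), R (g (a'.1, a'.2))⟫_ℂ

theorem norm_sum_rankOne_le_one [DecidableEq H] {κ : Type*} [DecidableEq κ] {g : κ → H}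
    (hg : Orthonormal ℂ g)
    (S : Finset κ) : ‖∑ x ∈ S, InnerProductSpace.rankOne ℂ (g x) (g x)‖ ≤ 1 := by
  refine ContinuousLinearMap.opNorm_le_bound _ zero_le_one fun y => ?_
  rw [one_mul]
  refine le_of_sq_le_sq ?_ (norm_nonneg _)
  have h : (∑ x ∈ S, InnerProductSpace.rankOne ℂ (g x) (g x)) y =
      ∑ x : S, ⟪g x, y⟫_ℂ • g x := by
    rw [sum_apply, ← Finset.sum_coe_sort S]
    simp only [InnerProductSpace.rankOne_apply]
  rw [h, norm_sum_smul_sq (g := fun x : S => g x) (hg.comp _ Subtype.val_injective)]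
  rw [Finset.sum_coe_sort S fun x => ‖⟪g x, y⟫_ℂ‖ ^ 2]
  exact hg.sum_inner_products_le y

/-- Lower semicontinuity: the trace norm is controlled by the trace norms of finite cutoffs. -/
theorem schattenNorm_one_le_liminf {κ₁ κ₂ : Type*} (g : HilbertBasis (κ₁ × κ₂) ℂ H)
    {P : ℕ → Finset κ₁} {Q : ℕ → Finset κ₂} (hP : Filter.Tendsto P Filter.atTop Filter.atTop)
    (hQ : Filter.Tendsto Q Filter.atTop Filter.atTop) (R : H →L[ℂ] H) :
    schattenNorm 1 R ≤ Filter.liminf (fun n => ENNReal.ofReal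
      ‖traceForm (fun a : P n × Q n => g (a.1, a.2)) (cutoff g (P n) (Q n) R)‖) Filter.atTop := by
  classical
  obtain ⟨V, W, -, hW, -, hWR⟩ := exists_polar R
  have h1 : schattenNorm 1 R = trace (CFC.abs R) := by
    rw [schattenNorm, CFC.rpow_one _ (CFC.abs_nonneg R)]; simp
  have hN : Filter.Tendsto (fun n => P n ×ˢ Q n) Filter.atTop Filter.atTop := by
    rw [Filter.tendsto_atTop]
    intro S
    filter_upwards [hP.eventually_ge_atTop (S.image Prod.fst),
      hQ.eventually_ge_atTop (S.image Prod.snd)] with n h2 h3 x hx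
    exact Finset.mem_product.2 ⟨h2 (Finset.mem_image_of_mem _ hx), h3 (Finset.mem_image_of_mem _ hx)⟩
  rw [h1, trace_eq_tsum g _ (CFC.abs_nonneg R), ENNReal.tsum_eq_iSup_sum]
  refine iSup_le fun S => ?_
  have hnn : ∀ x, 0 ≤ RCLike.re ⟪g x, CFC.abs R (g x)⟫_ℂ := fun x =>
    (isPositive_of_nonneg (CFC.abs_nonneg R)).re_inner_nonneg_right _
  rw [← ENNReal.ofReal_sum_of_nonneg fun x _ => hnn x]
  set r : ℕ → ℝ := fun n => ∑ x ∈ S, RCLike.re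
    (∑ a ∈ P n ×ˢ Q n, ⟪g a, R (g x)⟫_ℂ * ⟪g x, W (g a)⟫_ℂ) with hr
  have hlim : Filter.Tendsto r Filter.atTop
      (nhds (∑ x ∈ S, RCLike.re ⟪g x, CFC.abs R (g x)⟫_ℂ)) := by
    refine tendsto_finsetSum _ fun x _ => ?_
    refine (RCLike.continuous_re.tendsto _).comp ?_
    have h2 := g.hasSum_inner_mul_inner (ContinuousLinearMap.adjoint W (g x)) (R (g x))
    rw [ContinuousLinearMap.adjoint_inner_left, hWR] at h2
    have h3 := h2.comp hN
    refine h3.congr fun n => ?_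
    refine Finset.sum_congr rfl fun a _ => ?_
    change ⟪ContinuousLinearMap.adjoint W (g x), g a⟫_ℂ * ⟪g a, R (g x)⟫_ℂ = _
    rw [ContinuousLinearMap.adjoint_inner_left, mul_comm]
  have hle : ∀ᶠ n in Filter.atTop, ENNReal.ofReal (r n) ≤ ENNReal.ofReal
      ‖traceForm (fun a : P n × Q n => g (a.1, a.2)) (cutoff g (P n) (Q n) R)‖ := by
    filter_upwards [hN.eventually_ge_atTop S] with n hn
    refine ENNReal.ofReal_le_ofReal ?_
    set Z : H →L[ℂ] H := (∑ x ∈ S, InnerProductSpace.rankOne ℂ (g x) (g x)) * W with hZ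
    have hZ1 : ‖Z‖ ≤ 1 := (norm_mul_le _ _).trans
      (mul_le_one₀ (norm_sum_rankOne_le_one g.orthonormal S) (norm_nonneg _) hW)
    have hev := TraceDual.norm_eval_le
      (traceForm (fun a : P n × Q n => g (a.1, a.2)) (cutoff g (P n) (Q n) R)) Z
    refine le_trans ?_ (hev.trans (mul_le_of_le_one_right (norm_nonneg _) hZ1))
    have hZe : ∀ a a', ⟪g a', Z (g a)⟫_ℂ = if a' ∈ S then ⟪g a', W (g a)⟫_ℂ else 0 := by
      intro a a'
      rw [hZ, mul_apply_eq_comp, sum_apply, inner_sum]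
      simp only [InnerProductSpace.rankOne_apply, inner_smul_right,
        orthonormal_iff_ite.1 g.orthonormal, mul_ite, mul_one, mul_zero, Finset.sum_ite_eq]
    have heq : TraceDual.eval Z (traceForm (fun a : P n × Q n => g (a.1, a.2))
        (cutoff g (P n) (Q n) R)) =
        ∑ x ∈ S, ∑ a ∈ P n ×ˢ Q n, ⟪g a, R (g x)⟫_ℂ * ⟪g x, W (g a)⟫_ℂ := by
      rw [eval_traceForm]
      simp only [cutoff, hZe]
      have hconv : ∀ F : κ₁ × κ₂ → ℂ, ∑ a : P n × Q n, F (a.1, a.2) = ∑ a ∈ P n ×ˢ Q n, F a := by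
        intro F
        rw [Fintype.sum_prod_type, Finset.sum_product,
          Finset.sum_coe_sort (P n) fun p => ∑ y : Q n, F (p, y)]
        exact Finset.sum_congr rfl fun p _ => Finset.sum_coe_sort (Q n) fun q => F (p, q)
      rw [Finset.sum_comm]
      rw [hconv fun a' => ∑ a : P n × Q n, ⟪g (a.1, a.2), R (g a')⟫_ℂ *
        if a' ∈ S then ⟪g a', W (g (a.1, a.2))⟫_ℂ else 0]
      rw [← Finset.sum_subset hn]
      · refine Finset.sum_congr rfl fun x hx => ?_
        rw [hconv fun a => ⟪g a, R (g x)⟫_ℂ * if x ∈ S then ⟪g x, W (g a)⟫_ℂ else 0]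
        simp only [hx, if_true]
      · intro x _ hx
        simp [hx]
    rw [heq, hr]
    simp only
    rw [← map_sum]
    exact RCLike.re_le_norm _
  calc ENNReal.ofReal (∑ x ∈ S, RCLike.re ⟪g x, CFC.abs R (g x)⟫_ℂ)
      = Filter.liminf (fun n => ENNReal.ofReal (r n)) Filter.atTop :=
        ((ENNReal.continuous_ofReal.tendsto _).comp hlim).liminf_eq.symm
    _ ≤ _ := Filter.liminf_le_liminf hle

end Hilbert

section Limit

variable {A : Type u} [NormedAddCommGroup A] [InnerProductSpace ℂ A] [CompleteSpace A]
  [FiniteDimensional ℂ A] {ι : Type*} [Fintype ι] [DecidableEq ι]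
  {H : Type*} [NormedAddCommGroup H] [InnerProductSpace ℂ H]
  {P Q : Type*} [Fintype P] [Fintype Q]

theorem continuous_integral_norm_traceForm (b : OrthonormalBasis ι ℂ A) (g : P × Q → H) :
    Continuous fun x : (ι → P → ι → P → ℂ) × (ι → Q → ι → Q → ℂ) =>
      ∫ U : unitary (A →L[ℂ] A), ‖traceForm g (decouplingMatrix b x.1 x.2 (U : A →L[ℂ] A))‖
        ∂haarUnitary A := by
  have hd : ∀ i j k l, Continuous fun x : ((ι → P → ι → P → ℂ) × (ι → Q → ι → Q → ℂ)) ×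
      unitary (A →L[ℂ] A) => decouplingCoeff b (x.2 : A →L[ℂ] A) i j k l := fun i j k l =>
    (continuous_decouplingCoeff b i j k l).comp continuous_snd
  have h := continuous_parametric_integral_of_continuous (μ := haarUnitary A)
    (f := fun (x : (ι → P → ι → P → ℂ) × (ι → Q → ι → Q → ℂ)) (U : unitary (A →L[ℂ] A)) =>
      ‖traceForm g (decouplingMatrix b x.1 x.2 (U : A →L[ℂ] A))‖) ?_ (isCompact_univ)
  · simpa only [Measure.restrict_univ] using h
  · refine Continuous.norm (continuous_traceForm g fun a a' => ?_)
    simp only [decouplingMatrix]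
    fun_prop

end Limit

/-! ### Entries of sandwiched operators -/

section Choi

variable {A : Type u} {B : Type v}
  [NormedAddCommGroup A] [InnerProductSpace ℂ A] [FiniteDimensional ℂ A]
  [NormedAddCommGroup B] [InnerProductSpace ℂ B] [CompleteSpace B]
  {ι : Type*} [Fintype ι]

/-- The entries of the blocks of an operator on `A ⊗ B` in a basis of `B`, for finitely many basis
vectors. -/
def blockEntries {κ : Type*} (b : OrthonormalBasis ι ℂ A) (f : κ → B) (P : Finset κ)
    (ω : HTensor A B →L[ℂ] HTensor A B) : ι → P → ι → P → ℂ :=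
  fun i p j p' => ⟪f p, block ω (b i) (b j) (f p')⟫_ℂ

theorem orthonormal_ketTensor {κ : Type*} (b : OrthonormalBasis ι ℂ A) (f : HilbertBasis κ ℂ B)
    (P : Finset κ) : Orthonormal ℂ fun a : ι × P => ketTensor (b a.1) (f a.2) := by
  classical
  rw [orthonormal_iff_ite]
  rintro ⟨i, p⟩ ⟨j, q⟩
  rw [inner_ketTensor, orthonormal_iff_ite.1 b.orthonormal, orthonormal_iff_ite.1 f.orthonormal]
  by_cases h1 : i = j <;> by_cases h2 : p = q <;> simp [h1, h2]

/-- In an eigenbasis of `σ`, the entries of `(1 ⊗ σ^s) Y (1 ⊗ σ^s)` are limits of weighted sums of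
rank one matrices. -/
theorem exists_tendsto_blockEntries (b : OrthonormalBasis ι ℂ A) {σ : B →L[ℂ] B} (hσ : 0 ≤ σ)
    {κ : Type*} (f : HilbertBasis κ ℂ B) {t : κ → ℝ} (hft : ∀ p, σ (f p) = (t p : ℂ) • f p) {α : ℝ}
    (h1 : 1 < α) (h2 : α ≤ 2) {Y ω : HTensor A B →L[ℂ] HTensor A B}
    (hY : opTensor (1 : A →L[ℂ] A) (σ ^ ((α - 1) / (2 * α))) * Y *
      opTensor (1 : A →L[ℂ] A) (σ ^ ((α - 1) / (2 * α))) = ω) (hfin : schattenNorm α Y ≠ ∞) :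
    ∃ (K : Type (max u v)) (y : K → ℝ) (v e : K → HTensor A B), (∀ k, 0 ≤ y k) ∧ IsBessel v ∧
      IsBessel e ∧ HasSum (fun k => y k ^ α) ((schattenNorm α Y).toReal ^ α) ∧
      ∀ P : Finset κ, Filter.Tendsto (fun F : Finset K => weightedSum (K := F)
        (fun p : P => ((t p ^ ((α - 1) / (2 * α)) : ℝ) : ℂ)) (fun k => (y k : ℂ))
        (fun k i p => ⟪ketTensor (b i) (f p), v k⟫_ℂ)
        (fun k i p => ⟪ketTensor (b i) (f p), e k⟫_ℂ)) Filter.atTop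
        (nhds (blockEntries b f P ω)) := by
  have hs : 0 ≤ (α - 1) / (2 * α) := div_nonneg (by linarith) (by linarith)
  set s := (α - 1) / (2 * α)
  obtain ⟨K, e, v, y, hy, hv, hye, hsum⟩ := exists_singularValues h1.le h2 hfin
  refine ⟨K, y, v, e, hy, hv, e.orthonormal.isBessel, hsum, fun P => ?_⟩
  simp only [tendsto_pi_nhds]
  intro i p j p'
  have heig : ∀ i p, opTensor (1 : A →L[ℂ] A) (σ ^ s) (ketTensor (b i) (f p)) =
      ((t p ^ s : ℝ) : ℂ) • ketTensor (b i) (f p) := fun i p =>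
    opTensor_one_apply_eigenvector (rpow_apply_eigenvector hσ hs (hft p)) (b i)
  have hpos : 0 ≤ opTensor (1 : A →L[ℂ] A) (σ ^ s) := opTensor_one_nonneg CFC.rpow_nonneg
  have hentry : blockEntries b f P ω i p j p' = ((t p ^ s : ℝ) : ℂ) * ((t p' ^ s : ℝ) : ℂ) *
      ⟪ketTensor (b i) (f p), Y (ketTensor (b j) (f p'))⟫_ℂ := by
    rw [blockEntries, inner_block, ← hY, mul_apply_eq_comp, mul_apply_eq_comp, heig,
      ← inner_apply_eq_inner_apply hpos, heig, map_smul, inner_smul_left, inner_smul_right,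
      Complex.conj_ofReal]
    ring
  have hSum : HasSum (fun k => (y k : ℂ) * (⟪ketTensor (b i) (f p), v k⟫_ℂ *
      starRingEnd ℂ ⟪ketTensor (b j) (f p'), e k⟫_ℂ))
      ⟪ketTensor (b i) (f p), Y (ketTensor (b j) (f p'))⟫_ℂ := by
    have h3 := (e.hasSum_repr (ketTensor (b j) (f p'))).mapL
      (innerSL ℂ (ketTensor (b i) (f p)) ∘L Y)
    have h4 : (innerSL ℂ (ketTensor (b i) (f p)) ∘L Y) (ketTensor (b j) (f p')) =
      ⟪ketTensor (b i) (f p), Y (ketTensor (b j) (f p'))⟫_ℂ := rfl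
    rw [h4] at h3
    refine (congrArg (HasSum · _) (funext fun k => ?_)).mpr h3
    rw [ContinuousLinearMap.comp_apply, map_smul, map_smul, hye, map_smul, innerSL_apply_apply,
      e.repr_apply_apply, smul_eq_mul, smul_eq_mul, inner_conj_symm]
    ring
  rw [hentry]
  refine (hSum.mul_left _).congr fun F => ?_
  simp only [weightedSum]
  rw [Finset.sum_coe_sort F fun k => (y k : ℂ) * (⟪ketTensor (b i) (f p), v k⟫_ℂ *
      starRingEnd ℂ ⟪ketTensor (b j) (f p'), e k⟫_ℂ)]
  rw [Finset.mul_sum]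

end Choi

/-! ### The decoupling bound for fixed reference states -/

section Decoupling

variable {A : Type u} {C : Type v} {E : Type w}
  [NormedAddCommGroup A] [InnerProductSpace ℂ A] [CompleteSpace A] [FiniteDimensional ℂ A]
  [NormedAddCommGroup C] [InnerProductSpace ℂ C] [CompleteSpace C]
  [NormedAddCommGroup E] [InnerProductSpace ℂ E] [CompleteSpace E]
  {ι : Type*} [Fintype ι] [DecidableEq ι]

/-- The operator `∑ g_{ijkl}(U) ω_{ij} ⊗ ρ_{kl}`. -/
def decouplingOp (b : OrthonormalBasis ι ℂ A) (ω : HTensor A C →L[ℂ] HTensor A C)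
    (ρ : HTensor A E →L[ℂ] HTensor A E) (U : A →L[ℂ] A) : HTensor C E →L[ℂ] HTensor C E :=
  ∑ i, ∑ j, ∑ k, ∑ l, decouplingCoeff b U i j k l •
    opTensor (block ω (b i) (b j)) (block ρ (b k) (b l))

theorem cutoff_decouplingOp (b : OrthonormalBasis ι ℂ A) (ω : HTensor A C →L[ℂ] HTensor A C)
    (ρ : HTensor A E →L[ℂ] HTensor A E) {κ₁ κ₂ : Type*} (f : κ₁ → C) (h : κ₂ → E)
    {g : κ₁ × κ₂ → HTensor C E} (hg : ∀ p, g p = ketTensor (f p.1) (h p.2)) (P : Finset κ₁)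
    (Q : Finset κ₂) (U : A →L[ℂ] A) :
    cutoff g P Q (decouplingOp b ω ρ U) =
      decouplingMatrix b (blockEntries b f P ω) (blockEntries b h Q ρ) U := by
  funext a a'
  simp only [cutoff, hg, decouplingOp, sum_apply, inner_sum, smul_apply, inner_smul_right,
    opTensor_ketTensor, inner_ketTensor]
  rfl

theorem sum_rpow_le_of_hasSum {K : Type*} {α : ℝ} (hα : 0 < α) (F : Finset K) {y : K → ℝ} {N : ℝ}
    (hy : ∀ k, 0 ≤ y k) (hN : 0 ≤ N) (hs : HasSum (fun k => y k ^ α) (N ^ α)) :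
    (∑ k : F, y k ^ α) ^ (1 / α) ≤ N := by
  rw [Finset.sum_coe_sort F fun k => y k ^ α]
  calc (∑ k ∈ F, y k ^ α) ^ (1 / α) ≤ (N ^ α) ^ (1 / α) := by
        refine Real.rpow_le_rpow (Finset.sum_nonneg fun k _ => Real.rpow_nonneg (hy k) _)
          (sum_le_hasSum _ (fun k _ => Real.rpow_nonneg (hy k) _) hs) (by positivity)
    _ = N := by rw [← Real.rpow_mul hN, mul_one_div_cancel hα.ne', Real.rpow_one]

/-- **Decoupling**, for fixed reference states `σ₁` and `σ₂`: the bound for finite matrices passes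
to the singular value expansions of `Y₁` and `Y₂` by continuity, and from finite cutoffs in eigenbases
of the reference states to the trace norm by Fatou's lemma. -/
theorem lintegral_schattenNorm_decouplingOp_le [Nonempty ι] [TopologicalSpace.SeparableSpace C]
    [TopologicalSpace.SeparableSpace E] (b : OrthonormalBasis ι ℂ A)
    {ω Y₁ : HTensor A C →L[ℂ] HTensor A C} {ρ Y₂ : HTensor A E →L[ℂ] HTensor A E}
    {σ₁ : C →L[ℂ] C} {σ₂ : E →L[ℂ] E} (hσ₁ : IsDensity σ₁) (hσ₂ : IsDensity σ₂) {α : ℝ}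
    (h1 : 1 < α) (h2 : α ≤ 2)
    (hY₁ : opTensor (1 : A →L[ℂ] A) (σ₁ ^ ((α - 1) / (2 * α))) * Y₁ *
      opTensor (1 : A →L[ℂ] A) (σ₁ ^ ((α - 1) / (2 * α))) = ω) (hfin₁ : schattenNorm α Y₁ ≠ ∞)
    (hY₂ : opTensor (1 : A →L[ℂ] A) (σ₂ ^ ((α - 1) / (2 * α))) * Y₂ *
      opTensor (1 : A →L[ℂ] A) (σ₂ ^ ((α - 1) / (2 * α))) = ρ) (hfin₂ : schattenNorm α Y₂ ≠ ∞) :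
    ∫⁻ U : unitary (A →L[ℂ] A), schattenNorm 1 (decouplingOp b ω ρ (U : A →L[ℂ] A))
      ∂haarUnitary A ≤ ENNReal.ofReal (2 * (3 : ℝ) ^ (-((α - 1) / α)) *
        ((schattenNorm α Y₁).toReal * (schattenNorm α Y₂).toReal)) := by
  classical
  have hα : 0 < α := by linarith
  obtain ⟨κ₁, f, t, ht0, hft, hts⟩ := hσ₁.exists_eigenbasis
  obtain ⟨κ₂, h, t', ht0', hft', hts'⟩ := hσ₂.exists_eigenbasis
  obtain ⟨K, y, v, e, hy, hv, he, hsum, hlim⟩ := exists_tendsto_blockEntries b hσ₁.1 f hft h1 h2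
    hY₁ hfin₁
  obtain ⟨L, y', v', e', hy', hv', he', hsum', hlim'⟩ := exists_tendsto_blockEntries b hσ₂.1 h hft'
    h1 h2 hY₂ hfin₂
  obtain ⟨g, hg⟩ := exists_tensorBasis f h
  have hc₁ := countable_hilbertBasis f
  have hc₂ := countable_hilbertBasis h
  obtain ⟨P, hP⟩ := Filter.exists_seq_tendsto (Filter.atTop : Filter (Finset κ₁))
  obtain ⟨Q, hQ⟩ := Filter.exists_seq_tendsto (Filter.atTop : Filter (Finset κ₂))
  have hcont : ∀ n, Continuous fun U : unitary (A →L[ℂ] A) =>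
      ‖traceForm (fun a : P n × Q n => g (a.1, a.2))
        (cutoff g (P n) (Q n) (decouplingOp b ω ρ (U : A →L[ℂ] A)))‖ := fun n => by
    simp only [cutoff_decouplingOp b ω ρ f h hg]
    exact (continuous_traceForm _ fun a a' => continuous_decouplingMatrix b _ _ a a').norm
  have hbound : ∀ n, ∫ U : unitary (A →L[ℂ] A), ‖traceForm (fun a : P n × Q n => g (a.1, a.2))
      (cutoff g (P n) (Q n) (decouplingOp b ω ρ (U : A →L[ℂ] A)))‖ ∂haarUnitary A ≤
      2 * (3 : ℝ) ^ (-((α - 1) / α)) *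
        ((schattenNorm α Y₁).toReal * (schattenNorm α Y₂).toReal) := by
    intro n
    simp only [cutoff_decouplingOp b ω ρ f h hg]
    have hJ := (continuous_integral_norm_traceForm b fun a : P n × Q n => g (a.1, a.2)).tendsto
      (blockEntries b f (P n) ω, blockEntries b h (Q n) ρ)
    have hconv := hJ.comp (((hlim (P n)).comp Filter.tendsto_fst).prodMk_nhds
      ((hlim' (Q n)).comp Filter.tendsto_snd))
    refine le_of_tendsto hconv (Filter.Eventually.of_forall fun F => ?_)
    have hg' : Orthonormal ℂ fun a : P n × Q n => g (a.1, a.2) :=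
      g.orthonormal.comp (fun a : P n × Q n => ((a.1 : κ₁), (a.2 : κ₂))) fun a a' haa =>
        Prod.ext (Subtype.ext (congrArg Prod.fst haa)) (Subtype.ext (congrArg Prod.snd haa))
    refine (integral_norm_traceForm_le (K := F.1) (L := F.2) b hg' (fun p => ht0 p) ?_ (fun q => ht0' q) ?_
      (fun k => hy k) (fun l => hy' l)
      ((hv.comp Subtype.val_injective).isCoordBessel (orthonormal_ketTensor b f (P n)))
      ((he.comp Subtype.val_injective).isCoordBessel (orthonormal_ketTensor b f (P n)))
      ((hv'.comp Subtype.val_injective).isCoordBessel (orthonormal_ketTensor b h (Q n)))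
      ((he'.comp Subtype.val_injective).isCoordBessel (orthonormal_ketTensor b h (Q n)))
      h1 h2).trans ?_
    · rw [Finset.sum_coe_sort (P n) t]
      exact sum_le_hasSum _ (fun p _ => ht0 p) hts
    · rw [Finset.sum_coe_sort (Q n) t']
      exact sum_le_hasSum _ (fun p _ => ht0' p) hts'
    · gcongr
      · exact Real.rpow_nonneg (Finset.sum_nonneg fun (l : F.2) _ => Real.rpow_nonneg (hy' l) α) _
      · exact sum_rpow_le_of_hasSum hα F.1 hy ENNReal.toReal_nonneg hsum
      · exact sum_rpow_le_of_hasSum hα F.2 hy' ENNReal.toReal_nonneg hsum'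
  calc _ ≤ ∫⁻ U : unitary (A →L[ℂ] A), Filter.liminf (fun n => ENNReal.ofReal
        ‖traceForm (fun a : P n × Q n => g (a.1, a.2))
          (cutoff g (P n) (Q n) (decouplingOp b ω ρ (U : A →L[ℂ] A)))‖) Filter.atTop
        ∂haarUnitary A := lintegral_mono fun U => schattenNorm_one_le_liminf g hP hQ _
    _ ≤ Filter.liminf (fun n => ∫⁻ U : unitary (A →L[ℂ] A), ENNReal.ofReal
        ‖traceForm (fun a : P n × Q n => g (a.1, a.2))
          (cutoff g (P n) (Q n) (decouplingOp b ω ρ (U : A →L[ℂ] A)))‖ ∂haarUnitary A)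
        Filter.atTop := by
        exact lintegral_liminf_le fun n => (hcont n).measurable.ennreal_ofReal
    _ ≤ _ := by
        refine (Filter.liminf_le_liminf (Filter.Eventually.of_forall fun n => ?_)).trans
          (Filter.liminf_const _).le
        rw [← ofReal_integral_eq_lintegral_ofReal (integrable_of_continuous (hcont n))
          (Filter.Eventually.of_forall fun U => norm_nonneg _)]
        exact ENNReal.ofReal_le_ofReal (hbound n)

end Decoupling


/-! ### Overlaps of vectors with eigenbases -/

section Overlap

variable {H : Type u} [NormedAddCommGroup H] [InnerProductSpace ℂ H] [CompleteSpace H]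
variable {ι : Type v} {κ : Type w}

/-- The squared overlap `|⟨x, y⟩|²` of two vectors, with values in `[0, ∞]`, so that double sums
of overlaps can be rearranged freely. -/
def overlap (x y : H) : ℝ≥0∞ := ‖⟪x, y⟫_ℂ‖ₑ ^ 2

theorem overlap_comm (x y : H) : overlap x y = overlap y x := by
  unfold overlap
  rw [← ofReal_norm, ← ofReal_norm, norm_inner_symm]

theorem overlap_ne_top (x y : H) : overlap x y ≠ ∞ := by
  unfold overlap
  simp

theorem overlap_eq_ofReal (x y : H) : overlap x y = ENNReal.ofReal (‖⟪x, y⟫_ℂ‖ ^ 2) := by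
  rw [overlap, ENNReal.ofReal_pow (norm_nonneg _), ofReal_norm]

theorem overlap_smul_right (t : ℝ) (x y : H) :
    overlap x ((t : ℂ) • y) = ENNReal.ofReal (t ^ 2) * overlap x y := by
  rw [overlap_eq_ofReal, overlap_eq_ofReal, inner_smul_right, norm_mul, mul_pow,
    ENNReal.ofReal_mul (by positivity)]
  simp

theorem tsum_overlap (e : HilbertBasis ι ℂ H) (x : H) : ∑' i, overlap (e i) x = ‖x‖ₑ ^ 2 :=
  (enorm_sq_eq_tsum e x).symm

theorem tsum_overlap_left (e : HilbertBasis ι ℂ H) (x : H) : ∑' i, overlap x (e i) = ‖x‖ₑ ^ 2 := by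
  simp_rw [overlap_comm x]
  exact tsum_overlap e x

theorem hasSum_overlap_toReal (h : HilbertBasis κ ℂ H) {x : H} (hx : ‖x‖ₑ = 1) :
    HasSum (fun j => (overlap x (h j)).toReal) 1 := by
  have h1 := tsum_overlap_left h x
  rw [hx, one_pow] at h1
  have h2 := ENNReal.hasSum_toReal (f := fun p => overlap x (h p)) (by rw [h1]; simp)
  rwa [← ENNReal.tsum_toReal_eq fun _ => overlap_ne_top _ _, h1, ENNReal.toReal_one] at h2

theorem enorm_hilbertBasis (e : HilbertBasis ι ℂ H) (i : ι) : ‖e i‖ₑ = 1 := by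
  rw [← ofReal_norm, e.orthonormal.norm_eq_one]; simp

theorem IsBessel.tsum_overlap_le {v : ι → H} (hv : IsBessel v) (x : H) :
    ∑' i, overlap (v i) x ≤ ‖x‖ₑ ^ 2 := by
  rw [ENNReal.tsum_eq_iSup_sum]
  refine iSup_le fun F => ?_
  simp_rw [overlap_eq_ofReal]
  rw [← ENNReal.ofReal_sum_of_nonneg (fun _ _ => by positivity), ← ofReal_norm,
    ← ENNReal.ofReal_pow (norm_nonneg _)]
  exact ENNReal.ofReal_le_ofReal (hv F x)

/-- `CFC.rpow_nonneg` for bounded operators; stating it separately spares repeated instance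
searches. -/
theorem rpow_opNonneg (T : H →L[ℂ] H) (r : ℝ) : 0 ≤ T ^ r := CFC.rpow_nonneg

theorem conj_opNonneg {T : H →L[ℂ] H} (hT : 0 ≤ T) (V : H →L[ℂ] H) : 0 ≤ star V * T * V :=
  star_left_conjugate_nonneg hT V

theorem mul_star_opNonneg (T : H →L[ℂ] H) : 0 ≤ T * star T := mul_star_self_nonneg T

theorem inner_eigenvector_apply {T : H →L[ℂ] H} (hT : 0 ≤ T) {t : ℝ} {e : H}
    (het : T e = (t : ℂ) • e) (x : H) : ⟪e, T x⟫_ℂ = (t : ℂ) * ⟪e, x⟫_ℂ := by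
  rw [← inner_apply_eq_inner_apply hT, het, inner_smul_left]
  simp

theorem overlap_eigenvector_apply {T : H →L[ℂ] H} (hT : 0 ≤ T) {t : ℝ} {e : H}
    (het : T e = (t : ℂ) • e) (x : H) :
    overlap e (T x) = ENNReal.ofReal (t ^ 2) * overlap e x := by
  rw [overlap_eq_ofReal, overlap_eq_ofReal, inner_eigenvector_apply hT het, norm_mul, mul_pow,
    ENNReal.ofReal_mul (by positivity)]
  simp

/-- The quadratic form of a positive operator in an eigenbasis. -/
theorem ofReal_re_inner_eq_tsum (e : HilbertBasis ι ℂ H) {T : H →L[ℂ] H} (hT : 0 ≤ T) {t : ι → ℝ}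
    (ht : ∀ i, 0 ≤ t i) (het : ∀ i, T (e i) = (t i : ℂ) • e i) (x : H) :
    ENNReal.ofReal (RCLike.re ⟪x, T x⟫_ℂ) = ∑' i, ENNReal.ofReal (t i) * overlap (e i) x := by
  have h := norm_sq_eq_re_inner_rpow_half (T := T) zero_le_one x
  rw [CFC.rpow_one T hT] at h
  rw [h, ENNReal.ofReal_pow (norm_nonneg _), ofReal_norm, ← tsum_overlap e]
  congr 1; funext i
  rw [overlap_eigenvector_apply (rpow_opNonneg _ _)
    (rpow_apply_eigenvector hT (by norm_num : (0 : ℝ) ≤ 1 / 2) (het i)),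
    ← Real.rpow_natCast, ← Real.rpow_mul (ht i)]
  norm_num

/-- The squared norm of `S⁻¹ x` in an eigenbasis of `S`. The quotient is taken in `[0, ∞]`: where
`S` has eigenvalue zero, `x = S z` has overlap zero, and `0 / 0 = 0`. -/
theorem tsum_overlap_div_le (h : HilbertBasis κ ℂ H) {S : H →L[ℂ] H} (hS : 0 ≤ S) {τ : κ → ℝ}
    (hτ : ∀ j, S (h j) = (τ j : ℂ) • h j) {x z : H} (hz : S z = x) :
    ∑' j, overlap (h j) x / ENNReal.ofReal (τ j ^ 2) ≤ ‖z‖ₑ ^ 2 := by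
  rw [← tsum_overlap h]
  refine ENNReal.tsum_le_tsum fun j => ENNReal.div_le_of_le_mul ?_
  rw [← hz, overlap_eigenvector_apply hS (hτ j), mul_comm]

/-- The operator inequality `T ≤ c S` as domination of square roots, the form in which
`exists_factor_of_norm_le` applies. -/
theorem norm_rpow_half_apply_le {T S : H →L[ℂ] H} (hT : 0 ≤ T) (hS : 0 ≤ S) {c : ℝ}
    (hc : 0 ≤ c) (hTS : T ≤ (c : ℂ) • S) (x : H) :
    ‖(T ^ (1 / 2 : ℝ)) x‖ ≤ √c * ‖(S ^ (1 / 2 : ℝ)) x‖ := by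
  have hq : ∀ R : H →L[ℂ] H, 0 ≤ R → ‖(R ^ (1 / 2 : ℝ)) x‖ ^ 2 = RCLike.re ⟪x, R x⟫_ℂ := by
    intro R hR
    rw [← norm_sq_eq_re_inner_rpow_half (T := R) zero_le_one x, CFC.rpow_one R hR]
  have h1 := ((ContinuousLinearMap.le_def _ _).1 hTS).re_inner_nonneg_right x
  rw [sub_apply, inner_sub_right, map_sub, smul_apply, inner_smul_right] at h1
  rw [RCLike.re_eq_complex_re, Complex.re_ofReal_mul] at h1
  have h2 : ‖(T ^ (1 / 2 : ℝ)) x‖ ^ 2 ≤ (√c * ‖(S ^ (1 / 2 : ℝ)) x‖) ^ 2 := by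
    rw [mul_pow, Real.sq_sqrt hc, hq T hT, hq S hS]
    simp only [RCLike.re_eq_complex_re] at h1 ⊢
    linarith
  exact abs_le_of_sq_le_sq' h2 (by positivity) |>.2

/-- Adjoint form of a factorization `V S = R` of positive operators. -/
theorem apply_adjoint_of_factor {S R V : H →L[ℂ] H} (hS : 0 ≤ S) (hR : 0 ≤ R)
    (h : ∀ x, V (S x) = R x) (x : H) : S (ContinuousLinearMap.adjoint V x) = R x := by
  refine ext_inner_left ℂ fun y => ?_
  rw [← inner_apply_eq_inner_apply hS, ContinuousLinearMap.adjoint_inner_right, h,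
    inner_apply_eq_inner_apply hR]

/-- If `T ≤ c S`, an eigenvector of `T` for the eigenvalue `s` satisfies
`s ⟨e, S⁻¹ e⟩ ≤ c ‖e‖²`. -/
theorem tsum_overlap_div_le_of_le (h : HilbertBasis κ ℂ H) {T S : H →L[ℂ] H} (hT : 0 ≤ T)
    (hS : 0 ≤ S) {c : ℝ} (hc : 0 ≤ c) (hTS : T ≤ (c : ℂ) • S) {s : ℝ} (hs : 0 ≤ s) {e : H}
    (he : T e = (s : ℂ) • e) {t : κ → ℝ} (ht : ∀ j, 0 ≤ t j)
    (hht : ∀ j, S (h j) = (t j : ℂ) • h j) :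
    ∑' j, ENNReal.ofReal s * (overlap e (h j) / ENNReal.ofReal (t j)) ≤
      ENNReal.ofReal c * ‖e‖ₑ ^ 2 := by
  obtain ⟨V, hV, hVS, -⟩ := exists_factor_of_norm_le _ _ (Real.sqrt_nonneg c)
    (norm_rpow_half_apply_le hT hS hc hTS)
  have hz : (S ^ (1 / 2 : ℝ)) (ContinuousLinearMap.adjoint V e) = ((s ^ (1 / 2 : ℝ) : ℝ) : ℂ) • e := by
    rw [← rpow_apply_eigenvector hT (by norm_num) he]
    exact apply_adjoint_of_factor (rpow_opNonneg _ _) (rpow_opNonneg _ _) hVS e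
  have hsq : ∀ a : ℝ, 0 ≤ a → (a ^ (1 / 2 : ℝ)) ^ 2 = a := fun a ha => by
    rw [← Real.rpow_natCast, ← Real.rpow_mul ha]; norm_num
  have h1 := tsum_overlap_div_le h (rpow_opNonneg _ _)
    (fun j => rpow_apply_eigenvector hS (by norm_num : (0 : ℝ) ≤ 1 / 2) (hht j)) hz
  refine le_trans (le_of_eq ?_) (h1.trans ?_)
  · congr 1; funext j
    rw [overlap_smul_right, hsq _ hs, hsq _ (ht j), overlap_comm e,
      mul_div_assoc]
  · rw [← ofReal_norm, ← ofReal_norm, ← ENNReal.ofReal_pow (norm_nonneg _),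
      ← ENNReal.ofReal_pow (norm_nonneg _), ← ENNReal.ofReal_mul hc]
    refine ENNReal.ofReal_le_ofReal ?_
    calc ‖ContinuousLinearMap.adjoint V e‖ ^ 2 ≤ (√c * ‖e‖) ^ 2 := by
          gcongr
          refine (ContinuousLinearMap.le_opNorm _ _).trans ?_
          rw [LinearIsometryEquiv.norm_map]
          gcongr
      _ = c * ‖e‖ ^ 2 := by rw [mul_pow, Real.sq_sqrt hc]

end Overlap

/-! ### Upper bound for the sandwiched norm -/

section SandwichedUpper

variable {H : Type u} [NormedAddCommGroup H] [InnerProductSpace ℂ H] [CompleteSpace H]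
variable {ι : Type v} {κ : Type w}

theorem schattenNorm_of_nonneg {α : ℝ} {Y : H →L[ℂ] H} (hY : 0 ≤ Y) :
    schattenNorm α Y = trace (Y ^ α) ^ (1 / α) := by
  rw [schattenNorm, CFC.abs_of_nonneg Y hY]

theorem smul_rpow_of_eigenbasis (h : HilbertBasis κ ℂ H) {S : H →L[ℂ] H} (hS : 0 ≤ S) {c : ℝ}
    (hc : 0 ≤ c) {t : κ → ℝ} (ht : ∀ j, 0 ≤ t j) (hht : ∀ j, S (h j) = (t j : ℂ) • h j)
    {p r : ℝ} (hp : 0 ≤ p) (hr : 0 ≤ r) :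
    ((c : ℂ) • S ^ p) ^ r = ((c ^ r : ℝ) : ℂ) • S ^ (p * r) := by
  have hpos : (0 : H →L[ℂ] H) ≤ (c : ℂ) • S ^ p := by
    rw [Complex.coe_smul]
    exact smul_nonneg hc (rpow_opNonneg _ _)
  refine ext_hilbertBasis h fun j => ?_
  have h1 : ((c : ℂ) • S ^ p) (h j) = ((c * t j ^ p : ℝ) : ℂ) • h j := by
    rw [smul_apply, rpow_apply_eigenvector hS hp (hht j), smul_smul]
    push_cast; rfl
  rw [rpow_apply_eigenvector hpos hr h1, smul_apply,
    rpow_apply_eigenvector hS (mul_nonneg hp hr) (hht j), smul_smul,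
    Real.mul_rpow hc (Real.rpow_nonneg (ht j) _), ← Real.rpow_mul (ht j)]
  push_cast; rfl

theorem inner_conj_apply (V T : H →L[ℂ] H) (x : H) :
    ⟪x, (star V * T * V) x⟫_ℂ = ⟪V x, T (V x)⟫_ℂ := by
  rw [mul_apply_eq_comp, mul_apply_eq_comp, ContinuousLinearMap.star_eq_adjoint,
    ContinuousLinearMap.adjoint_inner_right]

theorem rpow_rpow_of_eigenbasis (h : HilbertBasis κ ℂ H) {S : H →L[ℂ] H} (hS : 0 ≤ S)
    {t : κ → ℝ} (ht : ∀ j, 0 ≤ t j) (hht : ∀ j, S (h j) = (t j : ℂ) • h j)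
    {p r : ℝ} (hp : 0 ≤ p) (hr : 0 ≤ r) : (S ^ p) ^ r = S ^ (p * r) := by
  have := smul_rpow_of_eigenbasis h hS zero_le_one ht hht hp hr
  simpa using this

/-- If `‖V‖² ≤ c` then `K K⋆ ≤ c ρ^r` for `K = ρ^(r/2) V`. -/
theorem mul_star_self_le_smul_rpow {V ρ : H →L[ℂ] H} {c r : ℝ} (hc : 0 ≤ c) (hr : 0 ≤ r)
    (hV : ‖V‖ ≤ √c) : ρ ^ (r / 2) * V * star (ρ ^ (r / 2) * V) ≤ (c : ℂ) • ρ ^ r := by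
  have hR0 : 0 ≤ ρ ^ (r / 2) := (rpow_opNonneg _ _)
  have hq := norm_sq_eq_re_inner_rpow_half (T := ρ) hr
  generalize hR : ρ ^ (r / 2) = R at hR0 hq ⊢
  rw [← sub_nonneg]
  have hsa : IsSelfAdjoint ((c : ℂ) • ρ ^ r - R * V * star (R * V)) := by
    refine IsSelfAdjoint.sub ?_ (IsSelfAdjoint.of_nonneg (mul_star_opNonneg _))
    rw [Complex.coe_smul]
    exact (IsSelfAdjoint.all c).smul (IsSelfAdjoint.of_nonneg (rpow_opNonneg _ _))
  rw [ContinuousLinearMap.nonneg_iff_isPositive, ContinuousLinearMap.isPositive_def]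
  refine ⟨hsa.isSymmetric, fun x => ?_⟩
  have hx1 : RCLike.re ⟪x, (R * V * star (R * V)) x⟫_ℂ ≤ c * ‖R x‖ ^ 2 := by
    have h1 : star (R * V) x = star V (R x) := by
      rw [star_mul, mul_apply_eq_comp, (IsSelfAdjoint.of_nonneg hR0).star_eq]
    rw [mul_apply_eq_comp, ← ContinuousLinearMap.adjoint_inner_left,
      ← ContinuousLinearMap.star_eq_adjoint, inner_self_eq_norm_sq (𝕜 := ℂ), h1]
    have h2 : ‖star V (R x)‖ ≤ √c * ‖R x‖ := by
      refine (ContinuousLinearMap.le_opNorm _ _).trans ?_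
      rw [norm_star]
      gcongr
    calc ‖star V (R x)‖ ^ 2 ≤ (√c * ‖R x‖) ^ 2 := by gcongr
      _ = c * ‖R x‖ ^ 2 := by rw [mul_pow, Real.sq_sqrt hc]
  have hx2 := hq x
  rw [ContinuousLinearMap.reApplyInnerSelf_apply, inner_re_symm, sub_apply, inner_sub_right,
    map_sub, smul_apply, inner_smul_right]
  simp only [RCLike.re_eq_complex_re] at hx1 hx2 ⊢
  rw [Complex.re_ofReal_mul, hx2]
  linarith

/-- With `u = (α-1)/α` and `‖V‖² ≤ c`: `Tr (V* ρ^(1-u) V)^α ≤ c^(α-1) Tr (V* ρ V)`. The reason is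
that `V* ρ^(1-u) V = K* K` has the same nonzero eigenvalues as `K K* ≤ c ρ^(1-u)`, together with
operator monotonicity of the power `α - 1`. -/
theorem trace_conj_rpow_le (e : HilbertBasis ι ℂ H) {ρ : H →L[ℂ] H} (hρ : IsDensity ρ)
    {s : ι → ℝ} (hs : ∀ i, 0 ≤ s i) (hes : ∀ i, ρ (e i) = (s i : ℂ) • e i) {α : ℝ} (h1 : 1 < α)
    (h2 : α ≤ 2) {u : ℝ} (hu : u = (α - 1) / α) {V : H →L[ℂ] H} {c : ℝ} (hc : 0 ≤ c)
    (hV : ‖V‖ ≤ √c) :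
    trace ((star V * ρ ^ (1 - u) * V) ^ α) ≤
      ENNReal.ofReal (c ^ (α - 1)) * trace (star V * ρ * V) := by
  have hα0 : 0 < α := by linarith
  have hu0 : 0 < u := hu ▸ div_pos (by linarith) hα0
  have hu1 : u ≤ 1 := by rw [hu, div_le_one hα0]; linarith
  have huα : (1 - u) * α = 1 := by rw [hu]; field_simp; ring
  have hρ0 := hρ.1
  have hsplit : ρ ^ (1 - u) = ρ ^ ((1 - u) / 2) * ρ ^ ((1 - u) / 2) := by
    rw [← rpow_add_of_nonneg ρ (by linarith) (by linarith), add_halves]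
  have hZle := mul_star_self_le_smul_rpow (ρ := ρ) (r := 1 - u) hc (by linarith) hV
  have hRρ : ρ ^ ((1 - u) / 2) * (ρ ^ u * ρ ^ ((1 - u) / 2)) = ρ := by
    rw [← rpow_add_of_nonneg ρ hu0.le (by linarith),
      ← rpow_add_of_nonneg ρ (by linarith) (by linarith)]
    have : (1 - u) / 2 + (u + (1 - u) / 2) = 1 := by ring
    rw [this, CFC.rpow_one ρ hρ0]
  have hρc : IsCompactOperator (ρ ^ (1 - u)) := by
    refine isCompactOperator_of_trace_rpow_ne_top (rpow_opNonneg _ _) hα0 h2 ?_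
    rw [rpow_rpow_of_eigenbasis e hρ0 hs hes (by linarith) hα0.le, huα, CFC.rpow_one ρ hρ0, hρ.2]
    simp
  have hZpow : (ρ ^ ((1 - u) / 2) * V * star (ρ ^ ((1 - u) / 2) * V)) ^ (α - 1) ≤
      ((c ^ (α - 1) : ℝ) : ℂ) • ρ ^ u := by
    have h3 := CFC.rpow_le_rpow (p := α - 1) ⟨by linarith, by linarith⟩ hZle
    rw [smul_rpow_of_eigenbasis e hρ0 hc hs hes (by linarith) (by linarith)] at h3
    have : (1 - u) * (α - 1) = u := by rw [mul_sub, huα]; ring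
    rwa [this] at h3
  have hY0 : 0 ≤ star V * ρ ^ (1 - u) * V := conj_opNonneg (rpow_opNonneg _ _) V
  have hYc : IsCompactOperator (star V * ρ ^ (1 - u) * V : H →L[ℂ] H) :=
    (hρc.clm_comp (star V)).comp_clm V
  have hR0 : 0 ≤ ρ ^ ((1 - u) / 2) := (rpow_opNonneg _ _)
  have hYK : star V * ρ ^ (1 - u) * V =
      star (ρ ^ ((1 - u) / 2) * V) * (ρ ^ ((1 - u) / 2) * V) := by
    rw [hsplit, star_mul, (IsSelfAdjoint.of_nonneg hR0).star_eq]
    noncomm_ring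
  generalize hRdef : ρ ^ ((1 - u) / 2) = R at *
  generalize hYdef : star V * ρ ^ (1 - u) * V = Y at *
  obtain ⟨l, g, y, hy0, hgy⟩ := exists_eigenbasis hY0 hYc
  rw [trace_rpow_eq_tsum_eigenvalues g hY0 hgy hα0.le,
    trace_eq_tsum g _ (conj_opNonneg hρ0 V), ← ENNReal.tsum_mul_left]
  refine ENNReal.tsum_le_tsum fun i => ?_
  rw [← ENNReal.ofReal_mul (Real.rpow_nonneg hc _)]
  refine ENNReal.ofReal_le_ofReal ?_
  have hw : (R * V * star (R * V)) ((R * V) (g i)) = (y i : ℂ) • (R * V) (g i) := by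
    rw [mul_apply_eq_comp, ← mul_apply_eq_comp (star (R * V)), ← hYK, hgy, map_smul]
  have hwn : ⟪(R * V) (g i), (R * V) (g i)⟫_ℂ = (y i : ℂ) := by
    rw [← ContinuousLinearMap.adjoint_inner_right, ← ContinuousLinearMap.star_eq_adjoint,
      ← mul_apply_eq_comp, ← hYK, hgy, inner_smul_right, inner_self_eq_norm_sq_to_K,
      g.orthonormal.norm_eq_one]
    simp
  have h3 := ((ContinuousLinearMap.le_def _ _).1 hZpow).re_inner_nonneg_right ((R * V) (g i))
  rw [sub_apply, inner_sub_right, map_sub, smul_apply, inner_smul_right,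
    rpow_apply_eigenvector (mul_star_opNonneg _) (by linarith) hw, inner_smul_right, hwn,
    RCLike.re_eq_complex_re, Complex.re_ofReal_mul, Complex.re_ofReal_mul, Complex.ofReal_re] at h3
  have h5 : ⟪(R * V) (g i), (ρ ^ u) ((R * V) (g i))⟫_ℂ = ⟪g i, (star V * ρ * V) (g i)⟫_ℂ := by
    rw [inner_conj_apply, mul_apply_eq_comp, inner_apply_eq_inner_apply hR0, ← mul_apply_eq_comp,
      ← mul_apply_eq_comp, mul_assoc, hRρ]
  rw [h5] at h3
  have h6 : y i ^ α = y i ^ (α - 1) * y i := by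
    conv_rhs => rw [← Real.rpow_one (y i), ← Real.rpow_mul (hy0 i), one_mul]
    rw [← Real.rpow_add_of_nonneg (hy0 i) (by linarith) zero_le_one]
    norm_num
  rw [h6]
  simp only [RCLike.re_eq_complex_re]
  linarith

/-- If `ρ ≤ c S` then `ρ = S^(u/2) Y S^(u/2)`, `u = (α-1)/α`, for an operator `Y` with
`Tr Y^α ≤ c^(u(α-1)) Tr ρ^(1+u) S^(-u)`; the right-hand trace is written in eigenbases. -/
theorem exists_sandwiched_schattenNorm_le (e : HilbertBasis ι ℂ H) (h : HilbertBasis κ ℂ H)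
    {ρ S : H →L[ℂ] H} (hρ : IsDensity ρ) (hS : 0 ≤ S) {c : ℝ} (hc : 0 ≤ c)
    (hle : ρ ≤ (c : ℂ) • S) {s : ι → ℝ} (hs : ∀ i, 0 ≤ s i)
    (hes : ∀ i, ρ (e i) = (s i : ℂ) • e i) {t : κ → ℝ} (ht : ∀ j, 0 ≤ t j)
    (hht : ∀ j, S (h j) = (t j : ℂ) • h j) {α : ℝ} (h1 : 1 < α) (h2 : α ≤ 2) {u : ℝ}
    (hu : u = (α - 1) / α) :
    ∃ Y : H →L[ℂ] H, S ^ (u / 2) * Y * S ^ (u / 2) = ρ ∧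
      schattenNorm α Y ≤ (ENNReal.ofReal (c ^ (u * (α - 1))) *
        ∑' j, ∑' i, ENNReal.ofReal (s i) ^ (1 + u) * ENNReal.ofReal (t j) ^ (-u) *
          overlap (e i) (h j)) ^ (1 / α) := by
  have hα0 : 0 < α := by linarith
  have hu0 : 0 < u := hu ▸ div_pos (by linarith) hα0
  have hu1 : u ≤ 1 := by rw [hu, div_le_one hα0]; linarith
  have hρ0 := hρ.1
  -- operator monotonicity of the power `u`
  have hmono : ρ ^ u ≤ ((c ^ u : ℝ) : ℂ) • S ^ u := by
    have := CFC.rpow_le_rpow (p := u) ⟨hu0.le, hu1⟩ hle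
    have h3 := smul_rpow_of_eigenbasis h hS hc ht hht zero_le_one hu0.le
    rw [CFC.rpow_one S hS, one_mul] at h3
    rwa [h3] at this
  have hbd : ∀ x, ‖(ρ ^ (u / 2)) x‖ ≤ √(c ^ u) * ‖(S ^ (u / 2)) x‖ := by
    intro x
    have := norm_rpow_half_apply_le (rpow_opNonneg _ _) (rpow_opNonneg _ _)
      (Real.rpow_nonneg hc u) hmono x
    rwa [rpow_rpow_of_eigenbasis e hρ0 hs hes hu0.le (by norm_num),
      rpow_rpow_of_eigenbasis h hS ht hht hu0.le (by norm_num), mul_one_div] at this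
  obtain ⟨V, hV, hVS, hV0⟩ := exists_factor_of_norm_le _ _ (Real.sqrt_nonneg _) hbd
  have hSV : ∀ x, (S ^ (u / 2)) (star V x) = (ρ ^ (u / 2)) x :=
    apply_adjoint_of_factor (rpow_opNonneg _ _) (rpow_opNonneg _ _) hVS
  refine ⟨star V * ρ ^ (1 - u) * V, ?_, ?_⟩
  · have hρρ : ρ ^ (u / 2) * (ρ ^ (1 - u) * ρ ^ (u / 2)) = ρ := by
      rw [← rpow_add_of_nonneg ρ (by linarith) (by linarith),
        ← rpow_add_of_nonneg ρ (by linarith) (by linarith)]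
      have : u / 2 + (1 - u + u / 2) = 1 := by ring
      rw [this, CFC.rpow_one ρ hρ0]
    ext x
    rw [mul_apply_eq_comp, mul_apply_eq_comp, mul_apply_eq_comp, mul_apply_eq_comp, hVS, hSV,
      ← mul_apply_eq_comp, ← mul_apply_eq_comp, mul_assoc, hρρ]
  have htr : trace (star V * ρ * V) = ∑' j, ∑' i,
      ENNReal.ofReal (s i) ^ (1 + u) * ENNReal.ofReal (t j) ^ (-u) * overlap (e i) (h j) := by
    rw [trace_eq_tsum h _ (conj_opNonneg hρ0 V)]
    congr 1; funext j
    rw [inner_conj_apply, ofReal_re_inner_eq_tsum e hρ0 hs hes]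
    congr 1; funext i
    have hh : ((t j ^ (u / 2) : ℝ) : ℂ) • V (h j) = (ρ ^ (u / 2)) (h j) := by
      rw [← map_smul, ← rpow_apply_eigenvector hS (by positivity) (hht j), hVS]
    have h3 := overlap_smul_right (t j ^ (u / 2)) (e i) (V (h j))
    rw [hh, overlap_eigenvector_apply (rpow_opNonneg _ _)
      (rpow_apply_eigenvector hρ0 (by positivity) (hes i)), ← Real.rpow_natCast,
      ← Real.rpow_natCast, ← Real.rpow_mul (hs i), ← Real.rpow_mul (ht j)] at h3
    have h4 : u / 2 * ((2 : ℕ) : ℝ) = u := by push_cast; ring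
    rw [h4, ← ENNReal.ofReal_rpow_of_nonneg (hs i) hu0.le,
      ← ENNReal.ofReal_rpow_of_nonneg (ht j) hu0.le] at h3
    rcases (ht j).eq_or_lt with htj | htj
    · have hV' : V (h j) = 0 := by
        refine hV0 _ fun x => ?_
        rw [inner_apply_eq_inner_apply (rpow_opNonneg _ _),
          rpow_apply_eigenvector hS (by positivity) (hht j), ← htj, Real.zero_rpow (by positivity)]
        simp
      rw [← htj, ENNReal.ofReal_zero, ENNReal.zero_rpow_of_pos hu0, zero_mul, mul_eq_zero,
        ENNReal.rpow_eq_zero_iff_of_pos hu0] at h3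
      rw [hV']
      rcases h3 with h3 | h3
      · rw [h3, ENNReal.zero_rpow_of_pos (by linarith)]; simp
      · rw [h3]; simp [overlap]
    · have hT0 : ENNReal.ofReal (t j) ≠ 0 := by simpa using htj
      have h5 : overlap (e i) (V (h j)) = ENNReal.ofReal (t j) ^ (-u) *
          (ENNReal.ofReal (s i) ^ u * overlap (e i) (h j)) := by
        rw [h3, ← mul_assoc, ← ENNReal.rpow_add _ _ hT0 ENNReal.ofReal_ne_top]
        simp
      rw [h5, ENNReal.rpow_add_of_nonneg _ _ zero_le_one hu0.le, ENNReal.rpow_one]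
      ring
  rw [schattenNorm_of_nonneg (conj_opNonneg (rpow_opNonneg _ _) V), ← htr]
  refine ENNReal.rpow_le_rpow ?_ (by positivity)
  have := trace_conj_rpow_le e hρ hs hes h1 h2 hu (Real.rpow_nonneg hc u) hV
  rwa [← Real.rpow_mul hc] at this

end SandwichedUpper


/-! ### Lower bound for the sandwiched norm -/

section SandwichedLower

variable {H : Type u} [NormedAddCommGroup H] [InnerProductSpace ℂ H] [CompleteSpace H]
variable {ι : Type v} {κ : Type w}

open scoped ComplexOrder in
/-- If `S Y S ≥ 0`, the compression of `Y` to the closure of the range of `S` is positive. -/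
theorem exists_compression_nonneg {S Y : H →L[ℂ] H} (hS : 0 ≤ S) (hY : 0 ≤ S * Y * S) :
    ∃ P : H →L[ℂ] H, ‖P‖ ≤ 1 ∧ (∀ x, P (S x) = S x) ∧ (∀ x, S (P x) = S x) ∧
      (∀ x y, ⟪P x, y⟫_ℂ = ⟪x, P y⟫_ℂ) ∧ 0 ≤ P * Y * P := by
  set M := S.range.topologicalClosure with hM
  have hMc : IsClosed (M : Set H) := S.range.isClosed_topologicalClosure
  have : CompleteSpace M := hMc.completeSpace_coe
  have hsym : ∀ x y, ⟪M.starProjection x, y⟫_ℂ = ⟪x, M.starProjection y⟫_ℂ :=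
    fun x y => Submodule.inner_starProjection_left_eq_right M x y
  have hPS : ∀ x, M.starProjection (S x) = S x := fun x =>
    Submodule.starProjection_eq_self_iff.2 (S.range.le_topologicalClosure ⟨x, rfl⟩)
  refine ⟨M.starProjection, Submodule.starProjection_norm_le M, hPS, ?_, hsym, ?_⟩
  · intro x
    refine ext_inner_left ℂ fun y => ?_
    rw [← inner_apply_eq_inner_apply hS, ← hsym, hPS, inner_apply_eq_inner_apply hS]
  · have hcl : ∀ y ∈ M, 0 ≤ ⟪Y y, y⟫_ℂ := by
      intro y hy
      have hclosed : IsClosed {y : H | 0 ≤ ⟪Y y, y⟫_ℂ} :=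
        isClosed_le continuous_const (Y.continuous.inner continuous_id)
      refine hclosed.closure_subset_iff.2 ?_ hy
      rintro _ ⟨x, rfl⟩
      have h1 := (ContinuousLinearMap.isPositive_iff_complex _).1 (isPositive_of_nonneg hY) x
      rw [mul_apply_eq_comp, mul_apply_eq_comp, inner_apply_eq_inner_apply hS] at h1
      have h2 : 0 ≤ ⟪Y (S x), S x⟫_ℂ := by
        rw [← h1.1]
        exact_mod_cast h1.2
      exact h2
    rw [ContinuousLinearMap.nonneg_iff_isPositive, ContinuousLinearMap.isPositive_iff_complex]
    intro x
    have h1 := hcl (M.starProjection x) (Submodule.starProjection_apply_mem M x)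
    rw [mul_apply_eq_comp, mul_apply_eq_comp, hsym]
    rw [Complex.nonneg_iff] at h1
    refine ⟨?_, h1.1⟩
    refine Complex.ext (by simp) ?_
    simpa using h1.2

/-- A singular value decomposition bounds the quadratic form. -/
theorem ofReal_re_inner_le_tsum (e : HilbertBasis ι ℂ H) {Y : H →L[ℂ] H} {v : ι → H} {y : ι → ℝ}
    (hy : ∀ i, 0 ≤ y i) (hYe : ∀ i, Y (e i) = (y i : ℂ) • v i) (r : H) :
    ENNReal.ofReal (RCLike.re ⟪r, Y r⟫_ℂ) ≤
      ∑' k, ENNReal.ofReal (y k) * ((overlap (e k) r + overlap (v k) r) / 2) := by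
  have h1 : HasSum (fun k => RCLike.re ⟪r, Y (e.repr r k • e k)⟫_ℂ) (RCLike.re ⟪r, Y r⟫_ℂ) := by
    have h := (e.hasSum_repr r).mapL Y
    exact RCLike.hasSum_re ℂ (h.mapL (innerSL ℂ r))
  have h2 : Filter.Tendsto (fun F : Finset ι => ENNReal.ofReal
      (∑ k ∈ F, RCLike.re ⟪r, Y (e.repr r k • e k)⟫_ℂ)) Filter.atTop
      (nhds (ENNReal.ofReal (RCLike.re ⟪r, Y r⟫_ℂ))) :=
    (ENNReal.continuous_ofReal.tendsto _).comp h1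
  refine le_of_tendsto' h2 fun F => ?_
  have hk : ∀ k, RCLike.re ⟪r, Y (e.repr r k • e k)⟫_ℂ ≤
      y k * ((‖⟪e k, r⟫_ℂ‖ ^ 2 + ‖⟪v k, r⟫_ℂ‖ ^ 2) / 2) := by
    intro k
    refine (RCLike.re_le_norm _).trans ?_
    rw [map_smul, hYe, inner_smul_right, inner_smul_right, norm_mul, norm_mul,
      HilbertBasis.repr_apply_apply, norm_inner_symm r (v k), Complex.norm_real, Real.norm_eq_abs,
      abs_of_nonneg (hy k)]
    have := two_mul_le_add_sq ‖⟪e k, r⟫_ℂ‖ ‖⟪v k, r⟫_ℂ‖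
    nlinarith [hy k, mul_le_mul_of_nonneg_left this (hy k)]
  calc ENNReal.ofReal (∑ k ∈ F, RCLike.re ⟪r, Y (e.repr r k • e k)⟫_ℂ)
      ≤ ENNReal.ofReal (∑ k ∈ F, y k * ((‖⟪e k, r⟫_ℂ‖ ^ 2 + ‖⟪v k, r⟫_ℂ‖ ^ 2) / 2)) :=
        ENNReal.ofReal_le_ofReal (Finset.sum_le_sum fun k _ => hk k)
    _ = ∑ k ∈ F, ENNReal.ofReal (y k) * ((overlap (e k) r + overlap (v k) r) / 2) := by
        rw [ENNReal.ofReal_sum_of_nonneg fun k _ => mul_nonneg (hy k) (by positivity)]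
        refine Finset.sum_congr rfl fun k _ => ?_
        rw [ENNReal.ofReal_mul (hy k), overlap_eq_ofReal, overlap_eq_ofReal,
          ← ENNReal.ofReal_add (by positivity) (by positivity), ENNReal.ofReal_div_of_pos two_pos]
        simp
    _ ≤ _ := ENNReal.sum_le_tsum F

theorem tsum_ofReal_eq_one {X : Type*} {s : X → ℝ} (hs : ∀ i, 0 ≤ s i) (hs1 : HasSum s 1) :
    ∑' i, ENNReal.ofReal (s i) = 1 := by
  rw [← ENNReal.ofReal_tsum_of_nonneg hs hs1.summable, hs1.tsum_eq]; simp

/-- Hölder's inequality for a doubly substochastic kernel `D`, with exponents `1/u` and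
`α = 1/(1-u)`. -/
theorem tsum_rpow_mul_le_of_substochastic {s : ι → ℝ} {y : κ → ℝ} (hs : ∀ i, 0 ≤ s i)
    (hy : ∀ k, 0 ≤ y k) {α u N : ℝ} (hα : 0 < α) (hu0 : 0 ≤ u) (hu1 : u ≤ 1)
    (huα : (1 - u) * α = 1) (hN : 0 ≤ N) (hs1 : HasSum s 1)
    (hyN : HasSum (fun k => y k ^ α) (N ^ α)) (D : ι → κ → ℝ≥0∞) (hD1 : ∀ i, ∑' k, D i k ≤ 1)
    (hD2 : ∀ k, ∑' i, D i k ≤ 1) :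
    ∑' i, ENNReal.ofReal (s i) ^ u * ∑' k, ENNReal.ofReal (y k) * D i k ≤ ENNReal.ofReal N := by
  rcases hN.eq_or_lt with hN | hN
  · rw [← hN, Real.zero_rpow hα.ne'] at hyN
    have h0 := (hasSum_zero_iff_of_nonneg fun k => Real.rpow_nonneg (hy k) α).1 hyN
    have h1 : ∀ k, y k = 0 := fun k => (Real.rpow_eq_zero (hy k) hα.ne').1 (congrFun h0 k)
    simp [h1]
  have hterm : ∀ i k, ENNReal.ofReal (s i) ^ u * ENNReal.ofReal (y k) ≤
      ENNReal.ofReal N * (ENNReal.ofReal u * ENNReal.ofReal (s i) +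
        ENNReal.ofReal (1 - u) * ENNReal.ofReal ((y k / N) ^ α)) := by
    intro i k
    rw [ENNReal.ofReal_rpow_of_nonneg (hs i) hu0, ← ENNReal.ofReal_mul (Real.rpow_nonneg (hs i) u),
      ← ENNReal.ofReal_mul hu0, ← ENNReal.ofReal_mul (by linarith),
      ← ENNReal.ofReal_add (mul_nonneg hu0 (hs i))
        (mul_nonneg (by linarith) (Real.rpow_nonneg (div_nonneg (hy k) hN.le) _)),
      ← ENNReal.ofReal_mul hN.le]
    refine ENNReal.ofReal_le_ofReal ?_
    have h1 := Real.geom_mean_le_arith_mean2_weighted hu0 (by linarith : 0 ≤ 1 - u) (hs i)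
      (Real.rpow_nonneg (div_nonneg (hy k) hN.le) α) (by ring)
    rw [← Real.rpow_mul (div_nonneg (hy k) hN.le), mul_comm α, huα, Real.rpow_one] at h1
    calc s i ^ u * y k = N * (s i ^ u * (y k / N)) := by field_simp
      _ ≤ _ := by gcongr
  have hY1 : ∑' k, ENNReal.ofReal ((y k / N) ^ α) = 1 := by
    have h2 : HasSum (fun k => (y k / N) ^ α) 1 := by
      have h3 := hyN.div_const (N ^ α)
      rw [div_self (Real.rpow_pos_of_pos hN α).ne'] at h3
      refine (congrArg (HasSum · (1 : ℝ)) (funext fun k => ?_)).mpr h3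
      rw [Real.div_rpow (hy k) hN.le]
    exact tsum_ofReal_eq_one (fun k => Real.rpow_nonneg (div_nonneg (hy k) hN.le) _) h2
  calc ∑' i, ENNReal.ofReal (s i) ^ u * ∑' k, ENNReal.ofReal (y k) * D i k
      = ∑' i, ∑' k, ENNReal.ofReal (s i) ^ u * ENNReal.ofReal (y k) * D i k := by
        simp_rw [← ENNReal.tsum_mul_left, mul_assoc]
    _ ≤ ∑' i, ∑' k, ENNReal.ofReal N * (ENNReal.ofReal u * ENNReal.ofReal (s i) +
        ENNReal.ofReal (1 - u) * ENNReal.ofReal ((y k / N) ^ α)) * D i k :=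
        ENNReal.tsum_le_tsum fun i => ENNReal.tsum_le_tsum fun k => by
          exact mul_le_mul_left (hterm i k) _
    _ = ENNReal.ofReal N * (ENNReal.ofReal u * (∑' i, ENNReal.ofReal (s i) * ∑' k, D i k) +
        ENNReal.ofReal (1 - u) * (∑' k, ENNReal.ofReal ((y k / N) ^ α) * ∑' i, D i k)) := by
        have hA : ∀ i k, ENNReal.ofReal N * (ENNReal.ofReal u * ENNReal.ofReal (s i) +
            ENNReal.ofReal (1 - u) * ENNReal.ofReal ((y k / N) ^ α)) * D i k =
            ENNReal.ofReal N * (ENNReal.ofReal u * (ENNReal.ofReal (s i) * D i k)) +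
            ENNReal.ofReal N * (ENNReal.ofReal (1 - u) *
              (ENNReal.ofReal ((y k / N) ^ α) * D i k)) := fun i k => by ring
        simp_rw [hA, ENNReal.tsum_add]
        rw [mul_add]
        congr 1
        · simp_rw [ENNReal.tsum_mul_left]
        · rw [ENNReal.tsum_comm]
          simp_rw [ENNReal.tsum_mul_left]
    _ ≤ ENNReal.ofReal N * (ENNReal.ofReal u * (∑' i, ENNReal.ofReal (s i) * 1) +
        ENNReal.ofReal (1 - u) * (∑' k, ENNReal.ofReal ((y k / N) ^ α) * 1)) := by
        gcongr with i k
        · exact hD1 i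
        · exact hD2 k
    _ = ENNReal.ofReal N := by
        simp_rw [mul_one]
        rw [tsum_ofReal_eq_one hs hs1, hY1, mul_one, mul_one, ← ENNReal.ofReal_add hu0 (by linarith)]
        simp

/-- If `S Y S = ρ` then `Tr ρ^(1+u) S^(-2) ≤ ‖Y‖_α` for `u = (α-1)/α`; the left-hand trace is
written in eigenbases. -/
theorem tsum_le_schattenNorm (e : HilbertBasis ι ℂ H) (h : HilbertBasis κ ℂ H)
    {ρ S Y : H →L[ℂ] H} (hρ : 0 ≤ ρ) (hS : 0 ≤ S) (hSY : S * Y * S = ρ) {s : ι → ℝ}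
    (hs : ∀ i, 0 ≤ s i) (hes : ∀ i, ρ (e i) = (s i : ℂ) • e i) (hs1 : HasSum s 1) {τ : κ → ℝ}
    (hhτ : ∀ j, S (h j) = (τ j : ℂ) • h j) {α : ℝ} (h1 : 1 < α) (h2 : α ≤ 2) {u : ℝ}
    (hu : u = (α - 1) / α) :
    ∑' i, ENNReal.ofReal (s i) ^ u * (ENNReal.ofReal (s i) *
      ∑' j, overlap (e i) (h j) / ENNReal.ofReal (τ j ^ 2)) ≤ schattenNorm α Y := by
  by_cases hfin : schattenNorm α Y = ∞
  · rw [hfin]; exact le_top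
  have hα0 : 0 < α := by linarith
  have hu0 : 0 < u := hu ▸ div_pos (by linarith) hα0
  have hu1 : u ≤ 1 := by rw [hu, div_le_one hα0]; linarith
  have huα : (1 - u) * α = 1 := by rw [hu]; field_simp; ring
  obtain ⟨l, g, v, y, hy, hv, hYg, hyN⟩ := exists_singularValues h1.le h2 hfin
  obtain ⟨P, hP1, hPS, hSP, hPsym, hZ⟩ := exists_compression_nonneg hS (Y := Y) (by rwa [hSY])
  have hZq : ∀ x, ⟪x, (P * Y * P) x⟫_ℂ = ⟪P x, Y (P x)⟫_ℂ := fun x => by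
    rw [mul_apply_eq_comp, mul_apply_eq_comp, hPsym]
  have hSZS : ∀ x, S ((P * Y * P) (S x)) = ρ x := fun x => by
    rw [mul_apply_eq_comp, mul_apply_eq_comp, hSP, hPS, ← hSY]; rfl
  generalize P * Y * P = Z at hZ hZq hSZS
  -- the equation `S Z S = ρ` yields a contraction `U` with `Z^(1/2) S = U ρ^(1/2)`; the vectors
  -- `P U eᵢ` then satisfy `⟨P U eᵢ, Y P U eᵢ⟩ ≥ sᵢ ‖S⁻¹ eᵢ‖²`
  have hZZ : ∀ x, (Z ^ (1 / 2 : ℝ)) ((Z ^ (1 / 2 : ℝ)) x) = Z x := fun x => by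
    rw [← mul_apply_eq_comp, ← rpow_add_of_nonneg Z (by norm_num) (by norm_num)]
    norm_num
    rw [CFC.rpow_one Z hZ]
  have hhalf : ∀ (R : H →L[ℂ] H), 0 ≤ R → ∀ x, ‖(R ^ (1 / 2 : ℝ)) x‖ ^ 2 = RCLike.re ⟪x, R x⟫_ℂ := by
    intro R hR x
    rw [← norm_sq_eq_re_inner_rpow_half (T := R) zero_le_one x, CFC.rpow_one R hR]
  have hiso : ∀ x, ‖(Z ^ (1 / 2 : ℝ) * S) x‖ ≤ 1 * ‖(ρ ^ (1 / 2 : ℝ)) x‖ := by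
    intro x
    have : ‖(Z ^ (1 / 2 : ℝ) * S) x‖ ^ 2 = ‖(ρ ^ (1 / 2 : ℝ)) x‖ ^ 2 := by
      rw [mul_apply_eq_comp, hhalf Z hZ, hhalf ρ hρ, inner_apply_eq_inner_apply hS, hSZS]
    rw [one_mul, (sq_eq_sq₀ (norm_nonneg _) (norm_nonneg _)).1 this]
  obtain ⟨U, hU1, hU, -⟩ := exists_factor_of_norm_le _ _ zero_le_one hiso
  have hrB : IsBessel fun i => P (U (e i)) := by
    have := e.orthonormal.isBessel.map (V := P * U)
      ((norm_mul_le _ _).trans (mul_le_one₀ hP1 (norm_nonneg _) hU1))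
    exact this
  have hrow : ∀ i, ENNReal.ofReal (s i) *
      ∑' j, overlap (e i) (h j) / ENNReal.ofReal (τ j ^ 2) ≤
      ∑' k, ENNReal.ofReal (y k) *
        ((overlap (g k) (P (U (e i))) + overlap (v k) (P (U (e i)))) / 2) := by
    intro i
    refine le_trans ?_ (ofReal_re_inner_le_tsum g hy hYg (P (U (e i))))
    rcases (hs i).eq_or_lt with hsi | hsi
    · rw [← hsi]; simp
    have hz : S ((Z ^ (1 / 2 : ℝ)) (U (e i))) = ((s i ^ (1 / 2 : ℝ) : ℝ) : ℂ) • e i := by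
      have hpos : ((s i ^ (1 / 2 : ℝ) : ℝ) : ℂ) ≠ 0 := by
        exact_mod_cast (Real.rpow_pos_of_pos hsi _).ne'
      have h3 := hU (e i)
      rw [rpow_apply_eigenvector hρ (by norm_num) (hes i), map_smul, mul_apply_eq_comp] at h3
      have h4 := congrArg (fun x => S ((Z ^ (1 / 2 : ℝ)) x)) h3
      simp only [map_smul] at h4
      rw [hZZ, hSZS, hes] at h4
      have h5 : (s i : ℂ) = ((s i ^ (1 / 2 : ℝ) : ℝ) : ℂ) * ((s i ^ (1 / 2 : ℝ) : ℝ) : ℂ) := by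
        rw [← Complex.ofReal_mul, ← Real.rpow_add hsi]; norm_num
      rw [h5, mul_smul] at h4
      exact smul_right_injective H hpos h4
    have h3 := tsum_overlap_div_le h hS hhτ hz
    rw [← hZq, ← hhalf Z hZ, ENNReal.ofReal_pow (norm_nonneg _), ofReal_norm]
    refine le_trans (le_of_eq ?_) h3
    rw [← ENNReal.tsum_mul_left]
    congr 1; funext j
    rw [overlap_smul_right, overlap_comm, mul_div_assoc]
    congr 2
    rw [← Real.rpow_natCast, ← Real.rpow_mul hsi.le]; norm_num
  have hN := tsum_rpow_mul_le_of_substochastic hs hy hα0 hu0.le hu1 huα ENNReal.toReal_nonneg hs1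
    hyN (fun i k => (overlap (g k) (P (U (e i))) + overlap (v k) (P (U (e i)))) / 2) ?_ ?_
  · rw [ENNReal.ofReal_toReal hfin] at hN
    refine le_trans (ENNReal.tsum_le_tsum fun i => ?_) hN
    gcongr
    exact hrow i
  all_goals
    have hsq : ∀ x : H, ‖x‖ ≤ 1 → ‖x‖ₑ ^ 2 ≤ 1 := fun x hx => by
      rw [← ofReal_norm, ← ENNReal.ofReal_pow (norm_nonneg _), ENNReal.ofReal_le_one]
      exact pow_le_one₀ (norm_nonneg _) hx
    have htwo : ((1 : ℝ≥0∞) + 1) / 2 = 1 := by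
      rw [one_add_one_eq_two]; exact ENNReal.div_self two_ne_zero ENNReal.ofNat_ne_top
    intro i
    simp_rw [ENNReal.div_eq_inv_mul, ENNReal.tsum_mul_left, ENNReal.tsum_add]
    rw [← ENNReal.div_eq_inv_mul, ← htwo]
    gcongr
  · exact (g.orthonormal.isBessel.tsum_overlap_le _).trans (hsq _ (hrB.norm_le_one i))
  · exact (hv.tsum_overlap_le _).trans (hsq _ (hrB.norm_le_one i))
  · simp_rw [overlap_comm (g i)]
    exact (hrB.tsum_overlap_le _).trans (hsq _ (g.orthonormal.norm_eq_one i).le)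
  · simp_rw [overlap_comm (v i)]
    exact (hrB.tsum_overlap_le _).trans (hsq _ (hv.norm_le_one i))

end SandwichedLower


/-! ### Relative entropy through joint spectral weights -/

section SpectralWeights

variable {H : Type u} [NormedAddCommGroup H] [InnerProductSpace ℂ H] [CompleteSpace H]
variable {ι : Type v} {κ : Type w}

theorem eigenProj_apply_eigenvector [DecidableEq ℝ] {T : H →L[ℂ] H} (hT : 0 ≤ T) {s t : ℝ} {x : H}
    (hx : T x = (s : ℂ) • x) : eigenProj T t x = if s = t then x else 0 := by
  unfold eigenProj
  split_ifs with h
  · refine Submodule.starProjection_eq_self_iff.2 ?_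
    rw [LinearMap.mem_ker]
    simp [hx, h]
  · rw [Submodule.starProjection_apply_eq_zero_iff, Submodule.mem_orthogonal]
    intro y hy
    have hy2 : T y = (t : ℂ) • y := by
      rw [LinearMap.mem_ker] at hy
      simpa [sub_eq_zero] using hy
    have h1 := inner_eigenvector_apply hT hy2 x
    rw [hx, inner_smul_right] at h1
    have h2 : ((s : ℂ) - t) * ⟪y, x⟫_ℂ = 0 := by rw [sub_mul, h1, sub_self]
    rcases mul_eq_zero.1 h2 with h3 | h3
    · exact absurd (by exact_mod_cast sub_eq_zero.1 h3) h
    · exact h3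

theorem eigenProj_symm (T : H →L[ℂ] H) (t : ℝ) (x y : H) :
    ⟪eigenProj T t x, y⟫_ℂ = ⟪x, eigenProj T t y⟫_ℂ :=
  Submodule.inner_starProjection_left_eq_right _ x y

theorem star_eigenProj (T : H →L[ℂ] H) (t : ℝ) : star (eigenProj T t) = eigenProj T t := by
  ext x
  refine ext_inner_left ℂ fun y => ?_
  rw [ContinuousLinearMap.star_eq_adjoint, ContinuousLinearMap.adjoint_inner_right, eigenProj_symm]

theorem eigenProj_mul_self (T : H →L[ℂ] H) (t : ℝ) :
    eigenProj T t * eigenProj T t = eigenProj T t :=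
  Submodule.isIdempotentElem_starProjection _

theorem eigenProj_nonneg (T : H →L[ℂ] H) (t : ℝ) : 0 ≤ eigenProj T t := by
  rw [← eigenProj_mul_self]
  nth_rw 2 [← star_eigenProj]
  exact mul_star_opNonneg _

/-- The weight `Tr[Q_t P_s Q_t]` of a pair of spectral values is the total overlap of the pairs of
eigenvectors belonging to it. -/
theorem trace_eigenProj (e : HilbertBasis ι ℂ H) (h : HilbertBasis κ ℂ H) {ρ S : H →L[ℂ] H}
    (hρ : 0 ≤ ρ) (hS : 0 ≤ S) {s : ι → ℝ} {t : κ → ℝ} (hes : ∀ i, ρ (e i) = (s i : ℂ) • e i)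
    (hht : ∀ j, S (h j) = (t j : ℂ) • h j) (p : ℝ × ℝ) :
    trace (eigenProj S p.2 * eigenProj ρ p.1 * eigenProj S p.2) =
      ∑' x : (fun x : ι × κ => (s x.1, t x.2)) ⁻¹' {p}, overlap (e x.1.1) (h x.1.2) := by
  classical
  have hpos : 0 ≤ eigenProj S p.2 * eigenProj ρ p.1 * eigenProj S p.2 := by
    have := conj_opNonneg (eigenProj_nonneg ρ p.1) (eigenProj S p.2)
    rwa [star_eigenProj] at this
  rw [trace_eq_tsum h _ hpos, tsum_subtype _ fun x : ι × κ => overlap (e x.1) (h x.2),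
    ENNReal.tsum_prod', ENNReal.tsum_comm]
  congr 1; funext j
  have h1 : RCLike.re ⟪h j, (eigenProj S p.2 * eigenProj ρ p.1 * eigenProj S p.2) (h j)⟫_ℂ =
      ‖eigenProj ρ p.1 (eigenProj S p.2 (h j))‖ ^ 2 := by
    rw [mul_apply_eq_comp, mul_apply_eq_comp, ← eigenProj_symm,
      ← inner_self_eq_norm_sq (𝕜 := ℂ), eigenProj_symm ρ, ← mul_apply_eq_comp (eigenProj ρ p.1) (eigenProj ρ p.1),
      eigenProj_mul_self]
  rw [h1, ENNReal.ofReal_pow (norm_nonneg _), ofReal_norm, ← tsum_overlap e]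
  congr 1; funext i
  rw [overlap, ← eigenProj_symm, eigenProj_apply_eigenvector hρ (hes i),
    eigenProj_apply_eigenvector hS (hht j)]
  by_cases hs : s i = p.1 <;> by_cases ht : t j = p.2 <;>
    simp [Set.indicator, hs, ht, overlap, Prod.ext_iff]

/-- The sum over pairs of spectral values defining the conditional entropy, rewritten as a sum over
pairs of eigenvectors. -/
theorem tsum_trace_eigenProj (e : HilbertBasis ι ℂ H) (h : HilbertBasis κ ℂ H) {ρ S : H →L[ℂ] H}
    (hρ : 0 ≤ ρ) (hS : 0 ≤ S) {s : ι → ℝ} {t : κ → ℝ} (hes : ∀ i, ρ (e i) = (s i : ℂ) • e i)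
    (hht : ∀ j, S (h j) = (t j : ℂ) • h j) (f : ℝ × ℝ → ℝ) {a : ℝ}
    (hf : HasSum (fun x : ι × κ => (overlap (e x.1) (h x.2)).toReal * f (s x.1, t x.2)) a) :
    ∑' p : ℝ × ℝ, (trace (eigenProj S p.2 * eigenProj ρ p.1 * eigenProj S p.2)).toReal * f p =
      a := by
  rw [← (hf.tsum_fiberwise fun x : ι × κ => (s x.1, t x.2)).tsum_eq]
  congr 1; funext p
  rw [trace_eigenProj e h hρ hS hes hht, ENNReal.tsum_toReal_eq fun _ => overlap_ne_top _ _,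
    ← tsum_mul_right]
  congr 1; funext x
  have := x.2
  simp only [Set.mem_preimage, Set.mem_singleton_iff] at this
  rw [this]

theorem hasSum_of_tsum_ofReal_le {X : Type*} {g : X → ℝ} (hg : ∀ x, 0 ≤ g x) {a : ℝ≥0∞}
    (ha : a ≠ ∞) (h : ∑' x, ENNReal.ofReal (g x) ≤ a) :
    HasSum g (∑' x, ENNReal.ofReal (g x)).toReal := by
  have hne : ∑' x, ENNReal.ofReal (g x) ≠ ∞ := ne_top_of_le_ne_top ha h
  have h1 := ENNReal.hasSum_toReal hne
  rw [← ENNReal.tsum_toReal_eq fun _ => ENNReal.ofReal_ne_top] at h1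
  simpa [ENNReal.toReal_ofReal, hg] using h1

/-- The spectral data of a state `ρ` relative to a positive operator `S ≥ ρ / c` of finite trace:
eigenbases of both. The joint spectral weights `|⟨eᵢ, hⱼ⟩|² sᵢ` form a probability distribution,
and the relative entropy of `ρ` with respect to `S` is the mean of `log sᵢ - log tⱼ`. -/
structure SpectralPair (ρ S : H →L[ℂ] H) (c : ℝ) (e : HilbertBasis ι ℂ H) (h : HilbertBasis κ ℂ H)
    (s : ι → ℝ) (t : κ → ℝ) : Prop where
  left_nonneg : 0 ≤ ρ
  right_nonneg : 0 ≤ S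
  const_nonneg : 0 ≤ c
  le : ρ ≤ (c : ℂ) • S
  s_nonneg : ∀ i, 0 ≤ s i
  t_nonneg : ∀ j, 0 ≤ t j
  left_apply : ∀ i, ρ (e i) = (s i : ℂ) • e i
  right_apply : ∀ j, S (h j) = (t j : ℂ) • h j
  hasSum_s : HasSum s 1
  summable_t : Summable t

variable {ρ S : H →L[ℂ] H} {c : ℝ} {e : HilbertBasis ι ℂ H} {h : HilbertBasis κ ℂ H} {s : ι → ℝ}
  {t : κ → ℝ}

/-- The joint spectral weight `|⟨eᵢ, hⱼ⟩|² sᵢ`. -/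
def spectralWeight (e : HilbertBasis ι ℂ H) (h : HilbertBasis κ ℂ H) (s : ι → ℝ) (x : ι × κ) : ℝ :=
  (overlap (e x.1) (h x.2)).toReal * s x.1

/-- The logarithmic likelihood ratio `log sᵢ - log tⱼ`. -/
def logRatio (s : ι → ℝ) (t : κ → ℝ) (x : ι × κ) : ℝ := Real.log (s x.1) - Real.log (t x.2)

namespace SpectralPair

theorem weight_nonneg (P : SpectralPair ρ S c e h s t) (x : ι × κ) : 0 ≤ spectralWeight e h s x :=
  mul_nonneg ENNReal.toReal_nonneg (P.s_nonneg _)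

theorem ofReal_weight (x : ι × κ) :
    ENNReal.ofReal (spectralWeight e h s x) = ENNReal.ofReal (s x.1) * overlap (e x.1) (h x.2) := by
  rw [spectralWeight, ENNReal.ofReal_mul ENNReal.toReal_nonneg,
    ENNReal.ofReal_toReal (overlap_ne_top _ _), mul_comm]

theorem hasSum_weight (P : SpectralPair ρ S c e h s t) : HasSum (spectralWeight e h s) 1 := by
  have h1 : ∑' x, ENNReal.ofReal (spectralWeight e h s x) = 1 := by
    simp_rw [ofReal_weight]
    rw [ENNReal.tsum_prod']
    simp_rw [ENNReal.tsum_mul_left, tsum_overlap_left, enorm_hilbertBasis]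
    simpa using tsum_ofReal_eq_one P.s_nonneg P.hasSum_s
  have := hasSum_of_tsum_ofReal_le P.weight_nonneg ENNReal.one_ne_top h1.le
  rwa [h1, ENNReal.toReal_one] at this

theorem tsum_overlap_div_le (P : SpectralPair ρ S c e h s t) (i : ι) :
    ∑' j, ENNReal.ofReal (s i) * (overlap (e i) (h j) / ENNReal.ofReal (t j)) ≤
      ENNReal.ofReal c := by
  have := tsum_overlap_div_le_of_le h P.left_nonneg P.right_nonneg P.const_nonneg P.le
    (P.s_nonneg i) (P.left_apply i) P.t_nonneg P.right_apply
  rwa [enorm_hilbertBasis, one_pow, mul_one] at this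

/-- The support of `ρ` is contained in that of `S`. -/
theorem pos_of_weight_ne_zero (P : SpectralPair ρ S c e h s t) {x : ι × κ}
    (hx : spectralWeight e h s x ≠ 0) : 0 < s x.1 ∧ 0 < t x.2 := by
  have hs : s x.1 ≠ 0 := fun h0 => hx (by rw [spectralWeight, h0, mul_zero])
  have hs' := (P.s_nonneg x.1).lt_of_ne' hs
  refine ⟨hs', (P.t_nonneg x.2).lt_of_ne' fun ht => hx ?_⟩
  have h1 := (ENNReal.le_tsum x.2).trans (P.tsum_overlap_div_le x.1)
  by_contra hne
  have ho : overlap (e x.1) (h x.2) ≠ 0 := fun h0 => hne (by rw [spectralWeight, h0]; simp)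
  rw [ht, ENNReal.ofReal_zero, ENNReal.div_zero ho, ENNReal.mul_top (by simpa using hs')] at h1
  exact absurd h1 (by simp)

/-- The trace `Tr ρ² S⁻¹` is at most `c`. -/
theorem summable_weight_mul_exp (P : SpectralPair ρ S c e h s t) :
    Summable fun x => spectralWeight e h s x * Real.exp (logRatio s t x) := by
  refine (hasSum_of_tsum_ofReal_le (a := ENNReal.ofReal c)
    (fun x => mul_nonneg (P.weight_nonneg x) (Real.exp_pos _).le) ENNReal.ofReal_ne_top ?_).summable
  calc ∑' x, ENNReal.ofReal (spectralWeight e h s x * Real.exp (logRatio s t x))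
      ≤ ∑' x : ι × κ, ENNReal.ofReal (s x.1) *
          (ENNReal.ofReal (s x.1) * (overlap (e x.1) (h x.2) / ENNReal.ofReal (t x.2))) := by
        refine ENNReal.tsum_le_tsum fun x => ?_
        by_cases hx : spectralWeight e h s x = 0
        · rw [hx]; simp
        obtain ⟨hs, ht⟩ := P.pos_of_weight_ne_zero hx
        rw [ENNReal.ofReal_mul (P.weight_nonneg x), ofReal_weight, logRatio, Real.exp_sub,
          Real.exp_log hs, Real.exp_log ht, ENNReal.ofReal_div_of_pos ht]
        simp only [div_eq_mul_inv]
        exact le_of_eq (by ring)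
    _ ≤ ∑' i, ENNReal.ofReal (s i) * ENNReal.ofReal c := by
        rw [ENNReal.tsum_prod']
        refine ENNReal.tsum_le_tsum fun i => ?_
        simp only
        rw [ENNReal.tsum_mul_left]
        gcongr
        exact P.tsum_overlap_div_le i
    _ = ENNReal.ofReal c := by
        rw [ENNReal.tsum_mul_right, tsum_ofReal_eq_one P.s_nonneg P.hasSum_s, one_mul]

/-- The first negative moment is at most `Tr S`. -/
theorem summable_weight_mul_exp_neg (P : SpectralPair ρ S c e h s t) :
    Summable fun x => spectralWeight e h s x * Real.exp (-logRatio s t x) := by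
  refine (hasSum_of_tsum_ofReal_le (a := ENNReal.ofReal (∑' j, t j))
    (fun x => mul_nonneg (P.weight_nonneg x) (Real.exp_pos _).le) ENNReal.ofReal_ne_top ?_).summable
  calc ∑' x, ENNReal.ofReal (spectralWeight e h s x * Real.exp (-logRatio s t x))
      ≤ ∑' x : ι × κ, ENNReal.ofReal (t x.2) * overlap (e x.1) (h x.2) := by
        refine ENNReal.tsum_le_tsum fun x => ?_
        by_cases hx : spectralWeight e h s x = 0
        · rw [hx]; simp
        obtain ⟨hs, ht⟩ := P.pos_of_weight_ne_zero hx
        have hs0 : ENNReal.ofReal (s x.1) ≠ 0 := by simpa using hs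
        rw [ENNReal.ofReal_mul (P.weight_nonneg x), ofReal_weight, logRatio, neg_sub,
          Real.exp_sub, Real.exp_log hs, Real.exp_log ht, ENNReal.ofReal_div_of_pos hs,
          mul_comm, ← mul_assoc, ENNReal.div_mul_cancel hs0 ENNReal.ofReal_ne_top]
    _ = ENNReal.ofReal (∑' j, t j) := by
        rw [ENNReal.tsum_prod', ENNReal.tsum_comm]
        simp_rw [ENNReal.tsum_mul_left, tsum_overlap, enorm_hilbertBasis]
        rw [ENNReal.ofReal_tsum_of_nonneg P.t_nonneg P.summable_t]
        simp

theorem summable_weight_mul_exp_abs (P : SpectralPair ρ S c e h s t) :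
    Summable fun x => spectralWeight e h s x * Real.exp |logRatio s t x| := by
  refine Summable.of_nonneg_of_le (fun x => mul_nonneg (P.weight_nonneg x) (Real.exp_pos _).le)
    (fun x => ?_) (P.summable_weight_mul_exp.add P.summable_weight_mul_exp_neg)
  rw [← mul_add]
  refine mul_le_mul_of_nonneg_left ?_ (P.weight_nonneg x)
  rcases abs_cases (logRatio s t x) with ⟨h1, -⟩ | ⟨h1, -⟩ <;> rw [h1]
  · linarith [Real.exp_pos (-logRatio s t x)]
  · linarith [Real.exp_pos (logRatio s t x)]

theorem summable_weight_mul_of_le (P : SpectralPair ρ S c e h s t) {f : ι × κ → ℝ}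
    (hf : ∀ x, |f x| ≤ Real.exp |logRatio s t x|) :
    Summable fun x => spectralWeight e h s x * f x := by
  refine Summable.of_norm_bounded P.summable_weight_mul_exp_abs fun x => ?_
  rw [Real.norm_eq_abs, abs_mul, abs_of_nonneg (P.weight_nonneg x)]
  exact mul_le_mul_of_nonneg_left (hf x) (P.weight_nonneg x)

theorem summable_weight_mul_logRatio (P : SpectralPair ρ S c e h s t) :
    Summable fun x => spectralWeight e h s x * logRatio s t x :=
  P.summable_weight_mul_of_le fun x => by linarith [Real.add_one_le_exp |logRatio s t x|]

/-- The moments `∑ p e^(u L)` of the weights `p` grow at most quadratically beyond the linear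
term, uniformly for small `u ≥ 0`. -/
theorem exists_moment_le (P : SpectralPair ρ S c e h s t) :
    ∃ M : ℝ, 0 ≤ M ∧ ∀ u : ℝ, 0 ≤ u → u ≤ 1 / 2 →
      Summable (fun x => spectralWeight e h s x * Real.exp (u * logRatio s t x)) ∧
      ∑' x, spectralWeight e h s x * Real.exp (u * logRatio s t x) ≤
        1 + u * (∑' x, spectralWeight e h s x * logRatio s t x) + u ^ 2 * M := by
  refine ⟨8 * ∑' x, spectralWeight e h s x * Real.exp |logRatio s t x|,
    mul_nonneg (by norm_num) (tsum_nonneg fun x => mul_nonneg (P.weight_nonneg x)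
      (Real.exp_pos _).le), fun u hu0 hu1 => ?_⟩
  have hsum : Summable (fun x => spectralWeight e h s x * Real.exp (u * logRatio s t x)) := by
    refine P.summable_weight_mul_of_le fun x => ?_
    rw [Real.abs_exp, Real.exp_le_exp]
    refine (le_abs_self _).trans ?_
    rw [abs_mul, abs_of_nonneg hu0]
    exact mul_le_of_le_one_left (abs_nonneg _) (by linarith)
  refine ⟨hsum, ?_⟩
  have hexp : ∀ y : ℝ, Real.exp y ≤ 1 + y + y ^ 2 * Real.exp |y| := by
    intro y
    -- `e^y - 1 ≤ y e^y`, applied to `y` and to `-y`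
    have h1 : Real.exp y - 1 ≤ y * Real.exp y := by
      have h2 := mul_le_mul_of_nonneg_right (Real.add_one_le_exp (-y)) (Real.exp_pos y).le
      rw [← Real.exp_add] at h2
      simp only [neg_add_cancel, Real.exp_zero] at h2
      linarith
    rcases le_total 0 y with hy | hy
    · rw [abs_of_nonneg hy]
      nlinarith [mul_le_mul_of_nonneg_left h1 hy, Real.add_one_le_exp y]
    · have h3 : 1 ≤ Real.exp |y| := Real.one_le_exp (abs_nonneg _)
      nlinarith [Real.add_one_le_exp y, mul_le_mul_of_nonneg_left h3 (sq_nonneg y)]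
  have hpt : ∀ x, Real.exp (u * logRatio s t x) ≤ 1 + u * logRatio s t x +
      u ^ 2 * (8 * Real.exp |logRatio s t x|) := by
    intro x
    set l := logRatio s t x
    refine (hexp _).trans ?_
    have h1 : |u * l| ≤ |l| / 2 := by
      rw [abs_mul, abs_of_nonneg hu0]
      nlinarith [abs_nonneg l]
    have h2 : l ^ 2 ≤ 8 * Real.exp (|l| / 2) := by
      have := Real.quadratic_le_exp_of_nonneg (x := |l| / 2) (by positivity)
      rw [← sq_abs l]
      nlinarith [abs_nonneg l]
    have h3 : l ^ 2 * Real.exp |u * l| ≤ 8 * Real.exp |l| := by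
      calc l ^ 2 * Real.exp |u * l| ≤ 8 * Real.exp (|l| / 2) * Real.exp (|l| / 2) := by
            gcongr
        _ = 8 * Real.exp |l| := by rw [mul_assoc, ← Real.exp_add, add_halves]
    have h4 := mul_le_mul_of_nonneg_left h3 (sq_nonneg u)
    nlinarith
  have hR : HasSum (fun x => spectralWeight e h s x +
      u * (spectralWeight e h s x * logRatio s t x) +
      u ^ 2 * (8 * (spectralWeight e h s x * Real.exp |logRatio s t x|)))
      (1 + u * (∑' x, spectralWeight e h s x * logRatio s t x) +
      u ^ 2 * (8 * ∑' x, spectralWeight e h s x * Real.exp |logRatio s t x|)) :=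
    (P.hasSum_weight.add (P.summable_weight_mul_logRatio.hasSum.mul_left u)).add
      ((P.summable_weight_mul_exp_abs.hasSum.mul_left 8).mul_left (u ^ 2))
  refine hasSum_le (fun x => ?_) hsum.hasSum hR
  have := mul_le_mul_of_nonneg_left (hpt x) (P.weight_nonneg x)
  nlinarith

theorem tsum_trace_eigenProj_eq (P : SpectralPair ρ S c e h s t) :
    ∑' p : ℝ × ℝ, (trace (eigenProj S p.2 * eigenProj ρ p.1 * eigenProj S p.2)).toReal *
      (p.1 * (Real.log p.1 - Real.log p.2)) = ∑' x, spectralWeight e h s x * logRatio s t x := by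
  refine tsum_trace_eigenProj e h P.left_nonneg P.right_nonneg P.left_apply P.right_apply
    (fun p => p.1 * (Real.log p.1 - Real.log p.2)) ?_
  refine (congrArg (HasSum · _) (funext fun x => ?_)).mpr P.summable_weight_mul_logRatio.hasSum
  rw [spectralWeight, logRatio, mul_assoc]

/-- The trace `Tr ρ^(1+u) S^(-u)` as a moment of the spectral weights. -/
theorem tsum_rpow_eq (P : SpectralPair ρ S c e h s t) {u : ℝ} (hu : 0 < u)
    (hsum : Summable fun x => spectralWeight e h s x * Real.exp (u * logRatio s t x)) :
    ∑' j, ∑' i, ENNReal.ofReal (s i) ^ (1 + u) * ENNReal.ofReal (t j) ^ (-u) *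
      overlap (e i) (h j) =
      ENNReal.ofReal (∑' x, spectralWeight e h s x * Real.exp (u * logRatio s t x)) := by
  rw [ENNReal.ofReal_tsum_of_nonneg (fun x => mul_nonneg (P.weight_nonneg x) (Real.exp_pos _).le)
    hsum, ENNReal.tsum_comm, ENNReal.tsum_prod']
  congr 1; funext i
  congr 1; funext j
  by_cases hx : spectralWeight e h s (i, j) = 0
  · rw [hx, zero_mul, ENNReal.ofReal_zero]
    have h1 := ofReal_weight (e := e) (h := h) (s := s) (i, j)
    rw [hx, ENNReal.ofReal_zero, eq_comm, mul_eq_zero] at h1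
    rcases h1 with h1 | h1 <;> simp only at h1 <;> rw [h1]
    · rw [ENNReal.zero_rpow_of_pos (by linarith)]; simp
    · simp
  · obtain ⟨hs, ht⟩ := P.pos_of_weight_ne_zero hx
    simp only at hs ht
    rw [ENNReal.ofReal_mul (P.weight_nonneg _), ofReal_weight, logRatio, mul_sub, Real.exp_sub,
      mul_comm u, mul_comm u, ← Real.rpow_def_of_pos hs, ← Real.rpow_def_of_pos ht,
      ENNReal.ofReal_rpow_of_pos hs, ENNReal.ofReal_rpow_of_pos ht, Real.rpow_add hs,
      Real.rpow_one, Real.rpow_neg ht.le, div_eq_mul_inv, ENNReal.ofReal_mul hs.le,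
      ENNReal.ofReal_mul (Real.rpow_nonneg hs.le _)]
    ring

end SpectralPair

end SpectralWeights


/-! ### Klein's inequality -/

section EntropyComparison

variable {K : Type u} [NormedAddCommGroup K] [InnerProductSpace ℂ K] [CompleteSpace K]
variable {ι : Type v} {κ : Type w}

/-- Klein's inequality: the entropy of a subnormalized state with eigenvalues `n` is at most its
cross entropy with respect to a state with eigenvalues `t`. -/
theorem tsum_negMulLog_add_le (g : HilbertBasis ι ℂ K) (f : HilbertBasis κ ℂ K) {n : ι → ℝ}
    {t : κ → ℝ} (hn : ∀ r, 0 ≤ n r) (hn1 : ∀ r, n r ≤ 1) (ht : ∀ q, 0 ≤ t q) (ht1 : ∀ q, t q ≤ 1)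
    (hsum : HasSum t 1) (hsupp : ∀ r q, t q = 0 → n r ≠ 0 → overlap (g r) (f q) = 0) :
    ∑' r, ENNReal.ofReal (Real.negMulLog (n r)) + ∑' r, ENNReal.ofReal (n r) ≤
      ∑' q, ∑' r, ENNReal.ofReal (n r) * overlap (g r) (f q) * ENNReal.ofReal (-Real.log (t q)) +
        1 := by
  have hterm : ∀ r q, (ENNReal.ofReal (Real.negMulLog (n r)) + ENNReal.ofReal (n r)) *
      overlap (g r) (f q) ≤
      ENNReal.ofReal (n r) * overlap (g r) (f q) * ENNReal.ofReal (-Real.log (t q)) +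
        ENNReal.ofReal (t q) * overlap (f q) (g r) := by
    intro r q
    rw [overlap_comm (f q)]
    rcases (hn r).eq_or_lt with h0 | h0
    · rw [← h0]; simp
    rcases (ht q).eq_or_lt with h1 | h1
    · rw [hsupp r q h1.symm h0.ne']; simp
    have h2 : Real.negMulLog (n r) + n r ≤ n r * -Real.log (t q) + t q := by
      have h3 := mul_le_mul_of_nonneg_left (Real.log_le_sub_one_of_pos (div_pos h1 h0)) h0.le
      rw [Real.log_div h1.ne' h0.ne', mul_sub, mul_sub, mul_div_cancel₀ _ h0.ne'] at h3
      rw [Real.negMulLog]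
      linarith
    have hl : 0 ≤ -Real.log (t q) := by linarith [Real.log_nonpos (ht q) (ht1 q)]
    have h4 := ENNReal.ofReal_le_ofReal h2
    rw [ENNReal.ofReal_add (Real.negMulLog_nonneg (hn r) (hn1 r)) (hn r),
      ENNReal.ofReal_add (mul_nonneg (hn r) hl) (ht q), ENNReal.ofReal_mul (hn r)] at h4
    refine (mul_le_mul_left h4 _).trans (le_of_eq ?_)
    ring
  calc ∑' r, ENNReal.ofReal (Real.negMulLog (n r)) + ∑' r, ENNReal.ofReal (n r)
      = ∑' r, ∑' q, (ENNReal.ofReal (Real.negMulLog (n r)) + ENNReal.ofReal (n r)) *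
          overlap (g r) (f q) := by
        simp_rw [ENNReal.tsum_mul_left, tsum_overlap_left, enorm_hilbertBasis]
        rw [← ENNReal.tsum_add]
        simp
    _ ≤ ∑' r, ∑' q, (ENNReal.ofReal (n r) * overlap (g r) (f q) *
          ENNReal.ofReal (-Real.log (t q)) + ENNReal.ofReal (t q) * overlap (f q) (g r)) :=
        ENNReal.tsum_le_tsum fun r => ENNReal.tsum_le_tsum fun q => hterm r q
    _ = _ := by
        rw [ENNReal.tsum_comm]
        simp_rw [ENNReal.tsum_add, ENNReal.tsum_mul_left, tsum_overlap_left, enorm_hilbertBasis,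
          one_pow, mul_one]
        rw [tsum_ofReal_eq_one ht hsum]

/-- If `ν ≤ σ`, the cross entropy of an eigenvector of `ν` with respect to `σ` is at most its
entropy. -/
theorem tsum_neg_log_le_negMulLog (f : HilbertBasis κ ℂ K) {ν σ : K →L[ℂ] K} (hν : 0 ≤ ν)
    (hσ : 0 ≤ σ) (hle : ν ≤ σ) {n : ℝ} (hn : 0 ≤ n) (hn1 : n ≤ 1) {g : K} (hg : ‖g‖ₑ = 1)
    (hνg : ν g = (n : ℂ) • g) {t : κ → ℝ} (ht : ∀ q, 0 ≤ t q) (ht1 : ∀ q, t q ≤ 1)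
    (hft : ∀ q, σ (f q) = (t q : ℂ) • f q) :
    ∑' q, ENNReal.ofReal n * overlap g (f q) * ENNReal.ofReal (-Real.log (t q)) ≤
      ENNReal.ofReal (Real.negMulLog n) := by
  rcases hn.eq_or_lt with h0 | h0
  · rw [← h0]; simp
  have hG := tsum_overlap_div_le_of_le f hν hσ zero_le_one (by simpa using hle) hn hνg ht hft
  rw [hg, ENNReal.ofReal_one, one_pow, mul_one] at hG
  have hl : 0 ≤ -Real.log n := by linarith [Real.log_nonpos hn hn1]
  have hterm : ∀ q, overlap g (f q) * ENNReal.ofReal (-Real.log (t q)) + overlap g (f q) ≤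
      overlap g (f q) * ENNReal.ofReal (-Real.log n) +
        ENNReal.ofReal n * (overlap g (f q) / ENNReal.ofReal (t q)) := by
    intro q
    by_cases ho : overlap g (f q) = 0
    · rw [ho]; simp
    rcases (ht q).eq_or_lt with h1 | h1
    · rw [← h1, ENNReal.ofReal_zero, ENNReal.div_zero ho, ENNReal.mul_top (by simpa using h0),
        add_top]
      exact le_top
    have h2 : -Real.log (t q) + 1 ≤ -Real.log n + n / t q := by
      have h3 := Real.log_le_sub_one_of_pos (div_pos h0 h1)
      rw [Real.log_div h0.ne' h1.ne'] at h3
      linarith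
    have h4 := ENNReal.ofReal_le_ofReal h2
    rw [ENNReal.ofReal_add (by linarith [Real.log_nonpos (ht q) (ht1 q)]) zero_le_one,
      ENNReal.ofReal_add hl (by positivity), ENNReal.ofReal_one,
      ENNReal.ofReal_div_of_pos h1] at h4
    calc _ = overlap g (f q) * (ENNReal.ofReal (-Real.log (t q)) + 1) := by ring
      _ ≤ _ := mul_le_mul_right h4 _
      _ = _ := by simp only [div_eq_mul_inv]; ring
  have hsum := ENNReal.tsum_le_tsum hterm
  rw [ENNReal.tsum_add, ENNReal.tsum_add, ENNReal.tsum_mul_right (a := ENNReal.ofReal (-Real.log n)),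
    tsum_overlap_left, hg, one_pow, one_mul] at hsum
  have h5 := (ENNReal.add_le_add_iff_right ENNReal.one_ne_top).1
    (hsum.trans (add_le_add_right hG _))
  simp_rw [mul_assoc]
  rw [ENNReal.tsum_mul_left, Real.negMulLog, neg_mul_comm, ENNReal.ofReal_mul hn]
  gcongr

theorem nonneg_of_eigenbasis (e : HilbertBasis ι ℂ K) {R : K →L[ℂ] K} {r : ι → ℝ}
    (hr : ∀ i, 0 ≤ r i) (her : ∀ i, R (e i) = (r i : ℂ) • e i) : 0 ≤ R := by
  rw [ContinuousLinearMap.nonneg_iff_isPositive, ContinuousLinearMap.isPositive_iff_complex]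
  intro x
  have h0 : ∀ i, ⟪R (e.repr x i • e i), x⟫_ℂ = ((r i * ‖⟪e i, x⟫_ℂ‖ ^ 2 : ℝ) : ℂ) := by
    intro i
    rw [map_smul, her, inner_smul_left, inner_smul_left, HilbertBasis.repr_apply_apply,
      Complex.conj_ofReal, mul_left_comm, RCLike.conj_mul]
    push_cast
    rfl
  have h1 : HasSum (fun i => ⟪x, R (e.repr x i • e i)⟫_ℂ) ⟪x, R x⟫_ℂ :=
    ((e.hasSum_repr x).mapL R).mapL (innerSL ℂ x)
  have h2 : HasSum (fun i => ((r i * ‖⟪e i, x⟫_ℂ‖ ^ 2 : ℝ) : ℂ)) ⟪x, R x⟫_ℂ := by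
    refine (congrArg (HasSum · _) (funext fun i => ?_)).mpr h1
    rw [← inner_conj_symm x, h0, Complex.conj_ofReal]
  have h3 : HasSum (fun i => r i * ‖⟪e i, x⟫_ℂ‖ ^ 2) (RCLike.re ⟪x, R x⟫_ℂ) := by
    refine (congrArg (HasSum · _) (funext fun i => ?_)).mpr (RCLike.hasSum_re ℂ h2)
    exact (Complex.ofReal_re _).symm
  have h4 : ((RCLike.re ⟪x, R x⟫_ℂ : ℝ) : ℂ) = ⟪x, R x⟫_ℂ :=
    (Complex.hasSum_ofReal.2 h3).unique h2
  have h5 : ⟪R x, x⟫_ℂ = ⟪x, R x⟫_ℂ := by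
    rw [← inner_conj_symm, ← h4, Complex.conj_ofReal]
  rw [h5]
  exact ⟨h4, h3.nonneg fun i => mul_nonneg (hr i) (by positivity)⟩

/-- The truncation of a positive operator to finitely many eigenvectors. -/
theorem exists_truncation [DecidableEq ι] (e : HilbertBasis ι ℂ K) {ρ : K →L[ℂ] K} {s : ι → ℝ}
    (hs : ∀ i, 0 ≤ s i) (hes : ∀ i, ρ (e i) = (s i : ℂ) • e i) (F : Finset ι) :
    ∃ M : K →L[ℂ] K, 0 ≤ M ∧ M ≤ ρ ∧
      ∀ i, M (e i) = ((if i ∈ F then s i else 0 : ℝ) : ℂ) • e i := by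
  have hM : ∀ i, (∑ j ∈ F, (s j : ℂ) • InnerProductSpace.rankOne ℂ (e j) (e j) : K →L[ℂ] K) (e i) =
      ((if i ∈ F then s i else 0 : ℝ) : ℂ) • e i := by
    intro i
    simp only [sum_apply, smul_apply, InnerProductSpace.rankOne_apply]
    simp_rw [orthonormal_iff_ite.1 e.orthonormal, ite_smul, one_smul, zero_smul, smul_ite,
      smul_zero]
    rw [Finset.sum_ite_eq' F i (fun j => (s j : ℂ) • e j)]
    split_ifs <;> simp
  refine ⟨_, nonneg_of_eigenbasis e (fun i => ?_) hM, ?_, hM⟩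
  · split_ifs
    · exact hs i
    · exact le_rfl
  · rw [← sub_nonneg]
    refine nonneg_of_eigenbasis e (r := fun i => s i - if i ∈ F then s i else 0) (fun i => ?_)
      fun i => ?_
    · split_ifs
      · simp
      · simpa using hs i
    · rw [sub_apply, hM, hes, ← sub_smul]
      push_cast
      rfl

end EntropyComparison

/-! ### Cross entropies of the marginal -/

section MarginalEntropy

variable {A : Type u} {B : Type v}
  [NormedAddCommGroup A] [InnerProductSpace ℂ A] [CompleteSpace A] [FiniteDimensional ℂ A]
  [NormedAddCommGroup B] [InnerProductSpace ℂ B] [CompleteSpace B]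

theorem ofReal_re_inner_partialTrace {ι m : Type*} [Fintype m] (b : OrthonormalBasis m ℂ A)
    (e : HilbertBasis ι ℂ (HTensor A B)) {M : HTensor A B →L[ℂ] HTensor A B} (hM : 0 ≤ M)
    {s : ι → ℝ} (hs : ∀ i, 0 ≤ s i) (hes : ∀ i, M (e i) = (s i : ℂ) • e i) (x : B) :
    ENNReal.ofReal (RCLike.re ⟪x, partialTrace M x⟫_ℂ) =
      ∑ a, ∑' i, ENNReal.ofReal (s i) * overlap (e i) (ketTensor (b a) x) := by
  rw [re_inner_partialTrace b, map_sum, ENNReal.ofReal_sum_of_nonneg fun a _ =>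
    (isPositive_of_nonneg hM).re_inner_nonneg_right _]
  exact Finset.sum_congr rfl fun a _ => ofReal_re_inner_eq_tsum e hM hs hes _

/-- The cross entropy with respect to `1 ⊗ σ` of finitely many eigenvectors of a bipartite state is
that of the marginal with respect to `σ`. -/
theorem sum_tsum_overlap_eq {ι m κ l : Type*} [Fintype m] [DecidableEq ι]
    (b : OrthonormalBasis m ℂ A) (e : HilbertBasis ι ℂ (HTensor A B)) (f : HilbertBasis κ ℂ B)
    (g : HilbertBasis l ℂ B) {M : HTensor A B →L[ℂ] HTensor A B} (hM : 0 ≤ M) {s : ι → ℝ}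
    (hs : ∀ i, 0 ≤ s i) (F : Finset ι)
    (hes : ∀ i, M (e i) = ((if i ∈ F then s i else 0 : ℝ) : ℂ) • e i) {n : l → ℝ}
    (hn : ∀ r, 0 ≤ n r) (hgn : ∀ r, partialTrace M (g r) = (n r : ℂ) • g r) (c : κ → ℝ≥0∞) :
    ∑ i ∈ F, ENNReal.ofReal (s i) *
      ∑' p : m × κ, overlap (e i) (ketTensor (b p.1) (f p.2)) * c p.2 =
      ∑' q, ∑' r, ENNReal.ofReal (n r) * overlap (g r) (f q) * c q := by
  have hfib : ∀ q, ∑ i ∈ F, ENNReal.ofReal (s i) * ∑ a, overlap (e i) (ketTensor (b a) (f q)) =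
      ∑' r, ENNReal.ofReal (n r) * overlap (g r) (f q) := by
    intro q
    rw [← ofReal_re_inner_eq_tsum g (partialTrace_nonneg hM) hn hgn (f q),
      ofReal_re_inner_partialTrace b e hM
        (s := fun i => if i ∈ F then s i else 0) (fun i => ?_) hes]
    · simp_rw [Finset.mul_sum]
      rw [Finset.sum_comm]
      refine Finset.sum_congr rfl fun a _ => ?_
      rw [tsum_eq_sum (s := F) fun i hi => by simp [hi]]
      refine Finset.sum_congr rfl fun i hi => ?_
      simp [hi]
    · split_ifs
      · exact hs i
      · exact le_rfl
  calc ∑ i ∈ F, ENNReal.ofReal (s i) *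
      ∑' p : m × κ, overlap (e i) (ketTensor (b p.1) (f p.2)) * c p.2
      = ∑ i ∈ F, ∑' q, ENNReal.ofReal (s i) *
          (∑ a, overlap (e i) (ketTensor (b a) (f q))) * c q := by
        refine Finset.sum_congr rfl fun i _ => ?_
        rw [ENNReal.tsum_prod', ENNReal.tsum_comm, ← ENNReal.tsum_mul_left]
        congr 1; funext q
        rw [tsum_fintype (L := .unconditional m), Finset.mul_sum, Finset.mul_sum, Finset.sum_mul]
        exact Finset.sum_congr rfl fun a _ => by ring
    _ = ∑' q, ∑ i ∈ F, ENNReal.ofReal (s i) *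
          (∑ a, overlap (e i) (ketTensor (b a) (f q))) * c q :=
        (Summable.tsum_finsetSum fun _ _ => ENNReal.summable).symm
    _ = _ := by
        congr 1; funext q
        rw [← Finset.sum_mul, hfib, ENNReal.tsum_mul_right]

/-- Finite-truncation form of the inequality `-Tr ρ_B log ρ_B ≤ -Tr ρ_B log σ_B`: for a finite set
of eigenvectors of `ρ`, with error term the missing mass `1 - ∑ sᵢ`. It avoids the entropy of `ρ_B`,
which may be infinite. -/
theorem sum_crossEntropy_le {ι m κ κ' : Type*} [Fintype m]
    (b : OrthonormalBasis m ℂ A) (e : HilbertBasis ι ℂ (HTensor A B)) (f : HilbertBasis κ ℂ B)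
    (f' : HilbertBasis κ' ℂ B) {ρ : HTensor A B →L[ℂ] HTensor A B} (hρ : IsDensity ρ) {s : ι → ℝ}
    (hs : ∀ i, 0 ≤ s i) (hes : ∀ i, ρ (e i) = (s i : ℂ) • e i) (hs1 : HasSum s 1) {t : κ → ℝ}
    (ht : ∀ q, 0 ≤ t q) (ht1 : HasSum t 1) {t' : κ' → ℝ} (ht' : ∀ q, 0 ≤ t' q)
    (ht1' : HasSum t' 1) (hft' : ∀ q, partialTrace ρ (f' q) = (t' q : ℂ) • f' q)
    (hsupp : ∀ i a q, t q = 0 → s i ≠ 0 → overlap (e i) (ketTensor (b a) (f q)) = 0)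
    (F : Finset ι) :
    ∑ i ∈ F, ENNReal.ofReal (s i) * (∑' p : m × κ', overlap (e i) (ketTensor (b p.1) (f' p.2)) *
        ENNReal.ofReal (-Real.log (t' p.2))) + ∑ i ∈ F, ENNReal.ofReal (s i) ≤
      ∑ i ∈ F, ENNReal.ofReal (s i) * (∑' p : m × κ, overlap (e i) (ketTensor (b p.1) (f p.2)) *
        ENNReal.ofReal (-Real.log (t p.2))) + 1 := by
  classical
  obtain ⟨M, hM0, hMρ, hMe⟩ := exists_truncation e hs hes F
  have hν0 := partialTrace_nonneg hM0
  have htr : trace (partialTrace M) = ∑ i ∈ F, ENNReal.ofReal (s i) := by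
    rw [trace_partialTrace hM0, trace_eq_tsum_eigenvalues e hM0 hMe,
      tsum_eq_sum (s := F) fun i hi => by simp [hi]]
    exact Finset.sum_congr rfl fun i hi => by simp [hi]
  have htr1 : trace (partialTrace M) ≤ 1 := by
    rw [htr, ← tsum_ofReal_eq_one hs hs1]
    exact ENNReal.sum_le_tsum F
  obtain ⟨l, g, n, hn, hgn⟩ := exists_eigenbasis hν0
    (isCompactOperator_of_trace_rpow_ne_top hν0 zero_lt_one one_le_two (by
      rw [CFC.rpow_one _ hν0]; exact ne_top_of_le_ne_top ENNReal.one_ne_top htr1))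
  have hntr := trace_eq_tsum_eigenvalues g hν0 hgn
  have hn1 : ∀ r, n r ≤ 1 := by
    intro r
    have := (ENNReal.le_tsum r).trans (hntr ▸ htr1)
    simpa using this
  rw [sum_tsum_overlap_eq b e f' g hM0 hs F hMe hn hgn fun q => ENNReal.ofReal (-Real.log (t' q)),
    sum_tsum_overlap_eq b e f g hM0 hs F hMe hn hgn fun q => ENNReal.ofReal (-Real.log (t q)), ← htr, hntr]
  refine le_trans ?_ (tsum_negMulLog_add_le g f hn hn1 ht (fun q => le_hasSum ht1 q fun j _ => ht j)
    ht1 ?_)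
  · gcongr
    rw [ENNReal.tsum_comm]
    exact ENNReal.tsum_le_tsum fun r => tsum_neg_log_le_negMulLog f' hν0 hρ.partialTrace.1
      (partialTrace_mono hMρ) (hn r) (hn1 r) (enorm_hilbertBasis g r) (hgn r) ht'
      (fun q => le_hasSum ht1' q fun j _ => ht' j) hft'
  · intro r q htq hnr
    -- the diagonal entry of the marginal at `f q` vanishes
    have h1 := sum_tsum_overlap_eq b e f g hM0 hs F hMe hn hgn (Pi.single q 1)
    have h2 : ∑ i ∈ F, ENNReal.ofReal (s i) * ∑' p : m × κ,
        overlap (e i) (ketTensor (b p.1) (f p.2)) * (Pi.single q 1 : κ → ℝ≥0∞) p.2 = 0 := by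
      refine Finset.sum_eq_zero fun i _ => ?_
      by_cases hsi : s i = 0
      · rw [hsi]; simp
      rw [ENNReal.tsum_eq_zero.2 fun p => ?_, mul_zero]
      by_cases hp : p.2 = q
      · rw [hsupp i p.1 p.2 (hp ▸ htq) hsi, zero_mul]
      · simp [hp]
    rw [h2, eq_comm, ENNReal.tsum_eq_zero] at h1
    have h3 := ENNReal.tsum_eq_zero.1 (h1 q) r
    simp only [Pi.single_eq_same, mul_one, mul_eq_zero, ENNReal.ofReal_eq_zero] at h3
    exact h3.resolve_left fun h4 => hnr (le_antisymm h4 (hn r))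

end MarginalEntropy


/-! ### Rényi and von Neumann conditional entropies -/

section EntropyBounds

variable {A : Type u} {B : Type v}
  [NormedAddCommGroup A] [InnerProductSpace ℂ A] [CompleteSpace A] [FiniteDimensional ℂ A]
  [NormedAddCommGroup B] [InnerProductSpace ℂ B] [CompleteSpace B]

/-- A bipartite state `ρ_{AB}` and the operator `1 ⊗ ρ_B` form a spectral pair, because `ρ_{AB} ≤
|A| 1 ⊗ ρ_B`. -/
theorem exists_spectralPair {ρ : HTensor A B →L[ℂ] HTensor A B} (hρ : IsDensity ρ) :
    ∃ (ι : Type (max u v)) (κ : Type v) (e : HilbertBasis ι ℂ (HTensor A B))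
      (f : HilbertBasis κ ℂ B) (g : HilbertBasis (Fin (Module.finrank ℂ A) × κ) ℂ (HTensor A B))
      (s : ι → ℝ) (t : κ → ℝ),
      SpectralPair ρ (opTensor (1 : A →L[ℂ] A) (partialTrace ρ)) (Module.finrank ℂ A) e g s
        (fun p => t p.2) ∧
      (∀ p, g p = ketTensor (stdOrthonormalBasis ℂ A p.1) (f p.2)) ∧ (∀ q, 0 ≤ t q) ∧
      HasSum t 1 ∧ ∀ q, partialTrace ρ (f q) = (t q : ℂ) • f q := by
  obtain ⟨ι, e, s, hs, hes, hs1⟩ := hρ.exists_eigenbasis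
  obtain ⟨κ, f, t, ht, hft, ht1⟩ := hρ.partialTrace.exists_eigenbasis
  obtain ⟨g, hg⟩ := exists_tensorBasis (stdOrthonormalBasis ℂ A).toHilbertBasis f
  have hg' : ∀ p, g p = ketTensor (stdOrthonormalBasis ℂ A p.1) (f p.2) := fun p => by
    rw [hg, OrthonormalBasis.coe_toHilbertBasis]
  refine ⟨ι, κ, e, f, g, s, t, ⟨hρ.1, opTensor_one_nonneg hρ.partialTrace.1, Nat.cast_nonneg _, ?_,
    hs, fun p => ht p.2, hes, fun p => ?_, hs1, ?_⟩, hg', ht, ht1, hft⟩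
  · have := le_card_smul_opTensor_partialTrace hρ.1
    rwa [← Complex.coe_smul] at this
  · rw [hg', opTensor_one_apply_eigenvector (hft p.2)]
  · refine (summable_prod_of_nonneg fun p => ht p.2).2 ⟨fun a => ht1.summable, ?_⟩
    exact (hasSum_fintype _).summable

theorem condEntropy_eq_neg_tsum {ι κ : Type*} {ρ : HTensor A B →L[ℂ] HTensor A B} {c : ℝ}
    {e : HilbertBasis ι ℂ (HTensor A B)} {g : HilbertBasis κ ℂ (HTensor A B)} {s : ι → ℝ}
    {t : κ → ℝ}
    (P : SpectralPair ρ (opTensor (1 : A →L[ℂ] A) (partialTrace ρ)) c e g s t) :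
    condEntropy ρ = -∑' x, spectralWeight e g s x * logRatio s t x := by
  rw [condEntropy, P.tsum_trace_eigenProj_eq]

/-- Elementary facts on `u = (α-1)/α`, the reciprocal of the conjugate exponent of `α`. -/
theorem one_sub_inv_bounds {α : ℝ} (h1 : 1 < α) (h2 : α ≤ 2) :
    0 < (α - 1) / α ∧ (α - 1) / α ≤ 1 / 2 ∧ 1 / α = 1 - (α - 1) / α ∧
      α - 1 = (α - 1) / α * α := by
  have hα : 0 < α := by linarith
  refine ⟨div_pos (by linarith) hα, ?_, ?_, ?_⟩
  · rw [div_le_div_iff₀ hα two_pos]; linarith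
  · field_simp; ring
  · field_simp

/-- Near `α = 1` the sandwiched Rényi entropy is at least the conditional entropy, up to an error
linear in `(α-1)/α`. -/
theorem exists_sandwichedNorm_le {ρ : HTensor A B →L[ℂ] HTensor A B} (hρ : IsDensity ρ) :
    ∃ K : ℝ, ∀ α : ℝ, 1 < α → α ≤ 2 → sandwichedNorm α ρ ≤
      ENNReal.ofReal (Real.exp ((α - 1) / α * (-condEntropy ρ + K * ((α - 1) / α)))) := by
  obtain ⟨ι, κ, e, f, g, s, t, P, hg, ht, ht1, hft⟩ := exists_spectralPair hρ
  obtain ⟨M, hM0, hM⟩ := P.exists_moment_le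
  have hD := condEntropy_eq_neg_tsum P
  set D := ∑' x, spectralWeight e g s x * logRatio s (fun p : _ × κ => t p.2) x
  set d : ℝ := (Module.finrank ℂ A : ℝ) with hd
  have hd0 : 0 ≤ d := Nat.cast_nonneg _
  refine ⟨Real.log d + |D| + M, fun α h1 h2 => ?_⟩
  obtain ⟨hu0, hu1, huα, huα'⟩ := one_sub_inv_bounds h1 h2
  set u := (α - 1) / α with hu
  have hα0 : 0 < α := by linarith
  obtain ⟨hsum, hQ⟩ := hM u hu0.le hu1
  obtain ⟨Y, hY, hYn⟩ := exists_sandwiched_schattenNorm_le e g hρ P.right_nonneg hd0 P.le P.s_nonneg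
    P.left_apply P.t_nonneg P.right_apply h1 h2 hu
  rw [P.tsum_rpow_eq hu0 hsum] at hYn
  rw [opTensor_one_rpow hρ.partialTrace (by positivity)] at hY
  have hu2 : u / 2 = (α - 1) / (2 * α) := by rw [hu, div_div, mul_comm]
  rw [hu2] at hY
  have hle : sandwichedNorm α ρ ≤ schattenNorm α Y :=
    iInf₂_le_of_le _ hρ.partialTrace (iInf₂_le_of_le Y hY le_rfl)
  refine hle.trans (hYn.trans ?_)
  have hQ0 : 0 ≤ ∑' x, spectralWeight e g s x * Real.exp (u * logRatio s (fun p => t p.2) x) :=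
    tsum_nonneg fun x => mul_nonneg (P.weight_nonneg x) (Real.exp_pos _).le
  have hdpow : d ^ (u * (α - 1)) ≤ Real.exp (u * (α - 1) * Real.log d) := by
    have hx : 0 < u * (α - 1) := mul_pos hu0 (by linarith)
    rcases hd0.eq_or_lt with h0 | h0
    · rw [← h0, Real.zero_rpow hx.ne']; exact (Real.exp_pos _).le
    · rw [Real.rpow_def_of_pos h0, mul_comm]
  have hQexp := hQ.trans (show 1 + u * D + u ^ 2 * M ≤ Real.exp (u * D + u ^ 2 * M) by
    linarith [Real.add_one_le_exp (u * D + u ^ 2 * M)])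
  rw [← ENNReal.ofReal_mul (Real.rpow_nonneg hd0 _),
    ENNReal.ofReal_rpow_of_nonneg (mul_nonneg (Real.rpow_nonneg hd0 _) hQ0) (by positivity)]
  refine ENNReal.ofReal_le_ofReal ?_
  calc _ ≤ (Real.exp (u * (α - 1) * Real.log d) * Real.exp (u * D + u ^ 2 * M)) ^ (1 / α) := by
        gcongr
    _ = Real.exp ((u * (α - 1) * Real.log d + (u * D + u ^ 2 * M)) * (1 / α)) := by
        rw [← Real.exp_add, ← Real.exp_mul]
    _ ≤ _ := by
        rw [Real.exp_le_exp, hD, neg_neg]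
        have e1 : u * (α - 1) * Real.log d * (1 / α) = u ^ 2 * Real.log d := by
          rw [huα']; field_simp
        have e2 : (u * D + u ^ 2 * M) * (1 / α) ≤ u * D + u ^ 2 * (|D| + M) := by
          rw [huα]
          have := neg_abs_le D
          have h3 : 0 ≤ u ^ 2 * (|D| + D) := mul_nonneg (sq_nonneg _) (by linarith)
          have h4 : 0 ≤ u * (u ^ 2 * M) := by positivity
          nlinarith
        rw [add_mul, e1]
        linarith

/-- Convexity of the exponential along a probability distribution: `∑ w e^x ≥ e^m (1 + x̄ - m)` for
the mean `x̄` of `x = u (l + T)`. -/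
theorem summable_and_exp_mul_le {X : Type*} {w T : X → ℝ} (hw : ∀ x, 0 ≤ w x) (hw1 : HasSum w 1)
    (hT : ∀ x, 0 ≤ T x) {u : ℝ} (hu : 0 < u) (l m : ℝ)
    (hsum : Summable fun x => w x * Real.exp (u * (l + T x))) :
    Summable (fun x => w x * T x) ∧
      Real.exp m * (1 - m + u * l + u * ∑' x, w x * T x) ≤
        ∑' x, w x * Real.exp (u * (l + T x)) := by
  have hs : Summable (fun x => w x * T x) := by
    have h1 : Summable fun x => w x * (u * T x) := by
      refine Summable.of_nonneg_of_le (fun x => mul_nonneg (hw x) (mul_nonneg hu.le (hT x)))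
        (fun x => ?_) (hsum.add (hw1.summable.mul_right |u * l|))
      rw [← mul_add]
      refine mul_le_mul_of_nonneg_left ?_ (hw x)
      linarith [Real.add_one_le_exp (u * (l + T x)), neg_abs_le (u * l)]
    refine (h1.mul_left u⁻¹).congr fun x => ?_
    field_simp
  refine ⟨hs, ?_⟩
  have h1 : HasSum (fun x => Real.exp m * ((1 - m + u * l) * w x + u * (w x * T x)))
      (Real.exp m * ((1 - m + u * l) * 1 + u * ∑' x, w x * T x)) :=
    ((hw1.mul_left _).add (hs.hasSum.mul_left u)).mul_left _
  have h2 := hasSum_le (fun x => ?_) h1 hsum.hasSum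
  · rwa [mul_one] at h2
  · have h3 := mul_le_mul_of_nonneg_left (Real.add_one_le_exp (u * (l + T x) - m))
      (Real.exp_pos m).le
    rw [← Real.exp_add, add_sub_cancel] at h3
    have h4 := mul_le_mul_of_nonneg_left h3 (hw x)
    linarith

/-- One eigenvector's contribution to `Tr ρ^(1+u) σ^(-u)`: bounded below through the cross entropy. -/
theorem row_bound {H : Type u} [NormedAddCommGroup H] [InnerProductSpace ℂ H] [CompleteSpace H]
    {κ : Type*} (g : HilbertBasis κ ℂ H) {e : H} (he : ‖e‖ₑ = 1) {s : ℝ} (hs : 0 < s) {t : κ → ℝ}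
    (ht : ∀ p, 0 ≤ t p) (ht1 : ∀ p, t p ≤ 1) {u : ℝ} (hu : 0 < u) (m : ℝ)
    (hfin : ENNReal.ofReal s ^ u * (ENNReal.ofReal s *
      ∑' p, overlap e (g p) / ENNReal.ofReal ((t p ^ (u / 2)) ^ 2)) ≠ ∞) :
    (∀ p, t p = 0 → overlap e (g p) = 0) ∧
    Summable (fun p => (overlap e (g p)).toReal * -Real.log (t p)) ∧
    Real.exp m * (s * (1 - m + u * Real.log s +
      u * ∑' p, (overlap e (g p)).toReal * -Real.log (t p))) ≤
      (ENNReal.ofReal s ^ u * (ENNReal.ofReal s *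
        ∑' p, overlap e (g p) / ENNReal.ofReal ((t p ^ (u / 2)) ^ 2))).toReal := by
  have hs0 : ENNReal.ofReal s ≠ 0 := by simpa using hs
  have hsu0 : ENNReal.ofReal s ^ u ≠ 0 := by
    rw [Ne, ENNReal.rpow_eq_zero_iff_of_pos hu]; exact hs0
  have hsum : ∑' p, overlap e (g p) / ENNReal.ofReal ((t p ^ (u / 2)) ^ 2) ≠ ∞ := by
    intro h
    rw [h, ENNReal.mul_top hs0, ENNReal.mul_top hsu0] at hfin
    exact hfin rfl
  have hsupp : ∀ p, t p = 0 → overlap e (g p) = 0 := by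
    intro p hp
    by_contra hne
    have h1 := ENNReal.ne_top_of_tsum_ne_top hsum p
    rw [hp, Real.zero_rpow (by positivity)] at h1
    simp [ENNReal.div_zero hne] at h1
  have hterm : ∀ p, ENNReal.ofReal s ^ u * (overlap e (g p) /
      ENNReal.ofReal ((t p ^ (u / 2)) ^ 2)) = ENNReal.ofReal ((overlap e (g p)).toReal *
        Real.exp (u * (Real.log s + -Real.log (t p)))) := by
    intro p
    rcases (ht p).eq_or_lt with h0 | h0
    · rw [hsupp p h0.symm]; simp
    have h1 : (t p ^ (u / 2)) ^ 2 = t p ^ u := by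
      rw [← Real.rpow_natCast, ← Real.rpow_mul (ht p)]; congr 1; push_cast; ring
    rw [h1, ← sub_eq_add_neg, mul_sub, Real.exp_sub, mul_comm u, mul_comm u,
      ← Real.rpow_def_of_pos hs, ← Real.rpow_def_of_pos h0,
      ENNReal.ofReal_mul ENNReal.toReal_nonneg, ENNReal.ofReal_toReal (overlap_ne_top _ _),
      ENNReal.ofReal_div_of_pos (Real.rpow_pos_of_pos h0 u), ENNReal.ofReal_rpow_of_pos hs]
    simp only [div_eq_mul_inv]
    ring
  have htot : ENNReal.ofReal s ^ u * (ENNReal.ofReal s *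
      ∑' p, overlap e (g p) / ENNReal.ofReal ((t p ^ (u / 2)) ^ 2)) =
      ENNReal.ofReal s * ∑' p, ENNReal.ofReal ((overlap e (g p)).toReal *
        Real.exp (u * (Real.log s + -Real.log (t p)))) := by
    simp_rw [← hterm]
    rw [ENNReal.tsum_mul_left]
    ring
  have hne : ∑' p, ENNReal.ofReal ((overlap e (g p)).toReal *
      Real.exp (u * (Real.log s + -Real.log (t p)))) ≠ ∞ := by
    intro h
    rw [htot, h, ENNReal.mul_top hs0] at hfin
    exact hfin rfl
  have hS := hasSum_of_tsum_ofReal_le (fun p => mul_nonneg ENNReal.toReal_nonneg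
    (Real.exp_pos _).le) hne le_rfl
  obtain ⟨h1, h2⟩ := summable_and_exp_mul_le (fun p => ENNReal.toReal_nonneg)
    (hasSum_overlap_toReal g he)
    (fun p => by linarith [Real.log_nonpos (ht p) (ht1 p)]) hu (Real.log s) m hS.summable
  refine ⟨hsupp, h1, ?_⟩
  rw [htot, ENNReal.toReal_mul, ENNReal.toReal_ofReal hs.le, ← hS.tsum_eq]
  calc _ = s * (Real.exp m * (1 - m + u * Real.log s +
      u * ∑' p, (overlap e (g p)).toReal * -Real.log (t p))) := by ring
    _ ≤ _ := mul_le_mul_of_nonneg_left h2 hs.le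

theorem ofReal_mul_tsum_overlap {H : Type u} [NormedAddCommGroup H] [InnerProductSpace ℂ H]
    [CompleteSpace H] {κ : Type*} {g : κ → H} {e : H} {s : ℝ} (hs : 0 ≤ s) {t : κ → ℝ} (ht : ∀ p, 0 ≤ t p)
    (ht1 : ∀ p, t p ≤ 1)
    (hsum : 0 < s → Summable (fun p => (overlap e (g p)).toReal * -Real.log (t p))) :
    ENNReal.ofReal s * ∑' p, overlap e (g p) * ENNReal.ofReal (-Real.log (t p)) =
      ENNReal.ofReal (s * ∑' p, (overlap e (g p)).toReal * -Real.log (t p)) := by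
  rcases hs.eq_or_lt with h0 | h0
  · rw [← h0]; simp
  have hl : ∀ p, 0 ≤ -Real.log (t p) := fun p => by linarith [Real.log_nonpos (ht p) (ht1 p)]
  rw [ENNReal.ofReal_mul hs, ENNReal.ofReal_tsum_of_nonneg
    (fun p => mul_nonneg ENNReal.toReal_nonneg (hl p)) (hsum h0)]
  congr 2; funext p
  rw [ENNReal.ofReal_mul ENNReal.toReal_nonneg, ENNReal.ofReal_toReal (overlap_ne_top _ _)]

namespace SpectralPair

variable {H : Type u} [NormedAddCommGroup H] [InnerProductSpace ℂ H] [CompleteSpace H]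
variable {ι : Type v} {κ : Type w}
variable {ρ S : H →L[ℂ] H} {c : ℝ} {e : HilbertBasis ι ℂ H} {h : HilbertBasis κ ℂ H} {s : ι → ℝ}
  {t : κ → ℝ}

theorem summable_neg_log (P : SpectralPair ρ S c e h s t) {i : ι} (hi : 0 < s i) :
    Summable fun j => (overlap (e i) (h j)).toReal * -Real.log (t j) := by
  have h1 := P.summable_weight_mul_logRatio.prod_factor i
  have h2 := (hasSum_overlap_toReal h (enorm_hilbertBasis e i)).summable.mul_right (Real.log (s i))
  refine ((h1.mul_left (s i)⁻¹).sub h2).congr fun j => ?_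
  rw [spectralWeight, logRatio]
  field_simp
  ring

/-- The part of the relative entropy contributed by the eigenvector `e i`, split into `sᵢ log sᵢ` and
a cross entropy. The sums over `i` of the two parts may diverge separately. -/
theorem tsum_row (P : SpectralPair ρ S c e h s t) (i : ι) :
    ∑' j, spectralWeight e h s (i, j) * logRatio s t (i, j) =
      s i * Real.log (s i) + s i * ∑' j, (overlap (e i) (h j)).toReal * -Real.log (t j) := by
  rcases (P.s_nonneg i).eq_or_lt with h0 | h0
  · simp [spectralWeight, ← h0]
  have h1 := ((hasSum_overlap_toReal h (enorm_hilbertBasis e i)).mul_right (s i * Real.log (s i))).add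
    ((P.summable_neg_log h0).hasSum.mul_left (s i))
  rw [one_mul] at h1
  rw [← h1.tsum_eq]
  congr 1; funext j
  rw [spectralWeight, logRatio]
  ring

end SpectralPair

/-- The sandwiched Rényi entropy is at most the conditional entropy, in multiplicative form. -/
theorem exp_neg_condEntropy_le_schattenNorm {ρ Y : HTensor A B →L[ℂ] HTensor A B}
    (hρ : IsDensity ρ) {σ : B →L[ℂ] B} (hσ : IsDensity σ) {α : ℝ} (h1 : 1 < α) (h2 : α ≤ 2)
    (hY : opTensor (1 : A →L[ℂ] A) (σ ^ ((α - 1) / (2 * α))) * Y *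
      opTensor (1 : A →L[ℂ] A) (σ ^ ((α - 1) / (2 * α))) = ρ) :
    ENNReal.ofReal (Real.exp ((α - 1) / α * -condEntropy ρ)) ≤ schattenNorm α Y := by
  by_cases hfin : schattenNorm α Y = ∞
  · rw [hfin]; exact le_top
  obtain ⟨ι, κ', e, f', g', s, t', P, hg', ht', ht1', hft'⟩ := exists_spectralPair hρ
  have hD := condEntropy_eq_neg_tsum P
  rw [hD, neg_neg]
  set D := ∑' x, spectralWeight e g' s x * logRatio s (fun p : _ × κ' => t' p.2) x with hDdef
  obtain ⟨hu0, hu1, huα, -⟩ := one_sub_inv_bounds h1 h2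
  set u := (α - 1) / α with hu
  have hu2 : (α - 1) / (2 * α) = u / 2 := by rw [hu, div_div, mul_comm]
  rw [hu2] at hY
  obtain ⟨κ, f, t, ht, hft, ht1⟩ := hσ.exists_eigenbasis
  obtain ⟨g, hg⟩ := exists_tensorBasis (stdOrthonormalBasis ℂ A).toHilbertBasis f
  have hg2 : ∀ p, g p = ketTensor (stdOrthonormalBasis ℂ A p.1) (f p.2) := fun p => by
    rw [hg, OrthonormalBasis.coe_toHilbertBasis]
  have hE2 := tsum_le_schattenNorm e g hρ.1 (opTensor_one_nonneg (rpow_opNonneg σ (u / 2))) hY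
    P.s_nonneg P.left_apply P.hasSum_s (τ := fun p => t p.2 ^ (u / 2)) (fun p => by
      rw [hg2, opTensor_one_apply_eigenvector
        (rpow_apply_eigenvector hσ.1 (by positivity) (hft p.2))]) h1 h2 hu
  have hle1 : ∀ q, t q ≤ 1 := fun q => le_hasSum ht1 q fun j _ => ht j
  have hle1' : ∀ q, t' q ≤ 1 := fun q => le_hasSum ht1' q fun j _ => ht' j
  set G : ι → ℝ≥0∞ := fun i => ENNReal.ofReal (s i) ^ u * (ENNReal.ofReal (s i) *
      ∑' p : _ × κ, overlap (e i) (g p) / ENNReal.ofReal ((t p.2 ^ (u / 2)) ^ 2)) with hG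
  have hGfin : ∀ i, G i ≠ ∞ := fun i =>
    ne_top_of_le_ne_top hfin ((ENNReal.le_tsum i).trans hE2)
  -- at `m = u D` the convexity estimate is tight: the bounds sum up to `e^(u D)`
  have hrow : ∀ i, 0 < s i → _ := fun i hi => row_bound g (enorm_hilbertBasis e i) hi
    (fun p => ht p.2) (fun p => hle1 p.2) hu0 (u * D) (hGfin i)
  set W : ι → ℝ := fun i => ∑' p : _ × κ, (overlap (e i) (g p)).toReal * -Real.log (t p.2) with hW
  set V : ι → ℝ := fun i => ∑' p : _ × κ', (overlap (e i) (g' p)).toReal * -Real.log (t' p.2)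
    with hV
  have hWnn : ∀ i, 0 ≤ s i * W i := fun i => mul_nonneg (P.s_nonneg i) (tsum_nonneg fun p =>
    mul_nonneg ENNReal.toReal_nonneg (by linarith [Real.log_nonpos (ht p.2) (hle1 p.2)]))
  have hVnn : ∀ i, 0 ≤ s i * V i := fun i => mul_nonneg (P.s_nonneg i) (tsum_nonneg fun p =>
    mul_nonneg ENNReal.toReal_nonneg (by linarith [Real.log_nonpos (ht' p.2) (hle1' p.2)]))
  have hcross : ∀ F : Finset ι, ∑ i ∈ F, s i * V i + ∑ i ∈ F, s i ≤ ∑ i ∈ F, s i * W i + 1 := by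
    intro F
    have h3 := sum_crossEntropy_le (stdOrthonormalBasis ℂ A) e f f' hρ P.s_nonneg P.left_apply
      P.hasSum_s ht ht1 ht' ht1' hft' (fun i a q htq hsi => by
        have := (hrow i ((P.s_nonneg i).lt_of_ne' hsi)).1 (a, q) htq
        rwa [hg2] at this) F
    simp_rw [← hg2, ← hg'] at h3
    rw [Finset.sum_congr rfl fun i _ => ofReal_mul_tsum_overlap (P.s_nonneg i) (fun p => ht' p.2)
        (fun p => hle1' p.2) (fun hi => P.summable_neg_log hi),
      Finset.sum_congr rfl fun i _ => ofReal_mul_tsum_overlap (P.s_nonneg i) (fun p => ht p.2)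
        (fun p => hle1 p.2) (fun hi => (hrow i hi).2.1),
      ← ENNReal.ofReal_sum_of_nonneg fun i _ => hVnn i,
      ← ENNReal.ofReal_sum_of_nonneg fun i _ => hWnn i,
      ← ENNReal.ofReal_sum_of_nonneg fun i _ => P.s_nonneg i, ← ENNReal.ofReal_one,
      ← ENNReal.ofReal_add (Finset.sum_nonneg fun i _ => hVnn i)
        (Finset.sum_nonneg fun i _ => P.s_nonneg i),
      ← ENNReal.ofReal_add (Finset.sum_nonneg fun i _ => hWnn i) zero_le_one] at h3
    exact (ENNReal.ofReal_le_ofReal_iff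
      (add_nonneg (Finset.sum_nonneg fun i _ => hWnn i) zero_le_one)).1 h3
  have hfinite : ∀ F : Finset ι, Real.exp (u * D) * ((1 - u * D) * ∑ i ∈ F, s i +
      u * (∑ i ∈ F, ∑' p, spectralWeight e g' s (i, p) * logRatio s (fun p => t' p.2) (i, p)) +
      u * (∑ i ∈ F, s i - 1)) ≤ (schattenNorm α Y).toReal := by
    intro F
    have h3 : ∑ i ∈ F, (G i).toReal ≤ (schattenNorm α Y).toReal := by
      rw [← ENNReal.toReal_sum fun i _ => hGfin i]
      exact ENNReal.toReal_mono hfin ((ENNReal.sum_le_tsum F).trans hE2)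
    refine le_trans ?_ h3
    calc _ ≤ ∑ i ∈ F, Real.exp (u * D) * (s i * (1 - u * D + u * Real.log (s i) + u * W i)) := by
          rw [← Finset.mul_sum]
          refine mul_le_mul_of_nonneg_left ?_ (Real.exp_pos _).le
          simp_rw [P.tsum_row]
          have h4 : ∑ i ∈ F, s i * (1 - u * D + u * Real.log (s i) + u * W i) =
              (1 - u * D) * ∑ i ∈ F, s i + u * ∑ i ∈ F, s i * Real.log (s i) +
                u * ∑ i ∈ F, s i * W i := by
            simp_rw [Finset.mul_sum, ← Finset.sum_add_distrib]
            exact Finset.sum_congr rfl fun i _ => by ring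
          rw [h4, Finset.sum_add_distrib]
          have h5 := mul_le_mul_of_nonneg_left (hcross F) hu0.le
          linarith
      _ ≤ _ := by
          refine Finset.sum_le_sum fun i _ => ?_
          rcases (P.s_nonneg i).eq_or_lt with h0 | h0
          · rw [← h0, zero_mul, mul_zero]; exact ENNReal.toReal_nonneg
          · exact (hrow i h0).2.2
  -- as `F` grows, the missing mass `1 - ∑ sᵢ` tends to zero
  have hDsum : HasSum (fun i => ∑' p, spectralWeight e g' s (i, p) *
      logRatio s (fun p => t' p.2) (i, p)) D :=
    P.summable_weight_mul_logRatio.hasSum.prod_fiberwise fun i =>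
      (P.summable_weight_mul_logRatio.prod_factor i).hasSum
  have hs1 : Filter.Tendsto (fun F : Finset ι => ∑ i ∈ F, s i) Filter.atTop (nhds 1) := P.hasSum_s
  have hlim := ((((hs1.const_mul (1 - u * D)).add (hDsum.const_mul u)).add
    ((hs1.sub_const 1).const_mul u)).const_mul (Real.exp (u * D)))
  have hfinal := le_of_tendsto' hlim hfinite
  have h6 : Real.exp (u * D) * ((1 - u * D) * 1 + u * D + u * (1 - 1)) = Real.exp (u * D) := by
    ring
  rw [h6] at hfinal
  rw [← ENNReal.ofReal_toReal hfin]
  exact ENNReal.ofReal_le_ofReal hfinal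

theorem exp_neg_condEntropy_le_sandwichedNorm {ρ : HTensor A B →L[ℂ] HTensor A B}
    (hρ : IsDensity ρ) {α : ℝ} (h1 : 1 < α) (h2 : α ≤ 2) :
    ENNReal.ofReal (Real.exp ((α - 1) / α * -condEntropy ρ)) ≤ sandwichedNorm α ρ :=
  le_iInf₂ fun _ hσ => le_iInf₂ fun _ hY => exp_neg_condEntropy_le_schattenNorm hρ hσ h1 h2 hY

end EntropyBounds


/-! ### Rényi entropies near order one -/

section RenyiLimit

variable {A : Type u} {B : Type v}
  [NormedAddCommGroup A] [InnerProductSpace ℂ A] [CompleteSpace A] [FiniteDimensional ℂ A]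
  [NormedAddCommGroup B] [InnerProductSpace ℂ B] [CompleteSpace B]

theorem sandwichedNorm_ne_top {ρ : HTensor A B →L[ℂ] HTensor A B} (hρ : IsDensity ρ) {α : ℝ}
    (h1 : 1 < α) (h2 : α ≤ 2) : sandwichedNorm α ρ ≠ ∞ := by
  obtain ⟨K, hK⟩ := exists_sandwichedNorm_le hρ
  exact ne_top_of_le_ne_top ENNReal.ofReal_ne_top (hK α h1 h2)

theorem sandwichedNorm_ne_zero {ρ : HTensor A B →L[ℂ] HTensor A B} (hρ : IsDensity ρ) {α : ℝ}
    (h1 : 1 < α) (h2 : α ≤ 2) : sandwichedNorm α ρ ≠ 0 := fun h0 => by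
  have h := exp_neg_condEntropy_le_sandwichedNorm hρ h1 h2
  rw [h0, nonpos_iff_eq_zero, ENNReal.ofReal_eq_zero] at h
  exact absurd (Real.exp_pos _) h.not_gt

theorem toReal_sandwichedNorm_pos {ρ : HTensor A B →L[ℂ] HTensor A B} (hρ : IsDensity ρ) {α : ℝ}
    (h1 : 1 < α) (h2 : α ≤ 2) : 0 < (sandwichedNorm α ρ).toReal :=
  ENNReal.toReal_pos (sandwichedNorm_ne_zero hρ h1 h2) (sandwichedNorm_ne_top hρ h1 h2)

theorem mul_sandwichedCondEntropy (ρ : HTensor A B →L[ℂ] HTensor A B) {α : ℝ} (h1 : 1 < α) :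
    (α - 1) / α * sandwichedCondEntropy α ρ = -Real.log (sandwichedNorm α ρ).toReal := by
  have h3 : α - 1 ≠ 0 := by linarith
  have h4 : α ≠ 0 := by linarith
  rw [sandwichedCondEntropy, if_neg h1.ne']
  field_simp

/-- `H*_α ≤ H`. -/
theorem mul_sandwichedCondEntropy_le {ρ : HTensor A B →L[ℂ] HTensor A B} (hρ : IsDensity ρ)
    {α : ℝ} (h1 : 1 < α) (h2 : α ≤ 2) :
    (α - 1) / α * sandwichedCondEntropy α ρ ≤ (α - 1) / α * condEntropy ρ := by
  rw [mul_sandwichedCondEntropy ρ h1, neg_le, ← mul_neg,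
    Real.le_log_iff_exp_le (toReal_sandwichedNorm_pos hρ h1 h2)]
  have h := ENNReal.toReal_mono (sandwichedNorm_ne_top hρ h1 h2)
    (exp_neg_condEntropy_le_sandwichedNorm hρ h1 h2)
  rwa [ENNReal.toReal_ofReal (Real.exp_pos _).le] at h

/-- `H*_α ≥ H - K (α-1)/α`, with a constant independent of `α`. -/
theorem exists_le_mul_sandwichedCondEntropy {ρ : HTensor A B →L[ℂ] HTensor A B}
    (hρ : IsDensity ρ) : ∃ K : ℝ, ∀ α : ℝ, 1 < α → α ≤ 2 →
      (α - 1) / α * (condEntropy ρ - K * ((α - 1) / α)) ≤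
        (α - 1) / α * sandwichedCondEntropy α ρ := by
  obtain ⟨K, hK⟩ := exists_sandwichedNorm_le hρ
  refine ⟨K, fun α h1 h2 => ?_⟩
  have h := ENNReal.toReal_mono ENNReal.ofReal_ne_top (hK α h1 h2)
  rw [ENNReal.toReal_ofReal (Real.exp_pos _).le] at h
  rw [mul_sandwichedCondEntropy ρ h1, le_neg, ← mul_neg,
    Real.log_le_iff_le_exp (toReal_sandwichedNorm_pos hρ h1 h2)]
  have e : -(condEntropy ρ - K * ((α - 1) / α)) = -condEntropy ρ + K * ((α - 1) / α) := by ring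
  rwa [e]

/-- On the zero space the trace vanishes, so there are no states. -/
theorem nonempty_of_isDensity {ι : Type*} [Fintype ι] (b : OrthonormalBasis ι ℂ A)
    {ρ : HTensor A B →L[ℂ] HTensor A B} (hρ : IsDensity ρ) : Nonempty ι := by
  by_contra h
  rw [not_nonempty_iff] at h
  have h0 : Module.finrank ℂ A = 0 := by
    rw [Module.finrank_eq_card_basis b.toBasis, Fintype.card_eq_zero]
  have h1 := le_card_smul_opTensor_partialTrace hρ.1
  rw [h0, Nat.cast_zero, zero_smul] at h1
  have h2 := trace_mono h1
  rw [hρ.2] at h2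
  simp [trace] at h2

end RenyiLimit

/-! ### The decoupling bound in terms of entropies -/

section DecouplingBound

variable {A : Type u} {C : Type v} {E : Type w}
  [NormedAddCommGroup A] [InnerProductSpace ℂ A] [CompleteSpace A] [FiniteDimensional ℂ A]
  [NormedAddCommGroup C] [InnerProductSpace ℂ C] [CompleteSpace C]
  [TopologicalSpace.SeparableSpace C]
  [NormedAddCommGroup E] [InnerProductSpace ℂ E] [CompleteSpace E]
  [TopologicalSpace.SeparableSpace E]

/-- The infimum over both reference states of the bound for fixed ones. The sandwiched norms are
positive and finite, so that one may divide by them in `[0, ∞]`. -/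
theorem lintegral_decouplingOp_le_sandwichedNorm {ι : Type*} [Fintype ι] [Nonempty ι]
    [DecidableEq ι] (b : OrthonormalBasis ι ℂ A) {ω : HTensor A C →L[ℂ] HTensor A C}
    {ρ : HTensor A E →L[ℂ] HTensor A E} (hω : IsDensity ω) (hρ : IsDensity ρ) {α : ℝ}
    (h1 : 1 < α) (h2 : α ≤ 2) :
    ∫⁻ U : unitary (A →L[ℂ] A), schattenNorm 1 (decouplingOp b ω ρ (U : A →L[ℂ] A))
      ∂haarUnitary A ≤ ENNReal.ofReal (2 * (3 : ℝ) ^ (-((α - 1) / α))) *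
        sandwichedNorm α ω * sandwichedNorm α ρ := by
  have hC0 : (0 : ℝ) < 2 * (3 : ℝ) ^ (-((α - 1) / α)) := by positivity
  set I := ∫⁻ U : unitary (A →L[ℂ] A), schattenNorm 1 (decouplingOp b ω ρ (U : A →L[ℂ] A))
      ∂haarUnitary A
  set c := ENNReal.ofReal (2 * (3 : ℝ) ^ (-((α - 1) / α))) with hc
  have hc0 : c ≠ 0 := by simpa [hc] using hC0
  have hct : c ≠ ∞ := ENNReal.ofReal_ne_top
  have hpos : ∀ {x : ℝ≥0∞} {r : ℝ}, ENNReal.ofReal (Real.exp r) ≤ x → x ≠ 0 := by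
    intro x r h h0
    rw [h0, nonpos_iff_eq_zero, ENNReal.ofReal_eq_zero] at h
    exact absurd (Real.exp_pos _) h.not_gt
  have hmain : I / (c * sandwichedNorm α ω) ≤ sandwichedNorm α ρ := by
    refine le_iInf₂ fun σ₂ hσ₂ => le_iInf₂ fun Y₂ hY₂ => ?_
    by_cases hfin₂ : schattenNorm α Y₂ = ∞
    · rw [hfin₂]; exact le_top
    have hY₂0 : schattenNorm α Y₂ ≠ 0 :=
      hpos (exp_neg_condEntropy_le_schattenNorm hρ hσ₂ h1 h2 hY₂)
    have h3 : I / (c * schattenNorm α Y₂) ≤ sandwichedNorm α ω := by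
      refine le_iInf₂ fun σ₁ hσ₁ => le_iInf₂ fun Y₁ hY₁ => ?_
      by_cases hfin₁ : schattenNorm α Y₁ = ∞
      · rw [hfin₁]; exact le_top
      refine ENNReal.div_le_of_le_mul ?_
      refine (lintegral_schattenNorm_decouplingOp_le b hσ₁ hσ₂ h1 h2 hY₁ hfin₁ hY₂ hfin₂).trans
        (le_of_eq ?_)
      rw [ENNReal.ofReal_mul hC0.le, ENNReal.ofReal_mul ENNReal.toReal_nonneg,
        ENNReal.ofReal_toReal hfin₁, ENNReal.ofReal_toReal hfin₂]
      ring
    refine ENNReal.div_le_of_le_mul ?_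
    rw [ENNReal.div_le_iff (mul_ne_zero hc0 hY₂0) (ENNReal.mul_ne_top hct hfin₂)] at h3
    exact h3.trans (le_of_eq (by ring))
  rw [ENNReal.div_le_iff (mul_ne_zero hc0 (sandwichedNorm_ne_zero hω h1 h2))
    (ENNReal.mul_ne_top hct (sandwichedNorm_ne_top hω h1 h2))] at hmain
  exact hmain.trans (le_of_eq (by ring))

/-- The decoupling bound for `α > 1`. -/
theorem half_lintegral_decouplingOp_le {ι : Type*} [Fintype ι] [Nonempty ι] [DecidableEq ι]
    (b : OrthonormalBasis ι ℂ A) {ω : HTensor A C →L[ℂ] HTensor A C}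
    {ρ : HTensor A E →L[ℂ] HTensor A E} (hω : IsDensity ω) (hρ : IsDensity ρ) {α : ℝ}
    (h1 : 1 < α) (h2 : α ≤ 2) :
    (1 / 2 : ℝ≥0∞) * ∫⁻ U : unitary (A →L[ℂ] A),
        schattenNorm 1 (decouplingOp b ω ρ (U : A →L[ℂ] A)) ∂haarUnitary A ≤
      ENNReal.ofReal (Real.exp ((1 - α) / α *
        (sandwichedCondEntropy α ω + sandwichedCondEntropy α ρ + Real.log 3))) := by
  have hexp : Real.exp ((1 - α) / α *
      (sandwichedCondEntropy α ω + sandwichedCondEntropy α ρ + Real.log 3)) =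
      (3 : ℝ) ^ (-((α - 1) / α)) * (sandwichedNorm α ω).toReal * (sandwichedNorm α ρ).toReal := by
    have h3 : (1 - α) / α * (sandwichedCondEntropy α ω + sandwichedCondEntropy α ρ + Real.log 3) =
        Real.log 3 * -((α - 1) / α) + Real.log (sandwichedNorm α ω).toReal +
          Real.log (sandwichedNorm α ρ).toReal := by
      have e1 := mul_sandwichedCondEntropy ω h1
      have e2 := mul_sandwichedCondEntropy ρ h1
      have e3 : (1 - α) / α = -((α - 1) / α) := by ring
      rw [e3]
      linarith
    rw [h3, Real.exp_add, Real.exp_add, Real.exp_log (toReal_sandwichedNorm_pos hω h1 h2),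
      Real.exp_log (toReal_sandwichedNorm_pos hρ h1 h2), ← Real.rpow_def_of_pos (by norm_num)]
  have hhalf : (1 / 2 : ℝ≥0∞) * ENNReal.ofReal (2 * (3 : ℝ) ^ (-((α - 1) / α))) =
      ENNReal.ofReal ((3 : ℝ) ^ (-((α - 1) / α))) := by
    rw [ENNReal.ofReal_mul two_pos.le, ← mul_assoc, ENNReal.ofReal_ofNat, one_div,
      ENNReal.inv_mul_cancel two_ne_zero ENNReal.ofNat_ne_top, one_mul]
  calc _ ≤ (1 / 2 : ℝ≥0∞) * (ENNReal.ofReal (2 * (3 : ℝ) ^ (-((α - 1) / α))) *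
        sandwichedNorm α ω * sandwichedNorm α ρ) := by
        gcongr
        exact lintegral_decouplingOp_le_sandwichedNorm b hω hρ h1 h2
    _ = _ := by
        rw [hexp, ENNReal.ofReal_mul (mul_nonneg (by positivity) ENNReal.toReal_nonneg),
          ENNReal.ofReal_mul (Real.rpow_nonneg (by norm_num : (0 : ℝ) ≤ 3) _),
          ENNReal.ofReal_toReal (sandwichedNorm_ne_top hω h1 h2),
          ENNReal.ofReal_toReal (sandwichedNorm_ne_top hρ h1 h2), ← mul_assoc, ← mul_assoc, hhalf]

/-- The bound for `α > 1` tends to `1` as `α → 1`, since the Rényi entropies stay bounded below. -/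
theorem half_lintegral_decouplingOp_le_one {ι : Type*} [Fintype ι] [Nonempty ι] [DecidableEq ι]
    (b : OrthonormalBasis ι ℂ A) {ω : HTensor A C →L[ℂ] HTensor A C}
    {ρ : HTensor A E →L[ℂ] HTensor A E} (hω : IsDensity ω) (hρ : IsDensity ρ) :
    (1 / 2 : ℝ≥0∞) * ∫⁻ U : unitary (A →L[ℂ] A),
        schattenNorm 1 (decouplingOp b ω ρ (U : A →L[ℂ] A)) ∂haarUnitary A ≤ 1 := by
  obtain ⟨K₁, hK₁⟩ := exists_le_mul_sandwichedCondEntropy hω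
  obtain ⟨K₂, hK₂⟩ := exists_le_mul_sandwichedCondEntropy hρ
  let φ : ℝ → ℝ := fun α => Real.exp (-((α - 1) / α *
    (condEntropy ω - K₁ * ((α - 1) / α) + (condEntropy ρ - K₂ * ((α - 1) / α)) + Real.log 3)))
  have hφ : ContinuousAt φ 1 := by
    have h0 : ContinuousAt (fun α : ℝ => (α - 1) / α) 1 :=
      (continuousAt_id.sub continuousAt_const).div continuousAt_id one_ne_zero
    exact Real.continuous_exp.continuousAt.comp (h0.mul
      (((continuousAt_const.sub (continuousAt_const.mul h0)).add
        (continuousAt_const.sub (continuousAt_const.mul h0))).add continuousAt_const)).neg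
  have hlim : Filter.Tendsto (fun α => ENNReal.ofReal (φ α)) (nhdsWithin 1 (Set.Ioi 1))
      (nhds 1) := by
    have h1 : Filter.Tendsto (fun α => ENNReal.ofReal (φ α)) (nhds 1)
        (nhds (ENNReal.ofReal (φ 1))) := (ENNReal.continuous_ofReal.tendsto _).comp hφ
    have h2 : ENNReal.ofReal (φ 1) = 1 := by simp [φ]
    rw [h2] at h1
    exact h1.mono_left nhdsWithin_le_nhds
  refine ge_of_tendsto hlim ?_
  filter_upwards [Ioc_mem_nhdsGT (one_lt_two : (1 : ℝ) < 2)] with α hα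
  refine (half_lintegral_decouplingOp_le b hω hρ hα.1 hα.2).trans ?_
  refine ENNReal.ofReal_le_ofReal (Real.exp_le_exp.2 ?_)
  have e1 := hK₁ α hα.1 hα.2
  have e2 := hK₂ α hα.1 hα.2
  have e3 : (1 - α) / α = -((α - 1) / α) := by ring
  rw [e3]
  linarith

/-- Positivity of the optimal Rényi exponent is equivalent to positivity of the sum of the
conditional entropies, its slope at `α = 1`. -/
theorem iSup_pos_iff {ω : HTensor A C →L[ℂ] HTensor A C}
    {ρ : HTensor A E →L[ℂ] HTensor A E} (hω : IsDensity ω) (hρ : IsDensity ρ) :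
    (0 : EReal) < ⨆ α : Set.Icc (1 : ℝ) 2,
        ((((α : ℝ) - 1) / (α : ℝ) *
          (sandwichedCondEntropy (α : ℝ) ρ + sandwichedCondEntropy (α : ℝ) ω) : ℝ) : EReal) ↔
      0 < condEntropy ω + condEntropy ρ := by
  rw [lt_iSup_iff]
  constructor
  · rintro ⟨⟨α, hα⟩, h⟩
    have h' : 0 < (α - 1) / α * (sandwichedCondEntropy α ρ + sandwichedCondEntropy α ω) := by
      exact_mod_cast h
    rcases hα.1.eq_or_lt with h1 | h1
    · rw [← h1] at h'; simp at h'
    have e1 := mul_sandwichedCondEntropy_le hω h1 hα.2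
    have e2 := mul_sandwichedCondEntropy_le hρ h1 hα.2
    have hu : 0 < (α - 1) / α := (one_sub_inv_bounds h1 hα.2).1
    have h3 : 0 < (α - 1) / α * (condEntropy ω + condEntropy ρ) := by linarith
    exact (mul_pos_iff_of_pos_left hu).1 h3
  · intro h
    obtain ⟨K₁, hK₁⟩ := exists_le_mul_sandwichedCondEntropy hω
    obtain ⟨K₂, hK₂⟩ := exists_le_mul_sandwichedCondEntropy hρ
    set K := |K₁ + K₂| + 1 with hK
    set D := condEntropy ω + condEntropy ρ with hD
    have hK0 : 0 < K := by positivity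
    set x := min (1 / 2) (D / K) with hx
    have hx0 : 0 < x := lt_min (by norm_num) (div_pos h hK0)
    have hx1 : x ≤ 1 / 2 := min_le_left _ _
    have hx2 : x * K ≤ D := by
      have := min_le_right (1 / 2) (D / K)
      rwa [le_div_iff₀ hK0] at this
    have h1x : 0 < 1 - x := by linarith
    -- the order with `(α - 1) / α = x`
    have hα1 : 1 < 1 / (1 - x) := by rw [lt_div_iff₀ h1x]; linarith
    have hα2 : 1 / (1 - x) ≤ 2 := by rw [div_le_iff₀ h1x]; linarith
    have hαx : (1 / (1 - x) - 1) / (1 / (1 - x)) = x := by field_simp; ring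
    refine ⟨⟨1 / (1 - x), hα1.le, hα2⟩, ?_⟩
    have e1 := hK₁ _ hα1 hα2
    have e2 := hK₂ _ hα1 hα2
    simp only [hαx] at e1 e2 ⊢
    have h3 : 0 < x * (D - (K₁ + K₂) * x) := by
      refine mul_pos hx0 ?_
      have := mul_le_mul_of_nonneg_right (le_abs_self (K₁ + K₂)) hx0.le
      rw [hK] at hx2
      linarith
    have h4 : 0 < x * (sandwichedCondEntropy (1 / (1 - x)) ρ +
        sandwichedCondEntropy (1 / (1 - x)) ω) := by
      rw [hD] at h3
      linarith
    exact_mod_cast h4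

end DecouplingBound

end Decoupling

end

theorem theorem1p2
    {A : Type*} [NormedAddCommGroup A] [InnerProductSpace ℂ A] [CompleteSpace A]
    [FiniteDimensional ℂ A]
    {C : Type*} [NormedAddCommGroup C] [InnerProductSpace ℂ C] [CompleteSpace C]
    [TopologicalSpace.SeparableSpace C]
    {E : Type*} [NormedAddCommGroup E] [InnerProductSpace ℂ E] [CompleteSpace E]
    [TopologicalSpace.SeparableSpace E]
    {ι : Type*} [Fintype ι] (b : OrthonormalBasis ι ℂ A)
    (ρ : Decoupling.HTensor A E →L[ℂ] Decoupling.HTensor A E) (hρ : Decoupling.IsDensity ρ)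
    (T : (A →L[ℂ] A) →CP (C →L[ℂ] C)) (hT : Decoupling.IsChannel T) :
    (∀ α ∈ Set.Icc (1 : ℝ) 2,
      (1 / 2 : ℝ≥0∞) * ∫⁻ U : unitary (A →L[ℂ] A),
          Decoupling.schattenNorm 1
            (Decoupling.ampliation T.toLinearMap
                (Decoupling.opTensor (U : A →L[ℂ] A) (1 : E →L[ℂ] E) * ρ *
                  Decoupling.opTensor (star (U : A →L[ℂ] A)) (1 : E →L[ℂ] E)) -
              Decoupling.opTensor (Decoupling.partialTrace (Decoupling.choi b T))
                (Decoupling.partialTrace ρ))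
          ∂(Decoupling.haarUnitary A) ≤
        ENNReal.ofReal (Real.exp ((1 - α) / α *
          (Decoupling.sandwichedCondEntropy α (Decoupling.choi b T) +
            Decoupling.sandwichedCondEntropy α ρ + Real.log 3)))) ∧
    ((0 : EReal) < ⨆ α : Set.Icc (1 : ℝ) 2,
        ((((α : ℝ) - 1) / (α : ℝ) *
          (Decoupling.sandwichedCondEntropy (α : ℝ) ρ +
            Decoupling.sandwichedCondEntropy (α : ℝ) (Decoupling.choi b T)) : ℝ) : EReal) ↔
      0 < Decoupling.condEntropy (Decoupling.choi b T) + Decoupling.condEntropy ρ) := by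
  classical
  have : Nonempty ι := Decoupling.nonempty_of_isDensity b hρ
  have hω := Decoupling.isDensity_choi b hT
  refine ⟨fun α hα => ?_, Decoupling.iSup_pos_iff hω hρ⟩
  have hop : ∀ U : unitary (A →L[ℂ] A),
      Decoupling.ampliation T.toLinearMap
          (Decoupling.opTensor (U : A →L[ℂ] A) (1 : E →L[ℂ] E) * ρ *
            Decoupling.opTensor (star (U : A →L[ℂ] A)) (1 : E →L[ℂ] E)) -
        Decoupling.opTensor (Decoupling.partialTrace (Decoupling.choi b T))
          (Decoupling.partialTrace ρ) =
      Decoupling.decouplingOp b (Decoupling.choi b T) ρ (U : A →L[ℂ] A) :=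
    fun U => Decoupling.ampliation_sub_eq_sum b T U ρ
  simp_rw [hop]
  rcases hα.1.eq_or_lt with h1 | h1
  · -- at `α = 1` the right-hand side is `exp 0`
    rw [← h1, sub_self, zero_div, zero_mul, Real.exp_zero, ENNReal.ofReal_one]
    exact Decoupling.half_lintegral_decouplingOp_le_one b hω hρ
  · exact Decoupling.half_lintegral_decouplingOp_le b hω hρ h1 hα.2
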